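/- Let $L/K$ be a finite separable extension of fields (for example a finite Galois extension) and let $\mathcal C$ be a $K$-linear abelian category with enough injectives and with a family of generators. Let $\mathcal C_L$ be the abelian, $L$-linear category of $L$-module objects in $\mathcal C$: its objects are pairs $(X,f)$ with $X\in\mathcal C$ and $f\colon L\to\operatorname{End}_{\mathcal C}(X)$ a homomorphism of $K$-algebras, and its morphisms are the morphisms of $\mathcal C$ compatible with the actions of $L$. Let $\mathcal A$ be the DG-category over $K$ of bounded below complexes of injective objects of $\mathcal C$ with bounded cohomology (the standard enhancement $H^0(\mathcal A)\cong D^b(\mathcal C)$). Let $\mathcal A_L$ be the DG-category over $L$ whose objects are pairs $(X,f)$ with $X\in\mathcal A$ and $f\colon L\to\operatorname{End}_{\mathcal A}(X)$ a homomorphism of DG-algebras over $K$ ($L$ placed in degree $0$), and whose morphism complexes consist of the morphisms compatible with the actions of $L$. Let $(\mathcal A_L)^{\mathrm{pretr}}$ be its pretriangulated hull (one-sided twisted complexes $(\bigoplus_i C_i[r_i],q)$ with $dq+q^2=0$). Define $D^b(\mathcal C)_L$ to be the smallest full triangulated subcategory of $H^0((\mathcal A_L)^{\mathrm{pretr}})$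 that is closed under direct summands and contains the objects $L\otimes_K X$ for all $X\in\mathcal A$, where $L\otimes_K X$ is the direct sum of $[L:K]$ copies of $X$ with its natural $L$-action. Then $D^b(\mathcal C)_L$ is equivalent to $D^b(\mathcal C_L)$ as an $L$-linear triangulated category: there is an $L$-linear equivalence of categories that commutes with the translation functors up to a natural isomorphism and under which the distinguished triangles correspond. -/

import Mathlib

open CategoryTheory CategoryTheory.Limits

universe w w' v v' u u'

noncomputable section

/-- A differential graded category over `k`.  `comp f g h` is "first `f`, then `g`"; the Leibniz rule
`d (g ∘ f) = dg ∘ f + (-1)^|g| g ∘ df` is written in this order.  `d n m` is the differential if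
`n + 1 = m` and zero otherwise. -/
structure DGCat (k : Type w) [CommRing k] where
  Obj : Type u
  Hom : Obj → Obj → ℤ → Type v
  [addCommGroup : ∀ X Y n, AddCommGroup (Hom X Y n)]
  [module : ∀ X Y n, Module k (Hom X Y n)]
  d : ∀ {X Y : Obj} (n m : ℤ), Hom X Y n →ₗ[k] Hom X Y m
  id : ∀ X : Obj, Hom X X 0
  comp : ∀ {X Y Z : Obj} {p q n : ℤ}, Hom X Y p → Hom Y Z q → p + q = n → Hom X Z n
  d_shape : ∀ {X Y : Obj} (n m : ℤ) (f : Hom X Y n), n + 1 ≠ m → d n m f = 0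
  d_d : ∀ {X Y : Obj} (n m l : ℤ) (f : Hom X Y n), d m l (d n m f) = 0
  d_id : ∀ (X : Obj) (m : ℤ), d 0 m (id X) = 0
  add_comp : ∀ {X Y Z : Obj} {p q n : ℤ} (f f' : Hom X Y p) (g : Hom Y Z q) (h : p + q = n),
    comp (f + f') g h = comp f g h + comp f' g h
  comp_add : ∀ {X Y Z : Obj} {p q n : ℤ} (f : Hom X Y p) (g g' : Hom Y Z q) (h : p + q = n),
    comp f (g + g') h = comp f g h + comp f g' h
  smul_comp : ∀ {X Y Z : Obj} {p q n : ℤ} (c : k) (f : Hom X Y p) (g : Hom Y Z q) (h : p + q = n),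
    comp (c • f) g h = c • comp f g h
  comp_smul : ∀ {X Y Z : Obj} {p q n : ℤ} (c : k) (f : Hom X Y p) (g : Hom Y Z q) (h : p + q = n),
    comp f (c • g) h = c • comp f g h
  id_comp : ∀ {X Y : Obj} {n : ℤ} (f : Hom X Y n), comp (id X) f (zero_add n) = f
  comp_id : ∀ {X Y : Obj} {n : ℤ} (f : Hom X Y n), comp f (id Y) (add_zero n) = f
  assoc : ∀ {W X Y Z : Obj} {p q r pq qr n : ℤ} (f : Hom W X p) (g : Hom X Y q) (e : Hom Y Z r)
    (h₁ : p + q = pq) (h₂ : q + r = qr) (h₃ : pq + r = n) (h₄ : p + qr = n),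
    comp (comp f g h₁) e h₃ = comp f (comp g e h₂) h₄
  leibniz : ∀ {X Y Z : Obj} {p q n p' q' n' : ℤ} (f : Hom X Y p) (g : Hom Y Z q) (h : p + q = n)
    (hp : p + 1 = p') (hq : q + 1 = q') (hn : n + 1 = n'),
    d n n' (comp f g h) =
      comp f (d q q' g) (by omega) + q.negOnePow • comp (d p p' f) g (by omega)

namespace DGCat

attribute [instance] DGCat.addCommGroup DGCat.module

section Basic

variable {k : Type w} [CommRing k] (A : DGCat.{w, v, u} k)

/-- Composition as an additive map in the first variable. -/
def compLeft {X Y Z : A.Obj} {p q n : ℤ} (g : A.Hom Y Z q) (h : p + q = n) :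
    A.Hom X Y p →+ A.Hom X Z n :=
  AddMonoidHom.mk' (fun f => A.comp f g h) (fun f f' => A.add_comp f f' g h)

/-- Composition as an additive map in the second variable. -/
def compRight {X Y Z : A.Obj} {p q n : ℤ} (f : A.Hom X Y p) (h : p + q = n) :
    A.Hom Y Z q →+ A.Hom X Z n :=
  AddMonoidHom.mk' (fun g => A.comp f g h) (fun g g' => A.comp_add f g g' h)

lemma zero_comp {X Y Z : A.Obj} {p q n : ℤ} (g : A.Hom Y Z q) (h : p + q = n) :
    A.comp (0 : A.Hom X Y p) g h = 0 := (A.compLeft g h).map_zero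

lemma comp_zero {X Y Z : A.Obj} {p q n : ℤ} (f : A.Hom X Y p) (h : p + q = n) :
    A.comp f (0 : A.Hom Y Z q) h = 0 := (A.compRight f h).map_zero

lemma neg_comp {X Y Z : A.Obj} {p q n : ℤ} (f : A.Hom X Y p) (g : A.Hom Y Z q) (h : p + q = n) :
    A.comp (-f) g h = -A.comp f g h := (A.compLeft g h).map_neg f

lemma comp_neg {X Y Z : A.Obj} {p q n : ℤ} (f : A.Hom X Y p) (g : A.Hom Y Z q) (h : p + q = n) :
    A.comp f (-g) h = -A.comp f g h := (A.compRight f h).map_neg g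

lemma sub_comp {X Y Z : A.Obj} {p q n : ℤ} (f f' : A.Hom X Y p) (g : A.Hom Y Z q)
    (h : p + q = n) : A.comp (f - f') g h = A.comp f g h - A.comp f' g h :=
  (A.compLeft g h).map_sub f f'

lemma comp_sub {X Y Z : A.Obj} {p q n : ℤ} (f : A.Hom X Y p) (g g' : A.Hom Y Z q)
    (h : p + q = n) : A.comp f (g - g') h = A.comp f g h - A.comp f g' h :=
  (A.compRight f h).map_sub g g'

lemma sum_comp {ι : Type*} (s : Finset ι) {X Y Z : A.Obj} {p q n : ℤ} (f : ι → A.Hom X Y p)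
    (g : A.Hom Y Z q) (h : p + q = n) :
    A.comp (∑ i ∈ s, f i) g h = ∑ i ∈ s, A.comp (f i) g h := map_sum (A.compLeft g h) f s

lemma comp_sum {ι : Type*} (s : Finset ι) {X Y Z : A.Obj} {p q n : ℤ} (f : A.Hom X Y p)
    (g : ι → A.Hom Y Z q) (h : p + q = n) :
    A.comp f (∑ i ∈ s, g i) h = ∑ i ∈ s, A.comp f (g i) h := map_sum (A.compRight f h) g s

lemma units_smul_comp {X Y Z : A.Obj} {p q n : ℤ} (e : ℤˣ) (f : A.Hom X Y p) (g : A.Hom Y Z q)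
    (h : p + q = n) : A.comp (e • f) g h = e • A.comp f g h :=
  map_zsmul (A.compLeft g h) (e : ℤ) f

lemma comp_units_smul {X Y Z : A.Obj} {p q n : ℤ} (e : ℤˣ) (f : A.Hom X Y p) (g : A.Hom Y Z q)
    (h : p + q = n) : A.comp f (e • g) h = e • A.comp f g h :=
  map_zsmul (A.compRight f h) (e : ℤ) g

lemma d_units_smul {X Y : A.Obj} (n m : ℤ) (e : ℤˣ) (f : A.Hom X Y n) :
    A.d n m (e • f) = e • A.d n m f := map_zsmul (A.d n m) (e : ℤ) f

/-- Identification of morphism groups along an equality of degrees. -/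
def cast {X Y : A.Obj} {n m : ℤ} (h : n = m) (f : A.Hom X Y n) : A.Hom X Y m := h ▸ f

lemma comp_cast {X Y Z : A.Obj} {p q q' n : ℤ} (f : A.Hom X Y p) (g : A.Hom Y Z q) (hq : q = q')
    (h : p + q' = n) : A.comp f (A.cast hq g) h = A.comp f g (by omega) := by subst hq; rfl

lemma cast_comp {X Y Z : A.Obj} {p p' q n : ℤ} (f : A.Hom X Y p) (g : A.Hom Y Z q) (hp : p = p')
    (h : p' + q = n) : A.comp (A.cast hp f) g h = A.comp f g (by omega) := by subst hp; rfl

lemma d_cast {X Y : A.Obj} {n n' : ℤ} (m : ℤ) (f : A.Hom X Y n) (h : n = n') :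
    A.d n' m (A.cast h f) = A.d n m f := by subst h; rfl

lemma cast_d {X Y : A.Obj} {m m' : ℤ} (n : ℤ) (f : A.Hom X Y n) (h : m = m') :
    A.cast h (A.d n m f) = A.d n m' f := by subst h; rfl

/-- The identity, regarded as a morphism of degree `n = 0` between equal objects. -/
def eqId {X Y : A.Obj} {n : ℤ} (h : X = Y) (hn : n = 0) : A.Hom X Y n := by
  subst h; subst hn; exact A.id X

lemma d_eqId {X Y : A.Obj} {n : ℤ} (h : X = Y) (hn : n = 0) (m : ℤ) :
    A.d n m (A.eqId h hn) = 0 := by subst h; subst hn; exact A.d_id X m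

/-! ### The category of closed morphisms of degree zero and the homotopy category -/

/-- The objects of `A`, as objects of the category `Z⁰(A)`. -/
structure Z0 where
  obj : A.Obj

variable {A}

/-- Closed morphisms of degree zero. -/
@[ext]
structure Z0.Hom (X Y : Z0 A) where
  val : A.Hom X.obj Y.obj 0
  closed : A.d 0 1 val = 0

namespace Z0

instance : Category (Z0 A) where
  Hom X Y := Z0.Hom X Y
  id X := ⟨A.id X.obj, A.d_id _ _⟩
  comp f g := ⟨A.comp f.val g.val (add_zero 0), by
    rw [A.leibniz f.val g.val (add_zero 0) (zero_add 1) (zero_add 1) (zero_add 1), f.closed,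
      g.closed, A.comp_zero, A.zero_comp, smul_zero, add_zero]⟩
  id_comp f := Z0.Hom.ext (A.id_comp _)
  comp_id f := Z0.Hom.ext (A.comp_id _)
  assoc f g h := Z0.Hom.ext (A.assoc _ _ _ _ _ _ _)

@[ext] lemma hom_ext {X Y : Z0 A} {f g : X ⟶ Y} (h : f.val = g.val) : f = g := Z0.Hom.ext h

@[simp] lemma id_val (X : Z0 A) : (𝟙 X : X ⟶ X).val = A.id X.obj := rfl

@[simp] lemma comp_val {X Y W : Z0 A} (f : X ⟶ Y) (g : Y ⟶ W) :
    (f ≫ g).val = A.comp f.val g.val (add_zero 0) := rfl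

instance (X Y : Z0 A) : Zero (X ⟶ Y) := ⟨⟨0, map_zero _⟩⟩
instance (X Y : Z0 A) : Add (X ⟶ Y) :=
  ⟨fun f g => ⟨f.val + g.val, by rw [map_add, f.closed, g.closed, add_zero]⟩⟩
instance (X Y : Z0 A) : Neg (X ⟶ Y) := ⟨fun f => ⟨-f.val, by rw [map_neg, f.closed, neg_zero]⟩⟩
instance (X Y : Z0 A) : Sub (X ⟶ Y) :=
  ⟨fun f g => ⟨f.val - g.val, by rw [map_sub, f.closed, g.closed, sub_zero]⟩⟩
instance (X Y : Z0 A) : SMul k (X ⟶ Y) :=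
  ⟨fun c f => ⟨c • f.val, by rw [map_smul, f.closed, smul_zero]⟩⟩
instance (X Y : Z0 A) : SMul ℕ (X ⟶ Y) :=
  ⟨fun c f => ⟨c • f.val, by rw [map_nsmul, f.closed, smul_zero]⟩⟩
instance (X Y : Z0 A) : SMul ℤ (X ⟶ Y) :=
  ⟨fun c f => ⟨c • f.val, by rw [map_zsmul, f.closed, smul_zero]⟩⟩

lemma val_injective (X Y : Z0 A) : Function.Injective (fun f : X ⟶ Y => f.val) :=
  fun _ _ h => Z0.Hom.ext h

instance (X Y : Z0 A) : AddCommGroup (X ⟶ Y) :=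
  (val_injective X Y).addCommGroup _ rfl (fun _ _ => rfl) (fun _ => rfl) (fun _ _ => rfl)
    (fun _ _ => rfl) (fun _ _ => rfl)

@[simp] lemma add_val {X Y : Z0 A} (f g : X ⟶ Y) : (f + g).val = f.val + g.val := rfl

@[simp] lemma smul_val {X Y : Z0 A} (c : k) (f : X ⟶ Y) : (c • f).val = c • f.val := rfl

/-- The underlying morphism, as an additive map. -/
def valHom (X Y : Z0 A) : (X ⟶ Y) →+ A.Hom X.obj Y.obj 0 := AddMonoidHom.mk' (fun f => f.val)
  (fun _ _ => rfl)

instance (X Y : Z0 A) : Module k (X ⟶ Y) :=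
  (val_injective X Y).module k (valHom X Y) (fun _ _ => rfl)

instance : Preadditive (Z0 A) where
  add_comp _ _ _ _ _ _ := Z0.Hom.ext (A.add_comp _ _ _ _)
  comp_add _ _ _ _ _ _ := Z0.Hom.ext (A.comp_add _ _ _ _)

instance : Linear k (Z0 A) where
  smul_comp _ _ _ _ _ _ := Z0.Hom.ext (A.smul_comp _ _ _ _)
  comp_smul _ _ _ _ _ _ := Z0.Hom.ext (A.comp_smul _ _ _ _)

end Z0

variable (A)

/-- Two closed morphisms of degree zero are homotopic if they differ by a boundary. -/
def homotopic : HomRel (Z0 A) := fun X Y f g =>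
  ∃ s : A.Hom X.obj Y.obj (-1), A.d (-1) 0 s = f.val - g.val

instance : Congruence (homotopic A) where
  equivalence :=
    { refl := fun f => ⟨0, by rw [map_zero, sub_self]⟩
      symm := fun ⟨s, hs⟩ => ⟨-s, by rw [map_neg, hs, neg_sub]⟩
      trans := fun ⟨s, hs⟩ ⟨t, ht⟩ => ⟨s + t, by rw [map_add, hs, ht, sub_add_sub_cancel]⟩ }
  comp_left := by
    rintro X Y W f g g' ⟨s, hs⟩
    refine ⟨A.comp f.val s (zero_add _), ?_⟩
    rw [A.leibniz f.val s (zero_add _) (zero_add 1) (neg_add_cancel 1) (neg_add_cancel 1),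
      f.closed, A.zero_comp, smul_zero, add_zero, hs, A.comp_sub]
    rfl
  comp_right := by
    rintro X Y W f f' g ⟨s, hs⟩
    refine ⟨A.comp s g.val (add_zero _), ?_⟩
    rw [A.leibniz s g.val (add_zero _) (neg_add_cancel 1) (zero_add 1) (neg_add_cancel 1),
      g.closed, A.comp_zero, zero_add, Int.negOnePow_zero, one_smul, hs, A.sub_comp]
    rfl

/-- The homotopy category `H⁰(A)`: the same objects, and `H⁰` of the morphism complexes. -/
def H0 : Type _ := CategoryTheory.Quotient (homotopic A)

namespace H0

instance : Category (H0 A) := inferInstanceAs (Category (CategoryTheory.Quotient (homotopic A)))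

/-- The projection `Z⁰(A) ⥤ H⁰(A)`. -/
def quotient : Z0 A ⥤ H0 A := CategoryTheory.Quotient.functor (homotopic A)

lemma quotient_map_eq_iff {X Y : Z0 A} (f g : X ⟶ Y) :
    (quotient A).map f = (quotient A).map g ↔ homotopic A f g :=
  CategoryTheory.Quotient.functor_map_eq_iff (homotopic A) f g

instance : Preadditive (CategoryTheory.Quotient (homotopic A)) :=
  CategoryTheory.Quotient.preadditive _ (by
    rintro X Y f₁ f₂ g₁ g₂ ⟨s, hs⟩ ⟨t, ht⟩
    exact ⟨s + t, by rw [map_add, hs, ht, Z0.add_val, Z0.add_val, add_sub_add_comm]⟩)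

instance : (CategoryTheory.Quotient.functor (homotopic A)).Additive where

instance : Preadditive (H0 A) :=
  inferInstanceAs (Preadditive (CategoryTheory.Quotient (homotopic A)))

instance : Linear k (H0 A) :=
  CategoryTheory.Quotient.linear k (homotopic A) (by
    rintro c X Y f g ⟨s, hs⟩
    exact ⟨c • s, by rw [map_smul, hs, Z0.smul_val, Z0.smul_val, smul_sub]⟩)

end H0

/-! ### Translation and distinguished triangles -/

/-- A translation on a DG-category: for every object `X` an object `X[1]` with mutually inverse closed
morphisms `σ : X[1] ⟶ X` of degree `1` and `τ : X ⟶ X[1]` of degree `-1`. -/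
structure Translation where
  obj : A.Obj → A.Obj
  σ : ∀ X, A.Hom (obj X) X 1
  τ : ∀ X, A.Hom X (obj X) (-1)
  d_σ : ∀ X, A.d 1 2 (σ X) = 0
  d_τ : ∀ X, A.d (-1) 0 (τ X) = 0
  σ_τ : ∀ X, A.comp (σ X) (τ X) (add_neg_cancel 1) = A.id (obj X)
  τ_σ : ∀ X, A.comp (τ X) (σ X) (neg_add_cancel 1) = A.id X

/-- A cone of a closed morphism `f : X ⟶ Y` of degree zero: an object `Z` which is, as a graded object,
the direct sum of `Y` (via `i`, `j`) and of `X` shifted by one (via `s`, `p`), with the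
differential given by `d i = 0` and `d s = i ∘ f`. -/
structure Cone {X Y : Z0 A} (f : X ⟶ Y) (Z : Z0 A) where
  i : A.Hom Y.obj Z.obj 0
  j : A.Hom Z.obj Y.obj 0
  s : A.Hom X.obj Z.obj (-1)
  p : A.Hom Z.obj X.obj 1
  i_j : A.comp i j (add_zero 0) = A.id Y.obj
  i_p : A.comp i p (zero_add 1) = 0
  s_j : A.comp s j (add_zero (-1)) = 0
  s_p : A.comp s p (neg_add_cancel 1) = A.id X.obj
  total : A.comp j i (add_zero 0) + A.comp p s (add_neg_cancel 1) = A.id Z.obj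
  d_i : A.d 0 1 i = 0
  d_p : A.d 1 2 p = 0
  d_s : A.d (-1) 0 s = A.comp f.val i (add_zero 0)

namespace Translation

variable {A} (T : A.Translation)

/-- The translation functor on `Z⁰(A)`: `f[1] = τ ∘ f ∘ σ`. -/
def functorZ0 : Z0 A ⥤ Z0 A where
  obj X := ⟨T.obj X.obj⟩
  map {X Y} f := ⟨A.comp (A.comp (T.σ X.obj) f.val (add_zero 1)) (T.τ Y.obj) (add_neg_cancel 1), by
    rw [A.leibniz _ _ (add_neg_cancel 1) (one_add_one_eq_two) (neg_add_cancel 1) (zero_add 1),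
      A.leibniz _ _ (add_zero 1) (one_add_one_eq_two) (zero_add 1) (one_add_one_eq_two), T.d_σ,
      T.d_τ, f.closed, A.comp_zero, A.comp_zero, A.zero_comp, smul_zero, add_zero, A.zero_comp,
      smul_zero, add_zero]⟩
  map_id X := by
    ext
    dsimp
    rw [A.comp_id, T.σ_τ]
  map_comp {X Y W} f g := by
    ext
    dsimp
    rw [A.assoc (A.comp (T.σ X.obj) f.val (add_zero 1)) (T.τ Y.obj)
      (A.comp (A.comp (T.σ Y.obj) g.val (add_zero 1)) (T.τ W.obj) (add_neg_cancel 1))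
      (add_neg_cancel 1) (add_zero (-1)) (add_zero 0) (add_neg_cancel 1),
      ← A.assoc (T.τ Y.obj) (A.comp (T.σ Y.obj) g.val (add_zero 1)) (T.τ W.obj)
      (neg_add_cancel 1) (add_neg_cancel 1) (zero_add (-1)) (add_zero (-1)),
      ← A.assoc (T.τ Y.obj) (T.σ Y.obj) g.val (neg_add_cancel 1) (add_zero 1) (add_zero 0)
      (neg_add_cancel 1), T.τ_σ, A.id_comp,
      ← A.assoc (A.comp (T.σ X.obj) f.val (add_zero 1)) g.val (T.τ W.obj) (add_zero 1)
      (zero_add (-1)) (add_neg_cancel 1) (add_neg_cancel 1),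
      A.assoc (T.σ X.obj) f.val g.val (add_zero 1) (add_zero 0) (add_zero 1) (add_zero 1)]

/-- The translation functor on the homotopy category `H⁰(A)`. -/
def functor : H0 A ⥤ H0 A :=
  CategoryTheory.Quotient.lift (homotopic A) (T.functorZ0 ⋙ H0.quotient A) (by
    rintro X Y f g ⟨s, hs⟩
    have key : A.d (-1) 0
        (-(A.comp (A.comp (T.σ X.obj) s (add_neg_cancel 1)) (T.τ Y.obj) (zero_add (-1)))) =
        A.comp (A.comp (T.σ X.obj) f.val (add_zero 1)) (T.τ Y.obj) (add_neg_cancel 1) -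
        A.comp (A.comp (T.σ X.obj) g.val (add_zero 1)) (T.τ Y.obj) (add_neg_cancel 1) := by
      rw [map_neg, A.leibniz _ _ (zero_add (-1)) (zero_add 1) (neg_add_cancel 1)
        (neg_add_cancel 1), A.leibniz _ _ (add_neg_cancel 1) (one_add_one_eq_two)
        (neg_add_cancel 1) (zero_add 1), T.d_σ, T.d_τ, hs, A.comp_zero, A.zero_comp, smul_zero,
        add_zero, zero_add, A.comp_sub, A.sub_comp]
      simp
    exact (H0.quotient_map_eq_iff A _ _).2 ⟨_, key⟩)

/-- The morphism `Z ⟶ X[1]` of degree zero attached to a cone `Z` of `X ⟶ Y`. -/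
def coneToTranslation {X Y Z : Z0 A} {f : X ⟶ Y} (c : A.Cone f Z) : Z ⟶ T.functorZ0.obj X :=
  ⟨A.comp c.p (T.τ X.obj) (add_neg_cancel 1), by
    change A.d (Y := T.obj X.obj) 0 1 (A.comp c.p (T.τ X.obj) (add_neg_cancel 1)) = 0
    rw [A.leibniz _ _ (add_neg_cancel 1) (one_add_one_eq_two) (neg_add_cancel 1) (zero_add 1),
      T.d_τ, c.d_p, A.comp_zero, A.zero_comp, smul_zero, add_zero]⟩

/-- A triangle `X ⟶ Y ⟶ Z ⟶ X[1]` in `H⁰(A)` is distinguished if it is isomorphic to the triangle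
given by a cone of a closed morphism of degree zero. -/
def Distinguished {X Y Z : H0 A} (f : X ⟶ Y) (g : Y ⟶ Z) (h : Z ⟶ T.functor.obj X) : Prop :=
  ∃ (X' Y' Z' : Z0 A) (φ : X' ⟶ Y') (c : A.Cone φ Z')
    (a : X ≅ (H0.quotient A).obj X') (b : Y ≅ (H0.quotient A).obj Y')
    (e : Z ≅ (H0.quotient A).obj Z'),
    f ≫ b.hom = a.hom ≫ (H0.quotient A).map φ ∧
    g ≫ e.hom = b.hom ≫ (H0.quotient A).map ⟨c.i, c.d_i⟩ ∧
    h ≫ T.functor.map a.hom = e.hom ≫ (H0.quotient A).map (T.coneToTranslation c)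

/-- Thick full triangulated subcategories of `H⁰(A)`: closed under isomorphisms, containing the zero
objects, closed under translation in both directions, cones and direct summands. -/
structure IsThick (P : ObjectProperty (H0 A)) : Prop where
  of_iso : ∀ {X Y : H0 A}, (X ≅ Y) → P X → P Y
  zero : ∀ {X : H0 A}, IsZero X → P X
  translation : ∀ X : H0 A, P (T.functor.obj X) ↔ P X
  cone : ∀ {X Y Z : H0 A} (f : X ⟶ Y) (g : Y ⟶ Z) (h : Z ⟶ T.functor.obj X),
    T.Distinguished f g h → P X → P Y → P Z
  summand : ∀ {X Y : H0 A} (i : X ⟶ Y) (r : Y ⟶ X), i ≫ r = 𝟙 X → P Y → P X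

/-- The smallest thick full triangulated subcategory of `H⁰(A)` which contains `S`. -/
def thickClosure (S : ObjectProperty (H0 A)) : ObjectProperty (H0 A) :=
  fun X => ∀ P : ObjectProperty (H0 A), T.IsThick P → S ≤ P → P X

lemma thickClosure_translation (S : ObjectProperty (H0 A)) {X : H0 A} (hX : T.thickClosure S X) :
    T.thickClosure S (T.functor.obj X) :=
  fun P hP hS => (hP.translation X).2 (hX P hP hS)

/-- The translation functor on the thick closure. -/
def thickClosureFunctor (S : ObjectProperty (H0 A)) :
    (T.thickClosure S).FullSubcategory ⥤ (T.thickClosure S).FullSubcategory :=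
  (T.thickClosure S).lift ((T.thickClosure S).ι ⋙ T.functor)
    (fun X => T.thickClosure_translation S X.property)

end Translation

/-! ### Module objects in a DG-category -/

end Basic

section ModuleObjects

variable {K : Type w} [Field K] (A : DGCat.{w, v, u} K) (L : Type w') [Field L] [Algebra K L]

/-- An object of `A` with a morphism of DG-algebras `L ⟶ End(X)`; as `L` sits in degree zero and has
zero differential, this is a morphism of `K`-algebras into the closed endomorphisms of
degree zero. -/
structure LObj where
  obj : A.Obj
  act : L →ₗ[K] A.Hom obj obj 0
  act_one : act 1 = A.id obj
  act_mul : ∀ a b, act (a * b) = A.comp (act b) (act a) (add_zero 0)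
  d_act : ∀ a, A.d 0 1 (act a) = 0

variable {A L}

/-- The morphisms of degree `n` which are compatible with the actions of `L`. -/
def LHom (X Y : LObj A L) (n : ℤ) : AddSubgroup (A.Hom X.obj Y.obj n) where
  carrier := {α | ∀ l, A.comp (X.act l) α (zero_add n) = A.comp α (Y.act l) (add_zero n)}
  add_mem' := by
    intro a b ha hb l
    rw [A.comp_add, A.add_comp, ha l, hb l]
  zero_mem' := by
    intro l
    rw [A.comp_zero, A.zero_comp]
  neg_mem' := by
    intro a ha l
    rw [A.comp_neg, A.neg_comp, ha l]

lemma LObj.act_comm (X : LObj A L) (a b : L) :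
    A.comp (X.act a) (X.act b) (add_zero 0) = A.comp (X.act b) (X.act a) (add_zero 0) := by
  rw [← X.act_mul, ← X.act_mul, mul_comm]

/-- The scalar multiplication of `L` on morphisms: `l • α = α ∘ f(l)`. -/
instance (X Y : LObj A L) (n : ℤ) : SMul L (LHom X Y n) where
  smul l α := ⟨A.comp (X.act l) α.1 (zero_add n), fun m => by
    rw [← A.assoc (X.act m) (X.act l) α.1 (add_zero 0) (zero_add n) (zero_add n) (zero_add n),
      X.act_comm, A.assoc (X.act l) (X.act m) α.1 (add_zero 0) (zero_add n) (zero_add n)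
      (zero_add n), α.2 m, A.assoc (X.act l) α.1 (Y.act m) (zero_add n) (add_zero n)]⟩

lemma LHom.smul_val {X Y : LObj A L} {n : ℤ} (l : L) (α : LHom X Y n) :
    (l • α).1 = A.comp (X.act l) α.1 (zero_add n) := rfl

instance (X Y : LObj A L) (n : ℤ) : Module L (LHom X Y n) where
  one_smul α := Subtype.ext (by rw [LHom.smul_val, X.act_one, A.id_comp])
  mul_smul a b α := Subtype.ext (by
    rw [LHom.smul_val, LHom.smul_val, LHom.smul_val, mul_comm, X.act_mul,
      A.assoc _ _ _ _ (zero_add n) _ (zero_add n)])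
  smul_zero a := Subtype.ext (A.comp_zero _ _)
  smul_add a α β := Subtype.ext (A.comp_add _ _ _ _)
  add_smul a b α := Subtype.ext (by
    rw [LHom.smul_val, map_add, A.add_comp]; rfl)
  zero_smul α := Subtype.ext (by rw [LHom.smul_val, map_zero, A.zero_comp]; rfl)

lemma LObj.d_comp_act {X Y : LObj A L} {n : ℤ} (m : ℤ) (l : L) (α : A.Hom X.obj Y.obj n) :
    A.d n m (A.comp (X.act l) α (zero_add n)) = A.comp (X.act l) (A.d n m α) (zero_add m) := by
  by_cases h : n + 1 = m
  · rw [A.leibniz _ _ (zero_add n) (zero_add 1) h h, X.d_act, A.zero_comp, smul_zero, add_zero]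
  · rw [A.d_shape _ _ _ h, A.d_shape _ _ _ h, A.comp_zero]

lemma LObj.d_act_comp {X Y : LObj A L} {n : ℤ} (m : ℤ) (l : L) (α : A.Hom X.obj Y.obj n) :
    A.d n m (A.comp α (Y.act l) (add_zero n)) = A.comp (A.d n m α) (Y.act l) (add_zero m) := by
  by_cases h : n + 1 = m
  · rw [A.leibniz _ _ (add_zero n) h (zero_add 1) h, Y.d_act, A.comp_zero, Int.negOnePow_zero,
      one_smul, zero_add]
  · rw [A.d_shape _ _ _ h, A.d_shape _ _ _ h, A.zero_comp]

variable (A L)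

/-- The DG-category `A_L` over `L` of `L`-module objects in the DG-category `A` over `K`. -/
def scalarExt : DGCat.{w', v, max u v w'} L where
  Obj := LObj A L
  Hom X Y n := LHom X Y n
  d {X Y} n m :=
    { toFun := fun α => ⟨A.d n m α.1, fun l => by
        rw [← LObj.d_comp_act, α.2 l, LObj.d_act_comp]⟩
      map_add' := fun _ _ => Subtype.ext (map_add _ _ _)
      map_smul' := fun l α => Subtype.ext (LObj.d_comp_act m l α.1) }
  id X := ⟨A.id X.obj, fun l => by rw [A.comp_id, A.id_comp]⟩
  comp {X Y Z p q n} f g h := ⟨A.comp f.1 g.1 h, fun l => by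
    rw [← A.assoc (X.act l) f.1 g.1 (zero_add p) h h (zero_add n), f.2 l,
      A.assoc f.1 (Y.act l) g.1 (add_zero p) (zero_add q) h h, g.2 l,
      A.assoc f.1 g.1 (Z.act l) h (add_zero q) (add_zero n) h]⟩
  d_shape _ _ _ h := Subtype.ext (A.d_shape _ _ _ h)
  d_d _ _ _ _ := Subtype.ext (A.d_d _ _ _ _)
  d_id _ _ := Subtype.ext (A.d_id _ _)
  add_comp _ _ _ _ := Subtype.ext (A.add_comp _ _ _ _)
  comp_add _ _ _ _ := Subtype.ext (A.comp_add _ _ _ _)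
  smul_comp {X Y Z p q n} c f g h := Subtype.ext
    (A.assoc (X.act c) f.1 g.1 (zero_add p) h h (zero_add n))
  comp_smul {X Y Z p q n} c f g h := Subtype.ext (by
    change A.comp f.1 (A.comp (Y.act c) g.1 (zero_add q)) h =
      A.comp (X.act c) (A.comp f.1 g.1 h) (zero_add n)
    rw [← A.assoc (X.act c) f.1 g.1 (zero_add p) h h (zero_add n), f.2 c,
      A.assoc f.1 (Y.act c) g.1 (add_zero p) (zero_add q) h h])
  id_comp _ := Subtype.ext (A.id_comp _)
  comp_id _ := Subtype.ext (A.comp_id _)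
  assoc _ _ _ _ _ _ _ := Subtype.ext (A.assoc _ _ _ _ _ _ _)
  leibniz f g h hp hq hn := Subtype.ext (A.leibniz f.1 g.1 h hp hq hn)

variable {A L}

/-- `Y` is the module object `L ⊗ X`: there is a closed morphism `η : X ⟶ Y` of degree zero such that
`φ ↦ (l ↦ φ ∘ l ∘ η)` is a bijection from `Hom(Y, Z)` to `Hom_K(L, Hom(X, Z))`, for all `Z`.
This determines `Y` up to a closed isomorphism in `A_L`; if `L/K` is finite of degree `n` and
`A` has finite direct sums then `Y` is the sum of `n` copies of `X`. -/
def IsTensor (X : A.Obj) (Y : LObj A L) : Prop :=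
  ∃ η : A.Hom X Y.obj 0, A.d 0 1 η = 0 ∧
    ∀ (Z : A.Obj) (n : ℤ) (u : L →ₗ[K] A.Hom X Z n),
      ∃! φ : A.Hom Y.obj Z n,
        ∀ l, A.comp (A.comp η (Y.act l) (add_zero 0)) φ (zero_add n) = u l

end ModuleObjects


/-! ### The pretriangulated hull -/

section Pretr

variable {k : Type w} [CommRing k] (A : DGCat.{w, v, u} k)

/-- A formal expression `(⊕ Cᵢ[rᵢ], q)`: `q i j : C_j[r_j] ⟶ C_i[r_i]` is homogeneous of degree one,
strictly upper triangular, and satisfies `dq + q² = 0`.  A morphism `C[r] ⟶ D[s]` of degree `n`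
is a morphism `C ⟶ D` of degree `n + s - r`; under this identification the differential is
multiplied by `(-1)^s`. -/
structure Twisted where
  n : ℕ
  obj : Fin n → A.Obj
  r : Fin n → ℤ
  q : ∀ i j : Fin n, A.Hom (obj j) (obj i) (1 + r i - r j)
  q_eq_zero : ∀ i j : Fin n, j ≤ i → q i j = 0
  maurerCartan : ∀ i j : Fin n,
    (r i).negOnePow • A.d (1 + r i - r j) (2 + r i - r j) (q i j) +
      ∑ l, A.comp (q l j) (q i l) (by omega) = 0

variable {A}

namespace Twisted

/-- Matrices of morphisms of degree `m`. -/
abbrev Hom (C D : Twisted A) (m : ℤ) : Type v :=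
  ∀ (i : Fin D.n) (j : Fin C.n), A.Hom (C.obj j) (D.obj i) (m + D.r i - C.r j)

/-- Matrix multiplication. -/
def comp {C D E : Twisted A} {p q m : ℤ} (f : Hom C D p) (g : Hom D E q) (h : p + q = m) :
    Hom C E m :=
  fun i j => ∑ l, A.comp (f l j) (g i l) (by omega)

/-- Entrywise application of the differential. -/
def δ {C D : Twisted A} (m m' : ℤ) (f : Hom C D m) : Hom C D m' :=
  fun i j => (D.r i).negOnePow • A.d (m + D.r i - C.r j) (m' + D.r i - C.r j) (f i j)

/-- The differential `f ↦ (d f_ij) + q_D f - (-1)^m f q_C` for `f` of degree `m`. -/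
def dFun {C D : Twisted A} (m m' : ℤ) (h : m + 1 = m') (f : Hom C D m) : Hom C D m' :=
  δ m m' f + comp f D.q h - m.negOnePow • comp C.q f ((add_comm 1 m).trans h)

lemma add_comp {C D E : Twisted A} {p q m : ℤ} (f f' : Hom C D p) (g : Hom D E q)
    (h : p + q = m) : comp (f + f') g h = comp f g h + comp f' g h := by
  funext i j
  simp only [comp, Pi.add_apply, A.add_comp, Finset.sum_add_distrib]

lemma comp_add {C D E : Twisted A} {p q m : ℤ} (f : Hom C D p) (g g' : Hom D E q)
    (h : p + q = m) : comp f (g + g') h = comp f g h + comp f g' h := by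
  funext i j
  simp only [comp, Pi.add_apply, A.comp_add, Finset.sum_add_distrib]

lemma smul_comp {C D E : Twisted A} {p q m : ℤ} (c : k) (f : Hom C D p) (g : Hom D E q)
    (h : p + q = m) : comp (c • f) g h = c • comp f g h := by
  funext i j
  simp only [comp, Pi.smul_apply, A.smul_comp, Finset.smul_sum]

lemma comp_smul {C D E : Twisted A} {p q m : ℤ} (c : k) (f : Hom C D p) (g : Hom D E q)
    (h : p + q = m) : comp f (c • g) h = c • comp f g h := by
  funext i j
  simp only [comp, Pi.smul_apply, A.comp_smul, Finset.smul_sum]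

lemma units_smul_comp {C D E : Twisted A} {p q m : ℤ} (c : ℤˣ) (f : Hom C D p) (g : Hom D E q)
    (h : p + q = m) : comp (c • f) g h = c • comp f g h := by
  funext i j
  simp only [comp, Pi.smul_apply, A.units_smul_comp, Finset.smul_sum]

lemma comp_units_smul {C D E : Twisted A} {p q m : ℤ} (c : ℤˣ) (f : Hom C D p) (g : Hom D E q)
    (h : p + q = m) : comp f (c • g) h = c • comp f g h := by
  funext i j
  simp only [comp, Pi.smul_apply, A.comp_units_smul, Finset.smul_sum]

lemma sub_comp {C D E : Twisted A} {p q m : ℤ} (f f' : Hom C D p) (g : Hom D E q)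
    (h : p + q = m) : comp (f - f') g h = comp f g h - comp f' g h := by
  funext i j
  simp only [comp, Pi.sub_apply, A.sub_comp, Finset.sum_sub_distrib]

lemma comp_sub {C D E : Twisted A} {p q m : ℤ} (f : Hom C D p) (g g' : Hom D E q)
    (h : p + q = m) : comp f (g - g') h = comp f g h - comp f g' h := by
  funext i j
  simp only [comp, Pi.sub_apply, A.comp_sub, Finset.sum_sub_distrib]

lemma neg_comp {C D E : Twisted A} {p q m : ℤ} (f : Hom C D p) (g : Hom D E q)
    (h : p + q = m) : comp (-f) g h = -comp f g h := by
  funext i j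
  simp only [comp, Pi.neg_apply, A.neg_comp, Finset.sum_neg_distrib]

lemma comp_neg {C D E : Twisted A} {p q m : ℤ} (f : Hom C D p) (g : Hom D E q)
    (h : p + q = m) : comp f (-g) h = -comp f g h := by
  funext i j
  simp only [comp, Pi.neg_apply, A.comp_neg, Finset.sum_neg_distrib]

lemma δ_add {C D : Twisted A} (m m' : ℤ) (f g : Hom C D m) :
    δ m m' (f + g) = δ m m' f + δ m m' g := by
  funext i j
  simp only [δ, Pi.add_apply, map_add, smul_add]

lemma δ_sub {C D : Twisted A} (m m' : ℤ) (f g : Hom C D m) :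
    δ m m' (f - g) = δ m m' f - δ m m' g := by
  funext i j
  simp only [δ, Pi.sub_apply, map_sub, smul_sub]

lemma δ_units_smul {C D : Twisted A} (m m' : ℤ) (e : ℤˣ) (f : Hom C D m) :
    δ m m' (e • f) = e • δ m m' f := by
  funext i j
  simp only [δ, Pi.smul_apply, A.d_units_smul]
  rw [smul_comm]

lemma δ_smul {C D : Twisted A} (m m' : ℤ) (c : k) (f : Hom C D m) :
    δ m m' (c • f) = c • δ m m' f := by
  funext i j
  simp only [δ, Pi.smul_apply, map_smul]
  rw [smul_comm]

lemma δ_δ {C D : Twisted A} (m m' m'' : ℤ) (f : Hom C D m) : δ m' m'' (δ m m' f) = 0 := by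
  funext i j
  simp only [δ, A.d_units_smul, A.d_d, smul_zero, Pi.zero_apply]

lemma δ_q (C : Twisted A) : δ 1 2 (C := C) (D := C) C.q = -comp C.q C.q one_add_one_eq_two := by
  rw [eq_neg_iff_add_eq_zero]
  funext i j
  exact C.maurerCartan i j

lemma δ_comp {C D E : Twisted A} {p q n p' q' n' : ℤ} (f : Hom C D p) (g : Hom D E q)
    (h : p + q = n) (hp : p + 1 = p') (hq : q + 1 = q') (hn : n + 1 = n') :
    δ n n' (comp f g h) =
      comp f (δ q q' g) (by omega) + q.negOnePow • comp (δ p p' f) g (by omega) := by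
  funext i j
  simp only [δ, comp, Pi.add_apply, Pi.smul_apply, map_sum, Finset.smul_sum,
    ← Finset.sum_add_distrib]
  refine Finset.sum_congr rfl fun l _ => ?_
  rw [A.leibniz (f l j) (g i l) (by omega) (p' := p' + D.r l - C.r j)
    (q' := q' + E.r i - D.r l) (by omega) (by omega) (by omega), smul_add, A.comp_units_smul,
    A.units_smul_comp, smul_smul, smul_smul]
  congr 2
  rw [← Int.negOnePow_add, ← Int.negOnePow_add, Int.negOnePow_eq_iff]
  exact ⟨E.r i - D.r l, by ring⟩

lemma comp_assoc {B C D E : Twisted A} {p q r pq qr n : ℤ} (f : Hom B C p) (g : Hom C D q)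
    (e : Hom D E r) (h₁ : p + q = pq) (h₂ : q + r = qr) (h₃ : pq + r = n) (h₄ : p + qr = n) :
    comp (comp f g h₁) e h₃ = comp f (comp g e h₂) h₄ := by
  funext i j
  simp only [comp, A.sum_comp, A.comp_sum]
  rw [Finset.sum_comm]
  refine Finset.sum_congr rfl fun l _ => Finset.sum_congr rfl fun l' _ => ?_
  exact A.assoc _ _ _ _ _ _ _

/-- The identity matrix. -/
def idMatrix (C : Twisted A) : Hom C C 0 := fun i j =>
  if h : j = i then A.eqId (congrArg C.obj h) (by subst h; omega) else 0

/-- The differential as a linear map, extended by zero. -/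
def d {C D : Twisted A} (m m' : ℤ) : Hom C D m →ₗ[k] Hom C D m' :=
  if h : m + 1 = m' then
    { toFun := dFun m m' h
      map_add' := fun f g => by
        simp only [dFun, δ_add, add_comp, comp_add, smul_add]
        abel
      map_smul' := fun c f => by
        simp only [dFun, δ_smul, smul_comp, comp_smul, RingHom.id_apply, smul_sub, smul_add]
        rw [smul_comm c] }
  else 0

lemma d_apply {C D : Twisted A} (m m' : ℤ) (h : m + 1 = m') (f : Hom C D m) :
    d m m' f = dFun m m' h f := by
  simp [d, h]

lemma eqId_comp' {X Y W : A.Obj} {n m e : ℤ} (h : X = Y) (hn : n = 0) (f : A.Hom Y W m)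
    (he : n + m = e) (hme : m = e) :
    A.comp (A.eqId h hn) f he = A.cast hme (h ▸ f) := by
  subst h; subst hn; subst hme; exact A.id_comp f

lemma comp_eqId' {X Y W : A.Obj} {n m e : ℤ} (h : X = Y) (hn : n = 0) (f : A.Hom W X m)
    (he : m + n = e) (hme : m = e) :
    A.comp f (A.eqId h hn) he = A.cast hme (h ▸ f) := by
  subst h; subst hn; subst hme; exact A.comp_id f

/-- Sums against a row of the identity matrix, placed in any degrees. -/
lemma sum_dite_comp {C : Twisted A} {W : A.Obj} (j : Fin C.n) {a : Fin C.n → ℤ}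
    {b : Fin C.n → ℤ} {e : ℤ} (h₀ : ∀ l, j = l → a l = 0) (f : ∀ l, A.Hom (C.obj l) W (b l))
    (he : ∀ l, a l + b l = e) (hb : b j = e) :
    ∑ l, A.comp (if h : j = l then A.eqId (congrArg C.obj h) (h₀ l h) else 0) (f l) (he l) =
      A.cast hb (f j) := by
  rw [Finset.sum_eq_single j]
  · rw [dif_pos rfl, eqId_comp' (congrArg C.obj rfl) (h₀ j rfl) (f j) (he j) hb]
  · intro l _ hl
    rw [dif_neg (Ne.symm hl), A.zero_comp]
  · intro h; exact absurd (Finset.mem_univ _) h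

/-- Sums against a column of the identity matrix, placed in any degrees. -/
lemma sum_comp_dite {C : Twisted A} {W : A.Obj} (i : Fin C.n) {a : Fin C.n → ℤ}
    {b : Fin C.n → ℤ} {e : ℤ} (h₀ : ∀ l, l = i → a l = 0) (f : ∀ l, A.Hom W (C.obj l) (b l))
    (he : ∀ l, b l + a l = e) (hb : b i = e) :
    ∑ l, A.comp (f l) (if h : l = i then A.eqId (congrArg C.obj h) (h₀ l h) else 0) (he l) =
      A.cast hb (f i) := by
  rw [Finset.sum_eq_single i]
  · rw [dif_pos rfl, comp_eqId' (congrArg C.obj rfl) (h₀ i rfl) (f i) (he i) hb]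
  · intro l _ hl
    rw [dif_neg hl, A.comp_zero]
  · intro h; exact absurd (Finset.mem_univ _) h

lemma cast_rfl {X Y : A.Obj} {n : ℤ} (h : n = n) (f : A.Hom X Y n) : A.cast h f = f := rfl

lemma d_dite {X Y : A.Obj} {p : Prop} [Decidable p] {n : ℤ} (m : ℤ) (h₀ : p → n = 0)
    (h₁ : p → X = Y) : A.d n m (if h : p then A.eqId (h₁ h) (h₀ h) else 0) = 0 := by
  split_ifs with h
  · exact A.d_eqId _ _ _
  · exact map_zero _

lemma leibniz_aux {C D E : Twisted A} {p q n p' q' n' : ℤ} (f : Hom C D p) (g : Hom D E q)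
    (h : p + q = n) (hp : p + 1 = p') (hq : q + 1 = q') (hn : n + 1 = n') :
    dFun n n' hn (comp f g h) =
      comp f (dFun q q' hq g) (by omega) + q.negOnePow • comp (dFun p p' hp f) g (by omega) := by
  simp only [dFun, δ_comp f g h hp hq hn, add_comp, comp_add, sub_comp, comp_sub,
    comp_units_smul, units_smul_comp, smul_add, smul_sub]
  rw [comp_assoc f g E.q h hq hn (by omega), comp_assoc f D.q g hp
    (show 1 + q = q' by omega) (by omega) (by omega), comp_assoc C.q f g
    (show 1 + p = p' by omega) h (by omega) (show 1 + n = n' by omega), smul_smul,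
    show n.negOnePow = q.negOnePow * p.negOnePow by rw [← h, Int.negOnePow_add, mul_comm]]
  abel

lemma dd_aux {C D : Twisted A} (a b c : ℤ) (hab : a + 1 = b) (hbc : b + 1 = c) (f : Hom C D a) :
    dFun b c hbc (dFun a b hab f) = 0 := by
  have hb : b.negOnePow = -a.negOnePow := by rw [← hab, Int.negOnePow_succ]
  simp only [dFun, δ_add, δ_sub, δ_δ, δ_units_smul, add_comp, comp_add, sub_comp, comp_sub,
    comp_units_smul, units_smul_comp, smul_add, smul_sub]
  rw [δ_comp f D.q hab hab one_add_one_eq_two hbc,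
    δ_comp C.q f ((add_comm 1 a).trans hab) one_add_one_eq_two hab hbc, δ_q, δ_q,
    comp_assoc f D.q D.q hab one_add_one_eq_two hbc (by omega),
    comp_assoc C.q f D.q (show 1 + a = b by omega) hab hbc (by omega),
    ← comp_assoc C.q C.q f one_add_one_eq_two (show 1 + a = b by omega) (by omega) (by omega),
    hb, comp_neg, neg_comp, Int.negOnePow_one]
  simp only [Units.neg_smul, one_smul, smul_add, smul_neg, smul_smul, neg_mul, ← Int.negOnePow_add,
    Int.negOnePow_even (a + a) (Even.add_self a)]
  abel

lemma id_comp {C D : Twisted A} {n : ℤ} (f : Hom C D n) :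
    comp (idMatrix C) f (zero_add n) = f := by
  funext i j
  exact sum_dite_comp j _ (fun l => f i l) _ rfl

lemma comp_id {C D : Twisted A} {n : ℤ} (f : Hom C D n) :
    comp f (idMatrix D) (add_zero n) = f := by
  funext i j
  exact sum_comp_dite i _ (fun l => f l j) _ rfl

lemma δ_eq_zero {C : Twisted A} (D : Twisted A) {m m' : ℤ} (f : Hom C D m)
    (hf : ∀ i j, A.d (m + D.r i - C.r j) (m' + D.r i - C.r j) (f i j) = 0) : δ m m' f = 0 := by
  funext i j
  simp only [δ, hf, smul_zero, Pi.zero_apply]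

lemma d_idMatrix (C : Twisted A) : dFun 0 1 (zero_add 1) (idMatrix C) = 0 := by
  have h : δ 0 1 (idMatrix C) = 0 := δ_eq_zero _ _ (fun i j => by
    rw [idMatrix]; exact d_dite _ _ _)
  rw [dFun, h, id_comp, comp_id (D := C) (C := C) C.q]
  simp

end Twisted

variable (A)

/-- The pretriangulated hull of a DG-category. -/
def pretr : DGCat.{w, v, max u v} k where
  Obj := Twisted A
  Hom := Twisted.Hom
  d := Twisted.d
  id := Twisted.idMatrix
  comp := Twisted.comp
  d_shape n m f h := by simp [Twisted.d, h]
  d_d n m l f := by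
    by_cases h : n + 1 = m
    · by_cases h' : m + 1 = l
      · rw [Twisted.d_apply n m h, Twisted.d_apply m l h', Twisted.dd_aux]
      · simp [Twisted.d, h']
    · simp [Twisted.d, h]
  d_id X m := by
    by_cases h : 0 + 1 = m
    · subst h
      rw [Twisted.d_apply 0 _ rfl]
      exact Twisted.d_idMatrix X
    · rw [Twisted.d, dif_neg h, LinearMap.zero_apply]
  add_comp := Twisted.add_comp
  comp_add := Twisted.comp_add
  smul_comp := Twisted.smul_comp
  comp_smul := Twisted.comp_smul
  id_comp := Twisted.id_comp
  comp_id := Twisted.comp_id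
  assoc := Twisted.comp_assoc
  leibniz f g h hp hq hn := by
    rw [Twisted.d_apply _ _ hn, Twisted.d_apply _ _ hp, Twisted.d_apply _ _ hq]
    exact Twisted.leibniz_aux f g h hp hq hn

variable {A}

/-- The object `X` of `A` as an object of the pretriangulated hull. -/
def toPretr (X : A.Obj) : (pretr A).Obj where
  n := 1
  obj _ := X
  r _ := 0
  q _ _ := 0
  q_eq_zero _ _ _ := rfl
  maurerCartan _ _ := by simp [A.comp_zero]

lemma cast_neg {X Y : A.Obj} {n m : ℤ} (h : n = m) (f : A.Hom X Y n) :
    A.cast h (-f) = -A.cast h f := by subst h; rfl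

lemma cast_zero {X Y : A.Obj} {n m : ℤ} (h : n = m) : A.cast h (0 : A.Hom X Y n) = 0 := by
  subst h; rfl

lemma cast_add {X Y : A.Obj} {n m : ℤ} (h : n = m) (f g : A.Hom X Y n) :
    A.cast h (f + g) = A.cast h f + A.cast h g := by subst h; rfl

lemma cast_units_smul {X Y : A.Obj} {n m : ℤ} (h : n = m) (e : ℤˣ) (f : A.Hom X Y n) :
    A.cast h (e • f) = e • A.cast h f := by subst h; rfl

lemma cast_sum {ι : Type*} (s : Finset ι) {X Y : A.Obj} {n m : ℤ} (h : n = m)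
    (f : ι → A.Hom X Y n) : A.cast h (∑ i ∈ s, f i) = ∑ i ∈ s, A.cast h (f i) := by
  subst h; rfl

lemma cast_comp' {X Y Z : A.Obj} {p q n m : ℤ} (f : A.Hom X Y p) (g : A.Hom Y Z q) (h : p + q = n)
    (h' : n = m) : A.cast h' (A.comp f g h) = A.comp f g (h.trans h') := by
  subst h'; rfl

/-- The shift `(⊕ Cᵢ[rᵢ + 1], -q)` of `(⊕ Cᵢ[rᵢ], q)`. -/
def Twisted.shift (C : Twisted A) : Twisted A where
  n := C.n
  obj := C.obj
  r i := C.r i + 1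
  q i j := A.cast (by omega) (-(C.q i j))
  q_eq_zero i j h := by rw [C.q_eq_zero i j h, neg_zero, cast_zero]
  maurerCartan i j := by
    have h := congrArg (A.cast (show 2 + C.r i - C.r j = 2 + (C.r i + 1) - (C.r j + 1) by omega))
      (C.maurerCartan i j)
    rw [cast_add, cast_units_smul, A.cast_d, cast_sum, cast_zero] at h
    rw [A.d_cast, map_neg, Int.negOnePow_succ, smul_neg, Units.neg_smul, neg_neg, ← h]
    congr 1
    refine Finset.sum_congr rfl fun l _ => ?_
    rw [A.comp_cast, A.cast_comp, A.comp_neg, A.neg_comp, neg_neg, cast_comp']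

/-- The identity matrix, as a morphism `C[1] ⟶ C` of degree one. -/
def Twisted.σ (C : Twisted A) : Twisted.Hom C.shift C 1 := fun (i j : Fin C.n) =>
  if h : j = i then A.eqId (congrArg C.obj h)
    (show 1 + C.r i - (C.r j + 1) = 0 by subst h; omega) else 0

/-- The identity matrix, as a morphism `C ⟶ C[1]` of degree minus one. -/
def Twisted.τ (C : Twisted A) : Twisted.Hom C C.shift (-1) := fun (i j : Fin C.n) =>
  if h : j = i then A.eqId (congrArg C.obj h)
    (show -1 + (C.r i + 1) - C.r j = 0 by subst h; omega) else 0

lemma cast_dite {X Y : A.Obj} {p : Prop} [Decidable p] {n m : ℤ} (h₀ : p → n = 0)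
    (h₁ : p → X = Y) (h : n = m) : A.cast h (if h : p then A.eqId (h₁ h) (h₀ h) else 0) =
      if h' : p then A.eqId (h₁ h') (h ▸ h₀ h') else 0 := by
  subst h; rfl

lemma neg_cast_cast {X Y : A.Obj} {n m l : ℤ} (h : n = m) (h' : m = l) (f : A.Hom X Y n) :
    -A.cast h' (A.cast h (-f)) = A.cast (h.trans h') f := by
  subst h; subst h'; exact neg_neg f

lemma Twisted.d_σ (C : Twisted A) : Twisted.dFun 1 2 one_add_one_eq_two C.σ = 0 := by
  have h1 : Twisted.δ 1 2 C.σ = 0 := Twisted.δ_eq_zero _ _ (fun (i j : Fin C.n) => by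
    rw [Twisted.σ]; exact Twisted.d_dite _ _ _)
  suffices h : Twisted.comp C.σ C.q one_add_one_eq_two =
      -Twisted.comp C.shift.q C.σ one_add_one_eq_two by
    rw [Twisted.dFun, h1, h, Int.negOnePow_one]
    simp
  funext (i : Fin C.n) (j : Fin C.n)
  have h2 : Twisted.comp C.σ C.q one_add_one_eq_two i j =
      A.cast (show 1 + C.r i - C.r j = 2 + C.r i - (C.r j + 1) by omega) (C.q i j) :=
    Twisted.sum_dite_comp (C := C) j _ (fun l => C.q i l) _ _
  have h3 : Twisted.comp C.shift.q C.σ one_add_one_eq_two i j =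
      A.cast (show 1 + (C.r i + 1) - (C.r j + 1) = 2 + C.r i - (C.r j + 1) by omega)
        (C.shift.q i j) :=
    Twisted.sum_comp_dite (C := C) i _ (fun l => C.shift.q l j) _ _
  exact h2.trans ((neg_cast_cast _ _ _).symm.trans (congrArg Neg.neg h3).symm)

lemma Twisted.d_τ (C : Twisted A) : Twisted.dFun (-1) 0 (neg_add_cancel 1) C.τ = 0 := by
  have h1 : Twisted.δ (-1) 0 C.τ = 0 := Twisted.δ_eq_zero _ _ (fun (i j : Fin C.n) => by
    rw [Twisted.τ]; exact Twisted.d_dite _ _ _)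
  suffices h : Twisted.comp C.q C.τ (add_neg_cancel 1) =
      -Twisted.comp C.τ C.shift.q (neg_add_cancel 1) by
    rw [Twisted.dFun, h1, h, Int.negOnePow_neg, Int.negOnePow_one]
    simp
  funext (i : Fin C.n) (j : Fin C.n)
  have h2 : Twisted.comp C.τ C.shift.q (neg_add_cancel 1) i j =
      A.cast (show 1 + (C.r i + 1) - (C.r j + 1) = 0 + (C.r i + 1) - C.r j by omega)
        (C.shift.q i j) :=
    Twisted.sum_dite_comp (C := C) j _ (fun l => C.shift.q i l) _ _
  have h3 : Twisted.comp C.q C.τ (add_neg_cancel 1) i j =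
      A.cast (show 1 + C.r i - C.r j = 0 + (C.r i + 1) - C.r j by omega) (C.q i j) :=
    Twisted.sum_comp_dite (C := C) i _ (fun l => C.q l j) _ _
  exact h3.trans ((neg_cast_cast _ _ _).symm.trans (congrArg Neg.neg h2).symm)

lemma Twisted.σ_τ (C : Twisted A) :
    Twisted.comp C.σ C.τ (add_neg_cancel 1) = Twisted.idMatrix C.shift := by
  funext (i : Fin C.n) (j : Fin C.n)
  have h : Twisted.comp C.σ C.τ (add_neg_cancel 1) i j =
      A.cast (show -1 + (C.r i + 1) - C.r j = 0 + (C.r i + 1) - (C.r j + 1) by omega) (C.τ i j) :=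
    Twisted.sum_dite_comp (C := C) j _ (fun l => C.τ i l) _ _
  exact h.trans (cast_dite _ _ _)

lemma Twisted.τ_σ (C : Twisted A) :
    Twisted.comp C.τ C.σ (neg_add_cancel 1) = Twisted.idMatrix C := by
  funext (i : Fin C.n) (j : Fin C.n)
  have h : Twisted.comp C.τ C.σ (neg_add_cancel 1) i j =
      A.cast (show 1 + C.r i - (C.r j + 1) = 0 + C.r i - C.r j by omega) (C.σ i j) :=
    Twisted.sum_dite_comp (C := C) j _ (fun l => C.σ i l) _ _
  exact h.trans (cast_dite _ _ _)

variable (A)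

/-- The translation of the pretriangulated hull. -/
def pretrTranslation : (pretr A).Translation where
  obj := Twisted.shift
  σ := Twisted.σ
  τ := Twisted.τ
  d_σ C := (Twisted.d_apply 1 2 one_add_one_eq_two _).trans (Twisted.d_σ C)
  d_τ C := (Twisted.d_apply (-1) 0 (neg_add_cancel 1) _).trans (Twisted.d_τ C)
  σ_τ := Twisted.σ_τ
  τ_σ := Twisted.τ_σ

end Pretr

/-! ### The base change of the homotopy category -/

section BaseChange

variable {K : Type w} [Field K] (A : DGCat.{w, v, u} K) (L : Type w') [Field L] [Algebra K L]

/-- The image of `H⁰(A)` in `H⁰((A_L)^pretr)` under `X ↦ L ⊗ X`. -/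
def baseChangeImage : ObjectProperty (H0 (pretr (A.scalarExt L))) := fun M =>
  ∃ (X : A.Obj) (Y : LObj A L), IsTensor X Y ∧
    M = (H0.quotient (pretr (A.scalarExt L))).obj ⟨toPretr (A := A.scalarExt L) Y⟩

/-- The base change `T_L` of `T = H⁰(A)`: the smallest thick full triangulated subcategory of
`H⁰((A_L)^pretr)` containing the image of `T`. -/
abbrev BaseChange : Type _ :=
  ((pretrTranslation (A.scalarExt L)).thickClosure (A.baseChangeImage L)).FullSubcategory

/-- The translation functor of `T_L`. -/
abbrev baseChangeShift : A.BaseChange L ⥤ A.BaseChange L :=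
  (pretrTranslation (A.scalarExt L)).thickClosureFunctor (A.baseChangeImage L)

/-- The distinguished triangles of `T_L` are those of `H⁰((A_L)^pretr)`. -/
def BaseChangeDistinguished {X Y Z : A.BaseChange L} (f : X ⟶ Y) (g : Y ⟶ Z)
    (h : Z ⟶ (A.baseChangeShift L).obj X) : Prop :=
  (pretrTranslation (A.scalarExt L)).Distinguished f.hom g.hom h.hom

end BaseChange

end DGCat

/-! ### The enhancement of the bounded derived category by complexes of injective objects -/

section Injectives

variable (K : Type w) [Field K] (C : Type u) [Category.{v} C] [Abelian C] [Linear K C]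

/-- Bounded below complexes of injective objects with bounded cohomology. -/
structure InjComplex where
  cx : CochainComplex C ℤ
  injective : ∀ i, Injective (cx.X i)
  boundedBelow : ∃ a : ℤ, ∀ i < a, IsZero (cx.X i)
  boundedCohomology : ∃ b : ℤ, ∀ i > b, cx.ExactAt i

open CochainComplex.HomComplex in
/-- The DG-category of bounded below complexes of injective objects with bounded cohomology. -/
def injDG : DGCat.{w, v, max u v} K where
  Obj := InjComplex C
  Hom X Y n := Cochain X.cx Y.cx n
  d {X Y} n m := δ_hom K X.cx Y.cx n m
  id X := Cochain.ofHom (𝟙 X.cx)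
  comp f g h := f.comp g h
  d_shape n m f h := δ_shape n m h f
  d_d n m l f := δ_δ n m l f
  d_id X m := δ_ofHom _
  add_comp f f' g h := Cochain.add_comp f f' g h
  comp_add f g g' h := Cochain.comp_add f g g' h
  smul_comp c f g h := Cochain.smul_comp c f g h
  comp_smul c f g h := Cochain.comp_smul f c g h
  id_comp f := Cochain.id_comp f
  comp_id f := Cochain.comp_id f
  assoc f g e h₁ h₂ h₃ h₄ := Cochain.comp_assoc f g e h₁ h₂ (by omega)
  leibniz {X Y Z p q n p' q' n'} f g h hp hq hn := δ_comp f g h p' q' n' hn hp hq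

end Injectives

/-! ### Module objects in a linear category -/

/-- The category `C_L` of `L`-module objects in a `K`-linear category `C`: pairs `(X, f)` with
`f : L ⟶ End(X)` a morphism of `K`-algebras. -/
structure ScalarModule (K : Type w) (L : Type w') [Field K] [Field L] [Algebra K L]
    (C : Type u) [Category.{v} C] [Preadditive C] [Linear K C] where
  obj : C
  act : L →ₐ[K] End obj

namespace ScalarModule

section

variable {K : Type w} {L : Type w'} [Field K] [Field L] [Algebra K L]
  {C : Type u} [Category.{v} C] [Preadditive C] [Linear K C]

/-- The endomorphism by which `l` acts. -/
def ρ (X : ScalarModule K L C) (l : L) : X.obj ⟶ X.obj := X.act l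

/-- Morphisms of `C` compatible with the actions of `L`. -/
@[ext]
structure Hom (X Y : ScalarModule K L C) where
  hom : X.obj ⟶ Y.obj
  comm : ∀ l : L, X.ρ l ≫ hom = hom ≫ Y.ρ l

lemma Hom.comm_assoc {X Y : ScalarModule K L C} (f : Hom X Y) (l : L) {W : C} (g : Y.obj ⟶ W) :
    X.ρ l ≫ f.hom ≫ g = f.hom ≫ Y.ρ l ≫ g := by
  rw [← Category.assoc, f.comm, Category.assoc]

lemma act_mul_comp (X : ScalarModule K L C) (a b : L) : X.ρ (a * b) = X.ρ b ≫ X.ρ a :=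
  map_mul X.act a b

lemma act_algebraMap (X : ScalarModule K L C) (r : K) : X.ρ (algebraMap K L r) = r • 𝟙 X.obj :=
  (X.act.commutes r).trans (Algebra.algebraMap_eq_smul_one r)

lemma act_one (X : ScalarModule K L C) : X.ρ 1 = 𝟙 X.obj := map_one X.act

lemma act_zero (X : ScalarModule K L C) : X.ρ 0 = 0 := map_zero X.act

lemma act_add (X : ScalarModule K L C) (a b : L) : X.ρ (a + b) = X.ρ a + X.ρ b :=
  map_add X.act a b

instance : Category (ScalarModule K L C) where
  Hom X Y := Hom X Y
  id X := ⟨𝟙 X.obj, fun l => by rw [Category.comp_id, Category.id_comp]⟩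
  comp f g := ⟨f.hom ≫ g.hom, fun l => by rw [f.comm_assoc, g.comm, Category.assoc]⟩
  id_comp f := Hom.ext (Category.id_comp _)
  comp_id f := Hom.ext (Category.comp_id _)
  assoc f g h := Hom.ext (Category.assoc _ _ _)

@[ext] lemma hom_ext {X Y : ScalarModule K L C} {f g : X ⟶ Y} (h : f.hom = g.hom) : f = g := Hom.ext h

@[simp] lemma id_hom (X : ScalarModule K L C) : (𝟙 X : X ⟶ X).hom = 𝟙 X.obj := rfl

@[simp] lemma comp_hom {X Y Z : ScalarModule K L C} (f : X ⟶ Y) (g : Y ⟶ Z) :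
    (f ≫ g).hom = f.hom ≫ g.hom := rfl

variable (K L C) in
/-- The forgetful functor. -/
@[simps] def forget : ScalarModule K L C ⥤ C where
  obj X := X.obj
  map f := f.hom

instance (X Y : ScalarModule K L C) : Zero (X ⟶ Y) := ⟨⟨0, fun l => by simp⟩⟩
instance (X Y : ScalarModule K L C) : Add (X ⟶ Y) :=
  ⟨fun f g => ⟨f.hom + g.hom, fun l => by simp [f.comm, g.comm]⟩⟩
instance (X Y : ScalarModule K L C) : Neg (X ⟶ Y) := ⟨fun f => ⟨-f.hom, fun l => by simp [f.comm]⟩⟩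
instance (X Y : ScalarModule K L C) : Sub (X ⟶ Y) :=
  ⟨fun f g => ⟨f.hom - g.hom, fun l => by simp [f.comm, g.comm]⟩⟩
instance (X Y : ScalarModule K L C) : SMul ℕ (X ⟶ Y) :=
  ⟨fun n f => ⟨n • f.hom, fun l => by simp [f.comm]⟩⟩
instance (X Y : ScalarModule K L C) : SMul ℤ (X ⟶ Y) :=
  ⟨fun n f => ⟨n • f.hom, fun l => by simp [f.comm]⟩⟩

/-- The scalar multiplication of `L` on morphisms: `l • α = α ∘ f(l)`. -/
instance (X Y : ScalarModule K L C) : SMul L (X ⟶ Y) :=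
  ⟨fun l f => ⟨X.ρ l ≫ f.hom, fun m => by
    rw [← Category.assoc, ← act_mul_comp, mul_comm, act_mul_comp, Category.assoc, Category.assoc,
      f.comm]⟩⟩

lemma hom_injective (X Y : ScalarModule K L C) : Function.Injective (fun f : X ⟶ Y => f.hom) :=
  fun _ _ h => Hom.ext h

instance (X Y : ScalarModule K L C) : AddCommGroup (X ⟶ Y) :=
  (hom_injective X Y).addCommGroup _ rfl (fun _ _ => rfl) (fun _ => rfl) (fun _ _ => rfl)
    (fun _ _ => rfl) (fun _ _ => rfl)

@[simp] lemma zero_hom (X Y : ScalarModule K L C) : (0 : X ⟶ Y).hom = 0 := rfl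

@[simp] lemma add_hom {X Y : ScalarModule K L C} (f g : X ⟶ Y) : (f + g).hom = f.hom + g.hom := rfl

lemma smul_hom {X Y : ScalarModule K L C} (l : L) (f : X ⟶ Y) :
    (l • f).hom = X.ρ l ≫ f.hom := rfl

instance (X Y : ScalarModule K L C) : Module L (X ⟶ Y) where
  one_smul f := by
    ext
    rw [smul_hom, act_one, Category.id_comp]
  mul_smul a b f := by
    ext
    rw [smul_hom, smul_hom, smul_hom, mul_comm, act_mul_comp, Category.assoc]
  smul_zero a := by ext; simp [smul_hom]
  smul_add a f g := by ext; simp [smul_hom]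
  add_smul a b f := by
    ext
    rw [smul_hom, act_add, Preadditive.add_comp]; rfl
  zero_smul f := by
    ext
    rw [smul_hom, act_zero, zero_comp]; rfl

instance : Preadditive (ScalarModule K L C) where
  add_comp _ _ _ _ _ _ := by ext; simp
  comp_add _ _ _ _ _ _ := by ext; simp

instance : Linear L (ScalarModule K L C) where
  smul_comp _ _ _ _ _ _ := by ext; simp [smul_hom]
  comp_smul X Y Z f r g := by
    ext
    simp only [smul_hom, comp_hom]
    rw [f.comm_assoc]

instance : (forget K L C).Additive where

instance : (forget K L C).Faithful where
  map_injective h := Hom.ext h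

/-- A module object from the endomorphisms by which `L` acts. -/
def ofEnd (X : C) (φ : L → (X ⟶ X)) (hm : ∀ a b, φ (a * b) = φ b ≫ φ a)
    (ha : ∀ a b, φ (a + b) = φ a + φ b) (hc : ∀ r, φ (algebraMap K L r) = r • 𝟙 X) :
    ScalarModule K L C where
  obj := X
  act :=
    { toFun := φ
      map_one' := by
        have := hc 1
        rw [map_one, one_smul] at this
        exact this
      map_mul' := hm
      map_zero' := by
        have := hc 0
        rw [map_zero, zero_smul] at this
        exact this
      map_add' := ha
      commutes' := hc }

@[simp] lemma ofEnd_obj (X : C) (φ : L → (X ⟶ X)) (hm) (ha) (hc) :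
    (ofEnd (K := K) X φ hm ha hc).obj = X := rfl

end

/-! ### The category of module objects in an abelian category is abelian -/

section Abelian

variable {K : Type w} {L : Type w'} [Field K] [Field L] [Algebra K L]
  {C : Type u} [Category.{v} C] [Abelian C] [Linear K C]

/-- The kernel in `C`, with the induced action. -/
def ker {X Y : ScalarModule K L C} (f : X ⟶ Y) : ScalarModule K L C :=
  ofEnd (kernel f.hom)
    (fun l => kernel.lift f.hom (kernel.ι f.hom ≫ X.ρ l) (by
      rw [Category.assoc, f.comm, kernel.condition_assoc, zero_comp]))
    (fun a b => by
      rw [← cancel_mono (kernel.ι f.hom)]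
      simp [act_mul_comp])
    (fun a b => by
      rw [← cancel_mono (kernel.ι f.hom)]
      simp [act_add])
    (fun r => by
      rw [← cancel_mono (kernel.ι f.hom)]
      simp [act_algebraMap])

/-- The inclusion of the kernel. -/
def kerι {X Y : ScalarModule K L C} (f : X ⟶ Y) : ker f ⟶ X :=
  ⟨kernel.ι f.hom, fun l => by
    change kernel.lift f.hom _ _ ≫ _ = _
    exact kernel.lift_ι _ _ _⟩

/-- The cokernel in `C`, with the induced action. -/
def coker {X Y : ScalarModule K L C} (f : X ⟶ Y) : ScalarModule K L C :=
  ofEnd (cokernel f.hom)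
    (fun l => cokernel.desc f.hom (Y.ρ l ≫ cokernel.π f.hom) (by
      rw [← Category.assoc, ← f.comm, Category.assoc, cokernel.condition, comp_zero]))
    (fun a b => by
      rw [← cancel_epi (cokernel.π f.hom)]
      simp [act_mul_comp])
    (fun a b => by
      rw [← cancel_epi (cokernel.π f.hom)]
      simp [act_add])
    (fun r => by
      rw [← cancel_epi (cokernel.π f.hom)]
      simp [act_algebraMap])

/-- The projection to the cokernel. -/
def cokerπ {X Y : ScalarModule K L C} (f : X ⟶ Y) : Y ⟶ coker f :=
  ⟨cokernel.π f.hom, fun l => by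
    change _ = _ ≫ cokernel.desc f.hom _ _
    exact (cokernel.π_desc _ _ _).symm⟩

lemma kerι_hom {X Y : ScalarModule K L C} (f : X ⟶ Y) : (kerι f).hom = kernel.ι f.hom := rfl

lemma cokerπ_hom {X Y : ScalarModule K L C} (f : X ⟶ Y) : (cokerπ f).hom = cokernel.π f.hom := rfl

/-- A morphism of `C_L` whose underlying morphism is a kernel in `C` is a kernel in `C_L`. -/
def isLimitOfHom {X Y Z : ScalarModule K L C} (i : X ⟶ Y) (p : Y ⟶ Z) (w : i ≫ p = 0)
    (h : IsLimit (KernelFork.ofι i.hom (show i.hom ≫ p.hom = 0 from congrArg Hom.hom w))) :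
    IsLimit (KernelFork.ofι i w) :=
  have hm : Mono i.hom := mono_of_isLimit_fork h
  have fac : ∀ {W : C} (g : W ⟶ Y.obj) (hg : g ≫ p.hom = 0),
      h.lift (KernelFork.ofι g hg) ≫ i.hom = g := fun g hg => Fork.IsLimit.lift_ι h
  KernelFork.IsLimit.ofι _ _
    (fun {W} g hg => ⟨h.lift (KernelFork.ofι g.hom (congrArg Hom.hom hg)), fun l => by
      rw [← cancel_mono i.hom, Category.assoc, Category.assoc, i.comm, fac, ← Category.assoc, fac,
        g.comm]⟩)
    (fun g hg => by ext; exact fac _ _)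
    (fun g hg m hm' => by
      ext
      rw [← cancel_mono i.hom]
      exact (congrArg Hom.hom hm').trans (fac _ _).symm)

/-- A morphism of `C_L` whose underlying morphism is a cokernel in `C` is a cokernel in `C_L`. -/
def isColimitOfHom {X Y Z : ScalarModule K L C} (i : X ⟶ Y) (p : Y ⟶ Z) (w : i ≫ p = 0)
    (h : IsColimit (CokernelCofork.ofπ p.hom (show i.hom ≫ p.hom = 0 from congrArg Hom.hom w))) :
    IsColimit (CokernelCofork.ofπ p w) :=
  have hm : Epi p.hom := epi_of_isColimit_cofork h
  have fac : ∀ {W : C} (g : Y.obj ⟶ W) (hg : i.hom ≫ g = 0),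
      p.hom ≫ h.desc (CokernelCofork.ofπ g hg) = g := fun g hg => Cofork.IsColimit.π_desc h
  CokernelCofork.IsColimit.ofπ _ _
    (fun {W} g hg => ⟨h.desc (CokernelCofork.ofπ g.hom (congrArg Hom.hom hg)), fun l => by
      rw [← cancel_epi p.hom, ← Category.assoc, ← Category.assoc, ← p.comm, fac, Category.assoc,
        fac, g.comm]⟩)
    (fun g hg => by ext; exact fac _ _)
    (fun g hg m hm' => by
      ext
      rw [← cancel_epi p.hom]
      exact (congrArg Hom.hom hm').trans (fac _ _).symm)

lemma kerι_comp {X Y : ScalarModule K L C} (f : X ⟶ Y) : kerι f ≫ f = 0 := by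
  ext; exact kernel.condition f.hom

lemma comp_cokerπ {X Y : ScalarModule K L C} (f : X ⟶ Y) : f ≫ cokerπ f = 0 := by
  ext; exact cokernel.condition f.hom

instance : HasKernels (ScalarModule K L C) where
  has_limit f := ⟨⟨_, isLimitOfHom (kerι f) f (kerι_comp f) (kernelIsKernel f.hom)⟩⟩

instance : HasCokernels (ScalarModule K L C) where
  has_colimit f := ⟨⟨_, isColimitOfHom f (cokerπ f) (comp_cokerπ f) (cokernelIsCokernel f.hom)⟩⟩

instance {X Y : ScalarModule K L C} (f : X ⟶ Y) [Mono f] : Mono f.hom := by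
  have : kerι f = 0 := by rw [← cancel_mono f, kerι_comp, zero_comp]
  exact Preadditive.mono_of_kernel_zero (congrArg Hom.hom this)

instance {X Y : ScalarModule K L C} (f : X ⟶ Y) [Epi f] : Epi f.hom := by
  have : cokerπ f = 0 := by rw [← cancel_epi f, comp_cokerπ, comp_zero]
  exact Preadditive.epi_of_cokernel_zero (congrArg Hom.hom this)

instance : IsNormalMonoCategory (ScalarModule K L C) where
  normalMonoOfMono f _ := ⟨{
    Z := coker f
    g := cokerπ f
    w := comp_cokerπ f
    isLimit := isLimitOfHom f (cokerπ f) (comp_cokerπ f)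
      (Abelian.monoIsKernelOfCokernel (CokernelCofork.ofπ (cokernel.π f.hom)
        (cokernel.condition f.hom)) (cokernelIsCokernel f.hom)) }⟩

instance : IsNormalEpiCategory (ScalarModule K L C) where
  normalEpiOfEpi f _ := ⟨{
    W := ker f
    g := kerι f
    w := kerι_comp f
    isColimit := isColimitOfHom (kerι f) f (kerι_comp f)
      (Abelian.epiIsCokernelOfKernel (KernelFork.ofι (kernel.ι f.hom)
        (kernel.condition f.hom)) (kernelIsKernel f.hom)) }⟩

/-- The direct sum in `C`, with the componentwise action. -/
def biprodObj (X Y : ScalarModule K L C) : ScalarModule K L C :=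
  ofEnd (X.obj ⊞ Y.obj)
    (fun l => biprod.map (X.ρ l) (Y.ρ l))
    (fun a b => by ext <;> simp [act_mul_comp])
    (fun a b => by ext <;> simp [act_add])
    (fun r => by ext <;> simp [act_algebraMap])

/-- The direct sum as a bicone. -/
def biprodBicone (X Y : ScalarModule K L C) : BinaryBicone X Y where
  pt := biprodObj X Y
  fst := ⟨biprod.fst, fun l => biprod.map_fst _ _⟩
  snd := ⟨biprod.snd, fun l => biprod.map_snd _ _⟩
  inl := ⟨biprod.inl, fun l => (biprod.inl_map _ _).symm⟩
  inr := ⟨biprod.inr, fun l => (biprod.inr_map _ _).symm⟩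
  inl_fst := by ext; exact biprod.inl_fst
  inl_snd := by ext; exact biprod.inl_snd
  inr_fst := by ext; exact biprod.inr_fst
  inr_snd := by ext; exact biprod.inr_snd

instance : HasBinaryBiproducts (ScalarModule K L C) where
  has_binary_biproduct X Y := hasBinaryBiproduct_of_total (biprodBicone X Y) (by
    ext; exact biprod.total)

/-- The zero object of `C`, with its only action. -/
def zeroObj (Z : C) (hZ : IsZero Z) : ScalarModule K L C :=
  ofEnd Z (fun _ => 0) (fun _ _ => hZ.eq_of_src _ _) (fun _ _ => hZ.eq_of_src _ _)
    (fun _ => hZ.eq_of_src _ _)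

instance : HasZeroObject (ScalarModule K L C) := by
  obtain ⟨Z, hZ⟩ := HasZeroObject.zero (C := C)
  refine ⟨zeroObj Z hZ, ?_⟩
  rw [IsZero.iff_id_eq_zero]
  ext
  exact hZ.eq_of_src _ _

instance : HasFiniteProducts (ScalarModule K L C) :=
  hasFiniteProducts_of_has_binary_and_terminal

instance : Abelian (ScalarModule K L C) where

end Abelian
end ScalarModule
end

noncomputable section

/-! ### DG-functors -/

namespace DGCat

/-! The point is that all the constructions on the DG side lead back to one DG-category, that of
bounded below complexes of injective objects of $\mathcal C_L$ with bounded cohomology, `injDG L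
(ScalarModule K L C)`.

A complex with an action of $L$ is the same as a complex of $L$-module objects, and a morphism of
degree $n$ is $L$-linear exactly when its components are. Kernels and cokernels in $\mathcal C_L$
are formed in $\mathcal C$, so exactness is detected by the forgetful functor. Injectivity is
detected as well. The forgetful functor has the mono-preserving left adjoint $L\otimes_K-$, hence
preserves injectives (`injective_obj`). Conversely, if $(b_j)$ is a basis and $(b_j^*)$ its trace
dual, the element $\sum b_j\otimes b_j^*$ is central for the two actions of $L$ and multiplies to
$1$; averaging with it turns an extension in $\mathcal C$ into an $L$-linear one
(`injective_of_obj`). Therefore $\mathcal A_L$ is equivalent, as a DG-category, to the category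
above (`lobjFunctor`).

That category is already closed under one-sided twisted complexes: each has a total complex, and
strict triangularity of $q$ keeps the cohomology bounded. Taking total complexes gives a fully
faithful DG-functor from $(\mathcal A_L)^{\mathrm{pretr}}$ (`pretrToInj`), which is surjective up to
closed isomorphism already on one-term complexes. On $H^0$ it is followed by the classical
equivalence with $D^b(\mathcal C_L)$: bounded below complexes of injectives are K-injective, and
$\mathcal C_L$ inherits enough injectives from $\mathcal C$.

The thick closure is all of $H^0((\mathcal A_L)^{\mathrm{pretr}})$. Every object is isomorphic to
some $Y\in\mathcal A_L$, and the same separability element splits the multiplication $L\otimes_K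
Y\to Y$, so $Y$ is a direct summand of a generator (`exists_retract_isTensor`).

DG-functors commute with translations and preserve cones, and in complexes of injectives cones are
mapping cones; hence distinguished triangles are preserved. They are reflected because cones exist
on the source and the functor is fully faithful (`Translation.distinguished_iff_map`). -/

/-- A DG-functor between DG-categories over `k`. -/
structure DGFunctor {k : Type w} [CommRing k] (A : DGCat.{w, v, u} k) (B : DGCat.{w, v', u'} k) where
  obj : A.Obj → B.Obj
  map : ∀ {X Y : A.Obj} {n : ℤ}, A.Hom X Y n →ₗ[k] B.Hom (obj X) (obj Y) n
  map_d : ∀ {X Y : A.Obj} (n m : ℤ) (f : A.Hom X Y n), map (A.d n m f) = B.d n m (map f)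
  map_id : ∀ X : A.Obj, map (A.id X) = B.id (obj X)
  map_comp : ∀ {X Y Z : A.Obj} {p q n : ℤ} (f : A.Hom X Y p) (g : A.Hom Y Z q) (h : p + q = n),
    map (A.comp f g h) = B.comp (map f) (map g) h

/-! ### Closed isomorphisms and cones. -/

section Iso

variable {k : Type w} [CommRing k] {A : DGCat.{w, v, u} k}

lemma Z0.iso_hom_inv {X Y : Z0 A} (e : X ≅ Y) :
    A.comp e.hom.val e.inv.val (add_zero 0) = A.id X.obj := congrArg Z0.Hom.val e.hom_inv_id

lemma Z0.iso_inv_hom {X Y : Z0 A} (e : X ≅ Y) :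
    A.comp e.inv.val e.hom.val (add_zero 0) = A.id Y.obj := congrArg Z0.Hom.val e.inv_hom_id

lemma comp_iso_cancel {X Y Z Z' : A.Obj} {p q n : ℤ} (f : A.Hom X Z p) (a : A.Hom Z Z' 0)
    (b : A.Hom Z' Z 0) (hab : A.comp a b (add_zero 0) = A.id Z) (g : A.Hom Z Y q) (h : p + q = n) :
    A.comp (A.comp f a (add_zero p)) (A.comp b g (zero_add q)) h = A.comp f g h := by
  rw [A.assoc f a (A.comp b g (zero_add q)) (add_zero p) (zero_add q) h h,
    ← A.assoc a b g (add_zero 0) (zero_add q) (zero_add q) (zero_add q), hab, A.id_comp]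

lemma d_comp_closed {X Y Z : A.Obj} {p : ℤ} (p' : ℤ) (f : A.Hom X Y p) (a : A.Hom Y Z 0)
    (ha : A.d 0 1 a = 0) (hp : p + 1 = p') :
    A.d p p' (A.comp f a (add_zero p)) = A.comp (A.d p p' f) a (add_zero p') := by
  rw [A.leibniz f a (add_zero p) hp (zero_add 1) hp, ha, A.comp_zero, zero_add,
    Int.negOnePow_zero, one_smul]

lemma d_closed_comp {X Y Z : A.Obj} {p : ℤ} (p' : ℤ) (a : A.Hom X Y 0) (f : A.Hom Y Z p)
    (ha : A.d 0 1 a = 0) (hp : p + 1 = p') :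
    A.d p p' (A.comp a f (zero_add p)) = A.comp a (A.d p p' f) (zero_add p') := by
  rw [A.leibniz a f (zero_add p) (zero_add 1) hp hp, ha, A.zero_comp, smul_zero, add_zero]

/-- Cones are transported along isomorphisms of the apex. -/
def Cone.ofIso {X Y Z Z' : Z0 A} {f : X ⟶ Y} (c : A.Cone f Z) (e : Z ≅ Z') : A.Cone f Z' where
  i := A.comp c.i e.hom.val (add_zero 0)
  j := A.comp e.inv.val c.j (zero_add 0)
  s := A.comp c.s e.hom.val (add_zero _)
  p := A.comp e.inv.val c.p (zero_add _)
  i_j := (comp_iso_cancel _ _ _ (Z0.iso_hom_inv e) _ _).trans c.i_j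
  i_p := (comp_iso_cancel _ _ _ (Z0.iso_hom_inv e) _ _).trans c.i_p
  s_j := (comp_iso_cancel _ _ _ (Z0.iso_hom_inv e) _ _).trans c.s_j
  s_p := (comp_iso_cancel _ _ _ (Z0.iso_hom_inv e) _ _).trans c.s_p
  total := by
    rw [A.assoc e.inv.val c.j _ (zero_add 0) (add_zero 0) _ (add_zero 0),
      A.assoc e.inv.val c.p _ (zero_add 1) (add_neg_cancel 1) _ (add_zero 0),
      ← A.assoc c.j c.i e.hom.val (add_zero 0) _ (add_zero 0),
      ← A.assoc c.p c.s e.hom.val (add_neg_cancel 1) _ (add_zero 0),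
      ← A.comp_add, ← A.add_comp, c.total, A.id_comp, Z0.iso_inv_hom]
  d_i := by rw [d_comp_closed _ _ _ e.hom.closed (zero_add 1), c.d_i, A.zero_comp]
  d_p := by rw [d_closed_comp _ _ _ e.inv.closed one_add_one_eq_two, c.d_p, A.comp_zero]
  d_s := by
    rw [d_comp_closed _ _ _ e.hom.closed (neg_add_cancel 1), c.d_s,
      A.assoc f.val c.i _ _ (add_zero 0) _ (add_zero 0)]

end Iso

namespace DGFunctor

variable {k : Type w} [CommRing k] {A : DGCat.{w, v, u} k} {B : DGCat.{w, v', u'} k}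
  (F : DGFunctor A B)

/-- A DG-functor is fully faithful if it is bijective on morphisms of every degree. -/
def FullyFaithful : Prop := ∀ (X Y : A.Obj) (n : ℤ),
  Function.Bijective (F.map : A.Hom X Y n → B.Hom (F.obj X) (F.obj Y) n)

/-- The functor on closed morphisms of degree zero. -/
def mapZ0 : Z0 A ⥤ Z0 B where
  obj X := ⟨F.obj X.obj⟩
  map f := ⟨F.map f.val, by
    have := F.map_d 0 1 f.val
    rw [f.closed, map_zero] at this
    exact this.symm⟩
  map_id X := Z0.Hom.ext (F.map_id _)
  map_comp f g := Z0.Hom.ext (F.map_comp _ _ _)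

/-- The functor on homotopy categories. -/
def mapH0 : H0 A ⥤ H0 B :=
  CategoryTheory.Quotient.lift (homotopic A) (F.mapZ0 ⋙ H0.quotient B) (by
    rintro X Y f g ⟨s, hs⟩
    refine (H0.quotient_map_eq_iff B _ _).2 ⟨F.map s, ?_⟩
    have := F.map_d (-1) 0 s
    rw [hs, map_sub] at this
    exact this.symm)

lemma mapH0_map {X Y : Z0 A} (f : X ⟶ Y) :
    F.mapH0.map ((H0.quotient A).map f) = (H0.quotient B).map (F.mapZ0.map f) := rfl

end DGFunctor

section H0

variable {k : Type w} [CommRing k] {A : DGCat.{w, v, u} k}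

instance : (H0.quotient A).Full :=
  inferInstanceAs (CategoryTheory.Quotient.functor (homotopic A)).Full

instance : (H0.quotient A).Linear k :=
  CategoryTheory.Quotient.linear_functor k (homotopic A) _

lemma H0.exists_obj_eq (X : H0 A) : ∃ X', (H0.quotient A).obj X' = X := ⟨X.as, rfl⟩

lemma H0.exists_map_eq {X Y : Z0 A} (f : (H0.quotient A).obj X ⟶ (H0.quotient A).obj Y) :
    ∃ g : X ⟶ Y, f = (H0.quotient A).map g := ⟨_, ((H0.quotient A).map_preimage f).symm⟩

end H0

namespace DGFunctor

variable {k : Type w} [CommRing k] {A : DGCat.{w, v, u} k} {B : DGCat.{w, v', u'} k}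
  (F : DGFunctor A B)

instance : F.mapH0.Linear k where
  map_smul {X Y} f c := by
    obtain ⟨X, rfl⟩ := H0.exists_obj_eq X
    obtain ⟨Y, rfl⟩ := H0.exists_obj_eq Y
    obtain ⟨f, rfl⟩ := H0.exists_map_eq f
    have h : F.mapZ0.map (c • f) = c • F.mapZ0.map f := Z0.Hom.ext (map_smul F.map _ _)
    rw [← Functor.map_smul]
    exact (congrArg (H0.quotient B).map h).trans ((H0.quotient B).map_smul _ _)

variable {F}

/-- The lift of a closed morphism along a fully faithful DG-functor. -/
lemma FullyFaithful.exists_mapZ0_eq (hF : F.FullyFaithful) {X Y : Z0 A}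
    (f : F.mapZ0.obj X ⟶ F.mapZ0.obj Y) : ∃ g : X ⟶ Y, F.mapZ0.map g = f := by
  obtain ⟨g, hg⟩ := (hF _ _ _).2 f.val
  -- The preimage is closed because `F.map` is injective in degree one.
  refine ⟨⟨g, (hF _ _ _).1 ?_⟩, Z0.Hom.ext hg⟩
  rw [F.map_d, hg, map_zero]
  exact f.closed

lemma FullyFaithful.full (hF : F.FullyFaithful) : F.mapH0.Full where
  map_surjective {X Y} f := by
    obtain ⟨f, rfl⟩ := H0.exists_map_eq (X := F.mapZ0.obj X.as) (Y := F.mapZ0.obj Y.as) f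
    obtain ⟨g, rfl⟩ := hF.exists_mapZ0_eq f
    exact ⟨(H0.quotient A).map g, F.mapH0_map g⟩

/-- Degrees other than zero matter here: a homotopy between the images lifts by surjectivity in
degree `-1`, and its boundary is identified by injectivity in degree `0`. -/
lemma FullyFaithful.faithful (hF : F.FullyFaithful) : F.mapH0.Faithful where
  map_injective {X Y} f g h := by
    obtain ⟨X, rfl⟩ := H0.exists_obj_eq X
    obtain ⟨Y, rfl⟩ := H0.exists_obj_eq Y
    obtain ⟨f, rfl⟩ := H0.exists_map_eq f
    obtain ⟨g, rfl⟩ := H0.exists_map_eq g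
    obtain ⟨s, hs⟩ := (H0.quotient_map_eq_iff B _ _).1 h
    obtain ⟨s, rfl⟩ := (hF X.obj Y.obj _).2 s
    exact (H0.quotient_map_eq_iff A _ _).2 ⟨s, (hF _ _ _).1
      ((F.map_d _ _ _).trans (hs.trans (map_sub F.map _ _).symm))⟩

lemma FullyFaithful.fullZ0 (hF : F.FullyFaithful) : F.mapZ0.Full where
  map_surjective f := hF.exists_mapZ0_eq f

lemma FullyFaithful.faithfulZ0 (hF : F.FullyFaithful) : F.mapZ0.Faithful where
  map_injective h := Z0.Hom.ext ((hF _ _ _).1 (congrArg Z0.Hom.val h))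

variable (F) in
lemma essSurj_mapH0 [F.mapZ0.EssSurj] : F.mapH0.EssSurj where
  mem_essImage Y := ⟨(H0.quotient A).obj (F.mapZ0.objPreimage Y.as),
    ⟨(H0.quotient B).mapIso (F.mapZ0.objObjPreimageIso Y.as)⟩⟩

variable (F)

/-- The image of a cone under a DG-functor. -/
def mapCone {X Y Z : Z0 A} {f : X ⟶ Y} (c : A.Cone f Z) : B.Cone (F.mapZ0.map f) (F.mapZ0.obj Z) where
  i := F.map c.i
  j := F.map c.j
  s := F.map c.s
  p := F.map c.p
  i_j := (F.map_comp _ _ _).symm.trans ((congrArg F.map c.i_j).trans (F.map_id _))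
  i_p := (F.map_comp _ _ _).symm.trans ((congrArg F.map c.i_p).trans (map_zero _))
  s_j := (F.map_comp _ _ _).symm.trans ((congrArg F.map c.s_j).trans (map_zero _))
  s_p := (F.map_comp _ _ _).symm.trans ((congrArg F.map c.s_p).trans (F.map_id _))
  total := (congrArg₂ (· + ·) (F.map_comp _ _ _).symm (F.map_comp _ _ _).symm).trans
    ((map_add F.map _ _).symm.trans ((congrArg F.map c.total).trans (F.map_id _)))
  d_i := (F.map_d _ _ _).symm.trans ((congrArg F.map c.d_i).trans (map_zero _))
  d_p := (F.map_d _ _ _).symm.trans ((congrArg F.map c.d_p).trans (map_zero _))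
  d_s := (F.map_d _ _ _).symm.trans ((congrArg F.map c.d_s).trans (F.map_comp _ _ _))

variable {F}

/-- Fully faithful DG-functors reflect cones. -/
lemma FullyFaithful.exists_cone (hF : F.FullyFaithful) {X Y Z : Z0 A} {f : X ⟶ Y}
    (c : B.Cone (F.mapZ0.map f) (F.mapZ0.obj Z)) : Nonempty (A.Cone f Z) := by
  obtain ⟨i, hi⟩ := (hF _ _ _).2 c.i
  obtain ⟨j, hj⟩ := (hF _ _ _).2 c.j
  obtain ⟨s, hs⟩ := (hF _ _ _).2 c.s
  obtain ⟨p, hp⟩ := (hF _ _ _).2 c.p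
  -- A cone consists of morphisms subject to equations only, so each axiom may be tested after
  -- applying `F`.
  refine ⟨⟨i, j, s, p, (hF _ _ _).1 ?_, (hF _ _ _).1 ?_, (hF _ _ _).1 ?_, (hF _ _ _).1 ?_,
    (hF _ _ _).1 ?_, (hF _ _ _).1 ?_, (hF _ _ _).1 ?_, (hF _ _ _).1 ?_⟩⟩
  · rw [F.map_comp, hi, hj, F.map_id]; exact c.i_j
  · rw [F.map_comp, hi, hp, map_zero]; exact c.i_p
  · rw [F.map_comp, hs, hj, map_zero]; exact c.s_j
  · rw [F.map_comp, hs, hp, F.map_id]; exact c.s_p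
  · rw [map_add, F.map_comp, F.map_comp, hi, hj, hs, hp, F.map_id]; exact c.total
  · rw [F.map_d, hi, map_zero]; exact c.d_i
  · rw [F.map_d, hp, map_zero]; exact c.d_p
  · rw [F.map_d, hs, F.map_comp, hi]; exact c.d_s

/-- If `F` is fully faithful and surjective up to closed isomorphisms, then `A` has cones if `B`
does. -/
lemma FullyFaithful.exists_cone_of_essSurj (hF : F.FullyFaithful) [F.mapZ0.EssSurj]
    (hB : ∀ {X Y : Z0 B} (f : X ⟶ Y), ∃ Z, Nonempty (B.Cone f Z)) {X Y : Z0 A} (f : X ⟶ Y) :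
    ∃ Z, Nonempty (A.Cone f Z) := by
  obtain ⟨Z, ⟨c⟩⟩ := hB (F.mapZ0.map f)
  exact ⟨_, hF.exists_cone (c.ofIso (F.mapZ0.objObjPreimageIso Z).symm)⟩

/-! ### Compatibility of DG-functors with translations and distinguished triangles. -/

section Shift

variable (F) (T : A.Translation) (T' : B.Translation)

/-- The comparison of translations, on closed morphisms. -/
def shiftIsoZ0 (X : Z0 A) :
    F.mapZ0.obj (T.functorZ0.obj X) ≅ T'.functorZ0.obj (F.mapZ0.obj X) where
  -- Both objects are identified with `F.obj X.obj` by invertible closed morphisms of degree one;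
  -- the comparison goes down along one and up along the other.
  hom := ⟨B.comp (F.map (T.σ X.obj)) (T'.τ (F.obj X.obj)) (add_neg_cancel 1), by
    change B.d (X := F.obj (T.obj X.obj)) (Y := T'.obj (F.obj X.obj)) 0 1
      (B.comp (F.map (T.σ X.obj)) (T'.τ (F.obj X.obj)) (add_neg_cancel 1)) = 0
    rw [B.leibniz _ _ (add_neg_cancel 1) one_add_one_eq_two (neg_add_cancel 1) (zero_add 1),
      T'.d_τ, ← F.map_d, T.d_σ, map_zero, B.comp_zero, B.zero_comp, smul_zero, add_zero]⟩
  inv := ⟨B.comp (T'.σ (F.obj X.obj)) (F.map (T.τ X.obj)) (add_neg_cancel 1), by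
    change B.d (X := T'.obj (F.obj X.obj)) (Y := F.obj (T.obj X.obj)) 0 1
      (B.comp (T'.σ (F.obj X.obj)) (F.map (T.τ X.obj)) (add_neg_cancel 1)) = 0
    rw [B.leibniz _ _ (add_neg_cancel 1) one_add_one_eq_two (neg_add_cancel 1) (zero_add 1),
      T'.d_σ, ← F.map_d, T.d_τ, map_zero, B.comp_zero, B.zero_comp, smul_zero, add_zero]⟩
  hom_inv_id := by
    ext
    change B.comp (B.comp (F.map (T.σ X.obj)) (T'.τ (F.obj X.obj)) (add_neg_cancel 1))
      (B.comp (T'.σ (F.obj X.obj)) (F.map (T.τ X.obj)) (add_neg_cancel 1)) _ = B.id (F.obj (T.obj X.obj))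
    rw [B.assoc _ _ _ _ (add_zero (-1)) _ (add_neg_cancel 1),
      ← B.assoc _ _ _ (neg_add_cancel 1) _ (zero_add (-1)), T'.τ_σ, B.id_comp, ← F.map_comp,
      T.σ_τ, F.map_id]
  inv_hom_id := by
    ext
    change B.comp (B.comp (T'.σ (F.obj X.obj)) (F.map (T.τ X.obj)) (add_neg_cancel 1))
      (B.comp (F.map (T.σ X.obj)) (T'.τ (F.obj X.obj)) (add_neg_cancel 1)) _ =
        B.id (T'.obj (F.obj X.obj))
    rw [B.assoc _ _ _ _ (add_zero (-1)) _ (add_neg_cancel 1),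
      ← B.assoc _ _ _ (neg_add_cancel 1) _ (zero_add (-1)), ← F.map_comp, T.τ_σ, F.map_id,
      B.id_comp, T'.σ_τ]

/-- On either side an inner pair `τ`, `σ` cancels, and what remains is `F.map (T.σ X.obj)`, then
`F.map f.val`, then `T'.τ`. -/
lemma shiftIsoZ0_naturality {X Y : Z0 A} (f : X ⟶ Y) :
    F.mapZ0.map (T.functorZ0.map f) ≫ (F.shiftIsoZ0 T T' Y).hom =
      (F.shiftIsoZ0 T T' X).hom ≫ T'.functorZ0.map (F.mapZ0.map f) := by
  ext
  change B.comp (F.map (A.comp (A.comp (T.σ X.obj) f.val (add_zero 1)) (T.τ Y.obj)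
      (add_neg_cancel 1))) (B.comp (F.map (T.σ Y.obj)) (T'.τ (F.obj Y.obj)) (add_neg_cancel 1)) _ =
    B.comp (B.comp (F.map (T.σ X.obj)) (T'.τ (F.obj X.obj)) (add_neg_cancel 1))
      (B.comp (B.comp (T'.σ (F.obj X.obj)) (F.map f.val) (add_zero 1)) (T'.τ (F.obj Y.obj))
        (add_neg_cancel 1)) _
  rw [F.map_comp, B.assoc _ (F.map (T.τ Y.obj)) _ _ (add_zero (-1)) _ (add_neg_cancel 1),
    ← B.assoc (F.map (T.τ Y.obj)) (F.map (T.σ Y.obj)) _ (neg_add_cancel 1) _ (zero_add (-1)),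
    ← F.map_comp (T.τ Y.obj), T.τ_σ, F.map_id, B.id_comp,
    B.assoc (T'.σ (F.obj X.obj)) (F.map f.val) _ _ (zero_add (-1)) _ (add_neg_cancel 1),
    B.assoc (F.map (T.σ X.obj)) _ _ _ (add_zero (-1)) _ (add_neg_cancel 1),
    ← B.assoc (T'.τ (F.obj X.obj)) _ _ (neg_add_cancel 1) _ (zero_add (-1)), T'.τ_σ, B.id_comp,
    F.map_comp, B.assoc _ _ _ _ (zero_add (-1)) _ (add_neg_cancel 1)]

/-- DG-functors commute with translations. -/
def shiftIso : T.functor ⋙ F.mapH0 ≅ F.mapH0 ⋙ T'.functor :=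
  NatIso.ofComponents (fun X => (H0.quotient B).mapIso (F.shiftIsoZ0 T T' X.as)) (by
    intro X Y f
    obtain ⟨f, rfl⟩ := H0.exists_map_eq (X := X.as) (Y := Y.as) f
    exact ((H0.quotient B).map_comp _ _).symm.trans
      ((congrArg (H0.quotient B).map (F.shiftIsoZ0_naturality T T' f)).trans
      ((H0.quotient B).map_comp _ _)))

/-- This controls the third morphism of a triangle; the other two are transported by functoriality
alone. -/
lemma mapZ0_coneToTranslation {X Y Z : Z0 A} {f : X ⟶ Y} (c : A.Cone f Z) :
    F.mapZ0.map (T.coneToTranslation c) ≫ (F.shiftIsoZ0 T T' X).hom =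
      T'.coneToTranslation (F.mapCone c) := by
  ext
  change B.comp (F.map (A.comp c.p (T.τ X.obj) (add_neg_cancel 1)))
    (B.comp (F.map (T.σ X.obj)) (T'.τ (F.obj X.obj)) (add_neg_cancel 1)) _ =
    B.comp (F.map c.p) (T'.τ (F.obj X.obj)) (add_neg_cancel 1)
  rw [F.map_comp, B.assoc _ (F.map (T.τ X.obj)) _ _ (add_zero (-1)) _ (add_neg_cancel 1),
    ← B.assoc (F.map (T.τ X.obj)) (F.map (T.σ X.obj)) _ (neg_add_cancel 1) _ (zero_add (-1)),
    ← F.map_comp, T.τ_σ, F.map_id, B.id_comp]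

/-- DG-functors preserve distinguished triangles. -/
lemma map_distinguished {X Y Z : H0 A} {f : X ⟶ Y} {g : Y ⟶ Z} {h : Z ⟶ T.functor.obj X}
    (H : T.Distinguished f g h) : T'.Distinguished (F.mapH0.map f) (F.mapH0.map g)
      (F.mapH0.map h ≫ (F.shiftIso T T').hom.app X) := by
  obtain ⟨X', Y', Z', φ, c, a, b, e, h₁, h₂, h₃⟩ := H
  refine ⟨F.mapZ0.obj X', F.mapZ0.obj Y', F.mapZ0.obj Z', F.mapZ0.map φ, F.mapCone c,
    F.mapH0.mapIso a, F.mapH0.mapIso b, F.mapH0.mapIso e, ?_, ?_, ?_⟩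
  · exact ((F.mapH0.map_comp _ _).symm.trans (congrArg F.mapH0.map h₁)).trans
      (F.mapH0.map_comp _ _)
  · exact ((F.mapH0.map_comp _ _).symm.trans (congrArg F.mapH0.map h₂)).trans
      (F.mapH0.map_comp _ _)
  · have h₄ := (F.shiftIso T T').hom.naturality a.hom
    have h₅ : F.mapH0.map ((H0.quotient A).map (T.coneToTranslation c)) ≫
        (F.shiftIso T T').hom.app ((H0.quotient A).obj X') =
          (H0.quotient B).map (T'.coneToTranslation (F.mapCone c)) :=
      ((H0.quotient B).map_comp _ _).symm.trans
        (congrArg (H0.quotient B).map (F.mapZ0_coneToTranslation T T' c))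
    calc _ = F.mapH0.map h ≫ (F.shiftIso T T').hom.app X ≫ T'.functor.map (F.mapH0.map a.hom) :=
          Category.assoc _ _ _
      _ = F.mapH0.map h ≫ F.mapH0.map (T.functor.map a.hom) ≫
          (F.shiftIso T T').hom.app ((H0.quotient A).obj X') :=
        congrArg (F.mapH0.map h ≫ ·) h₄.symm
      _ = F.mapH0.map (h ≫ T.functor.map a.hom) ≫
          (F.shiftIso T T').hom.app ((H0.quotient A).obj X') := by
        rw [F.mapH0.map_comp, Category.assoc]
      _ = F.mapH0.map e.hom ≫ F.mapH0.map ((H0.quotient A).map (T.coneToTranslation c)) ≫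
          (F.shiftIso T T').hom.app ((H0.quotient A).obj X') :=
        (congrArg (· ≫ (F.shiftIso T T').hom.app ((H0.quotient A).obj X'))
          ((congrArg F.mapH0.map h₃).trans (F.mapH0.map_comp _ _))).trans (Category.assoc _ _ _)
      _ = _ := congrArg (F.mapH0.map e.hom ≫ ·) h₅

end Shift

end DGFunctor

end DGCat

end

noncomputable section

/-! ### Functoriality of the pretriangulated hull, and total objects of twisted complexes -/

namespace DGCat

universe v'' u''

variable {k : Type w} [CommRing k]

namespace DGFunctor

variable {A : DGCat.{w, v, u} k} {B : DGCat.{w, v', u'} k} (F : DGFunctor A B)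

lemma map_units_smul {X Y : A.Obj} {n : ℤ} (e : ℤˣ) (f : A.Hom X Y n) :
    F.map (e • f) = e • F.map f := map_zsmul F.map (e : ℤ) f

/-- The image of a twisted complex under a DG-functor. -/
abbrev mapTwisted (C : Twisted A) : Twisted B where
  n := C.n
  obj i := F.obj (C.obj i)
  r := C.r
  q i j := F.map (C.q i j)
  q_eq_zero i j h := by rw [C.q_eq_zero i j h, map_zero]
  maurerCartan i j := by
    have h := congrArg F.map (C.maurerCartan i j)
    rw [map_zero, map_add, map_sum, map_units_smul, F.map_d] at h
    simpa only [F.map_comp] using h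

/-- The matrix of images. -/
def mapMatrix {C D : Twisted A} {m : ℤ} (f : Twisted.Hom C D m) :
    Twisted.Hom (F.mapTwisted C) (F.mapTwisted D) m := fun i j => F.map (f i j)

lemma mapMatrix_comp {C D E : Twisted A} {p q m : ℤ} (f : Twisted.Hom C D p)
    (g : Twisted.Hom D E q) (h : p + q = m) :
    F.mapMatrix (Twisted.comp f g h) = Twisted.comp (F.mapMatrix f) (F.mapMatrix g) h := by
  funext i j
  simp only [mapMatrix, Twisted.comp, map_sum, F.map_comp]

lemma mapMatrix_δ {C D : Twisted A} (m m' : ℤ) (f : Twisted.Hom C D m) :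
    F.mapMatrix (Twisted.δ m m' f) = Twisted.δ m m' (F.mapMatrix f) := by
  funext i j
  simp only [mapMatrix, Twisted.δ, map_units_smul, F.map_d]

lemma mapMatrix_dFun {C D : Twisted A} (m m' : ℤ) (h : m + 1 = m') (f : Twisted.Hom C D m) :
    F.mapMatrix (Twisted.dFun m m' h f) = Twisted.dFun m m' h (F.mapMatrix f) := by
  have h₁ := F.mapMatrix_comp f D.q h
  have h₂ := F.mapMatrix_comp C.q f ((add_comm 1 m).trans h)
  have h₃ := F.mapMatrix_δ m m' f
  funext i j
  have e₁ := congrFun (congrFun h₁ i) j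
  have e₂ := congrFun (congrFun h₂ i) j
  have e₃ := congrFun (congrFun h₃ i) j
  simp only [Twisted.dFun, Pi.add_apply, Pi.sub_apply, Pi.smul_apply] at e₁ e₂ e₃ ⊢
  refine Eq.trans ?_ (congrArg₂ (· - ·) (congrArg₂ (· + ·) e₃ e₁)
    (congrArg (m.negOnePow • ·) e₂))
  simp only [mapMatrix, Pi.add_apply, Pi.sub_apply, Pi.smul_apply, map_add, map_sub,
    map_units_smul]

lemma map_eqId {X Y : A.Obj} {n : ℤ} (h : X = Y) (hn : n = 0) :
    F.map (A.eqId h hn) = B.eqId (congrArg F.obj h) hn := by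
  subst h; subst hn; exact F.map_id X

/-- `mapMatrix` as a linear map. -/
def mapMatrixHom (C D : Twisted A) (m : ℤ) :
    Twisted.Hom C D m →ₗ[k] Twisted.Hom (F.mapTwisted C) (F.mapTwisted D) m where
  toFun := F.mapMatrix
  map_add' f g := by funext i j; exact map_add F.map _ _
  map_smul' c f := by funext i j; exact map_smul F.map _ _

/-- The DG-functor between pretriangulated hulls induced by a DG-functor. -/
def mapPretr : DGFunctor (pretr A) (pretr B) where
  obj := F.mapTwisted
  map := F.mapMatrixHom _ _ _
  map_d n m f := by
    by_cases h : n + 1 = m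
    · exact ((congrArg F.mapMatrix (Twisted.d_apply n m h f)).trans
        (F.mapMatrix_dFun n m h f)).trans (Twisted.d_apply n m h _).symm
    · exact (congrArg F.mapMatrix ((pretr A).d_shape n m f h)).trans
        ((by funext i j; exact map_zero F.map : F.mapMatrix 0 = 0).trans
          ((pretr B).d_shape n m (F.mapMatrix f) h).symm)
  map_id C := by
    funext i j
    change F.map (Twisted.idMatrix C i j) = Twisted.idMatrix (F.mapTwisted C) i j
    unfold Twisted.idMatrix
    split_ifs with h
    · exact F.map_eqId _ _
    · exact map_zero F.map
  map_comp f g h := F.mapMatrix_comp f g h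

variable {F} in
-- As graded modules the morphisms of twisted complexes are matrices of morphisms in various
-- degrees, so bijectivity is checked entrywise and the twisting plays no role.
lemma FullyFaithful.mapPretr (hF : F.FullyFaithful) : F.mapPretr.FullyFaithful := by
  intro C D n
  constructor
  · intro f g h
    funext i j
    exact (hF _ _ _).1 (congrFun (congrFun h i) j)
  · intro f
    choose g hg using fun i j => (hF (C.obj j) (D.obj i) _).2 (f i j)
    exact ⟨g, by funext i j; exact hg i j⟩

/-- The composition of DG-functors. -/
def comp {A : DGCat.{w, v, u} k} {B : DGCat.{w, v', u'} k} {E : DGCat.{w, v'', u''} k}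
    (F : DGFunctor A B) (G : DGFunctor B E) : DGFunctor A E where
  obj X := G.obj (F.obj X)
  map := G.map.comp F.map
  map_d n m f := (congrArg G.map (F.map_d n m f)).trans (G.map_d n m _)
  map_id X := (congrArg G.map (F.map_id X)).trans (G.map_id _)
  map_comp f g h := (congrArg G.map (F.map_comp f g h)).trans (G.map_comp _ _ h)

lemma FullyFaithful.comp {A : DGCat.{w, v, u} k} {B : DGCat.{w, v', u'} k}
    {E : DGCat.{w, v'', u''} k} {F : DGFunctor A B} {G : DGFunctor B E} (hF : F.FullyFaithful)
    (hG : G.FullyFaithful) : (F.comp G).FullyFaithful :=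
  fun X Y n => (hG _ _ n).comp (hF X Y n)

end DGFunctor

variable {B : DGCat.{w, v, u} k}

/-- An object representing the twisted complex `(⊕ Cⱼ[rⱼ], q)`: a direct sum of the `Cⱼ`, shifted by
`rⱼ`, with differential given by `q`. -/
structure Realization (C : Twisted B) where
  obj : B.Obj
  ι : ∀ j, B.Hom (C.obj j) obj (-C.r j)
  π : ∀ j, B.Hom obj (C.obj j) (C.r j)
  ι_π : ∀ j, B.comp (ι j) (π j) (neg_add_cancel _) = B.id (C.obj j)
  ι_π_of_ne : ∀ (i j : Fin C.n) (n : ℤ) (h : -C.r i + C.r j = n), i ≠ j →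
    B.comp (ι i) (π j) h = 0
  total : ∑ j, B.comp (π j) (ι j) (add_neg_cancel _) = B.id obj
  d_ι : ∀ j, B.d (-C.r j) (1 - C.r j) (ι j) = ∑ i, B.comp (C.q i j) (ι i) (by omega)
  -- The sign is forced by the preceding conditions: differentiate `total` by the Leibniz rule and
  -- compose with `π i`.
  d_π : ∀ i, B.d (C.r i) (C.r i + 1) (π i) =
    -((C.r i).negOnePow • ∑ j, B.comp (π j) (C.q i j) (by omega))

namespace Realization

variable {C D E : Twisted B} (R : Realization C) (S : Realization D) (U : Realization E)

lemma ι_comp_π_comp (j : Fin C.n) {Y : B.Obj} {q n : ℤ} (x : B.Hom (C.obj j) Y q)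
    (h : C.r j + q = n) (h' : -C.r j + n = q) : B.comp (R.ι j) (B.comp (R.π j) x h) h' = x := by
  rw [← B.assoc (R.ι j) (R.π j) x (neg_add_cancel _) h (zero_add q) h', R.ι_π, B.id_comp]

lemma ι_comp_π_comp_of_ne (i j : Fin C.n) (hij : i ≠ j) {Y : B.Obj} {q n n' : ℤ}
    (x : B.Hom (C.obj j) Y q) (h : C.r j + q = n) (h' : -C.r i + n = n') :
    B.comp (R.ι i) (B.comp (R.π j) x h) h' = 0 := by
  rw [← B.assoc (R.ι i) (R.π j) x rfl h (by omega) h', R.ι_π_of_ne i j _ _ hij, B.zero_comp]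

/-- The intermediate degrees `n j` are free variables, so that the identity applies to whatever
expression for them occurs in a goal. -/
lemma sum_π_comp_ι_comp {Y : B.Obj} {m : ℤ} (x : B.Hom R.obj Y m) (n : Fin C.n → ℤ)
    (h : ∀ j, -C.r j + m = n j) :
    ∑ j, B.comp (R.π j) (B.comp (R.ι j) x (h j)) (by rw [← h j]; omega) = x := by
  refine Eq.trans (Finset.sum_congr rfl fun j _ => ?_)
    ((B.sum_comp Finset.univ (fun j => B.comp (R.π j) (R.ι j) (add_neg_cancel _)) x
      (zero_add m)).symm.trans ?_)
  · exact (B.assoc _ _ _ _ _ _ _).symm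
  · rw [R.total, B.id_comp]

lemma sum_comp_π_comp_ι {Y : B.Obj} {m : ℤ} (x : B.Hom Y R.obj m) (n : Fin C.n → ℤ)
    (h : ∀ j, m + C.r j = n j) :
    ∑ j, B.comp (B.comp x (R.π j) (h j)) (R.ι j) (by rw [← h j]; omega) = x := by
  refine Eq.trans (Finset.sum_congr rfl fun j _ => ?_)
    ((B.comp_sum Finset.univ x (fun j => B.comp (R.π j) (R.ι j) (add_neg_cancel _))
      (add_zero m)).symm.trans ?_)
  · exact B.assoc _ _ _ _ _ _ _
  · rw [R.total, B.comp_id]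

/-- A morphism `C_j ⟶ D_i` as a morphism between the total objects. -/
def entry (m : ℤ) (i : Fin D.n) (j : Fin C.n) :
    B.Hom (C.obj j) (D.obj i) (m + D.r i - C.r j) →ₗ[k] B.Hom R.obj S.obj m where
  toFun x := B.comp (B.comp (R.π j) x (show _ = m + D.r i by omega)) (S.ι i) (by omega)
  map_add' x y := by rw [B.comp_add, B.add_comp]
  map_smul' c x := by rw [B.comp_smul, B.smul_comp, RingHom.id_apply]

lemma entry_apply (m : ℤ) (i : Fin D.n) (j : Fin C.n)
    (x : B.Hom (C.obj j) (D.obj i) (m + D.r i - C.r j)) :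
    entry R S m i j x =
      B.comp (B.comp (R.π j) x (show _ = m + D.r i by omega)) (S.ι i) (by omega) := rfl

lemma entry_units_smul (m : ℤ) (i : Fin D.n) (j : Fin C.n) (e : ℤˣ)
    (x : B.Hom (C.obj j) (D.obj i) (m + D.r i - C.r j)) :
    entry R S m i j (e • x) = e • entry R S m i j x := map_zsmul (entry R S m i j) (e : ℤ) x

/-- A matrix as a morphism between the total objects. -/
def ofMatrix (m : ℤ) : Twisted.Hom C D m →ₗ[k] B.Hom R.obj S.obj m where
  toFun f := ∑ i, ∑ j, entry R S m i j (f i j)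
  map_add' f g := by simp only [Pi.add_apply, map_add, Finset.sum_add_distrib]
  map_smul' c f := by simp only [Pi.smul_apply, map_smul, Finset.smul_sum, RingHom.id_apply]

lemma ofMatrix_apply (m : ℤ) (f : Twisted.Hom C D m) :
    ofMatrix R S m f = ∑ i, ∑ j, entry R S m i j (f i j) := rfl

lemma ofMatrix_units_smul (m : ℤ) (e : ℤˣ) (f : Twisted.Hom C D m) :
    ofMatrix R S m (e • f) = e • ofMatrix R S m f := map_zsmul (ofMatrix R S m) (e : ℤ) f

lemma entry_comp {p q m : ℤ} (h : p + q = m) (i : Fin E.n) (l : Fin D.n) (j : Fin C.n)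
    (x : B.Hom (C.obj j) (D.obj l) (p + D.r l - C.r j))
    (y : B.Hom (D.obj l) (E.obj i) (q + E.r i - D.r l)) :
    B.comp (entry R S p l j x) (entry S U q i l y) h =
      entry R U m i j (B.comp x y (by omega)) := by
  simp only [entry_apply]
  rw [B.assoc _ (S.ι l) _ _ (show _ = q - D.r l by omega) _ (by omega),
    ← B.assoc (S.ι l) _ (U.ι i) (show _ = q + E.r i - D.r l by omega) _ (by omega),
    ι_comp_π_comp, ← B.assoc (B.comp (R.π j) x _) y (U.ι i) (show _ = m + E.r i by omega) _
      (by omega), B.assoc (R.π j) x y _ (show _ = m + E.r i - C.r j by omega)]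

lemma entry_comp_of_ne {p q m : ℤ} (h : p + q = m) (i : Fin E.n) (l l' : Fin D.n) (hl : l ≠ l')
    (j : Fin C.n) (x : B.Hom (C.obj j) (D.obj l) (p + D.r l - C.r j))
    (y : B.Hom (D.obj l') (E.obj i) (q + E.r i - D.r l')) :
    B.comp (entry R S p l j x) (entry S U q i l' y) h = 0 := by
  simp only [entry_apply]
  rw [B.assoc _ (S.ι l) _ _ (show _ = q - D.r l by omega) _ (by omega),
    ← B.assoc (S.ι l) _ (U.ι i) (show _ = q + E.r i - D.r l by omega) _ (by omega),
    ι_comp_π_comp_of_ne _ _ _ hl, B.zero_comp, B.comp_zero]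

lemma ofMatrix_comp {p q m : ℤ} (h : p + q = m) (f : Twisted.Hom C D p) (g : Twisted.Hom D E q) :
    ofMatrix R U m (Twisted.comp f g h) = B.comp (ofMatrix R S p f) (ofMatrix S U q g) h := by
  simp only [ofMatrix_apply, Twisted.comp, map_sum, B.sum_comp, B.comp_sum]
  rw [Finset.sum_comm (s := (Finset.univ : Finset (Fin D.n)))]
  rw [Finset.sum_comm]
  refine Finset.sum_congr rfl fun j _ => ?_
  rw [Finset.sum_comm (s := (Finset.univ : Finset (Fin D.n)))]
  refine Finset.sum_congr rfl fun i _ => ?_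
  refine Finset.sum_congr rfl fun l _ => ?_
  -- Of the double sum over the middle index only the diagonal survives, by orthogonality of `S.ι`
  -- and `S.π`.
  rw [Finset.sum_eq_single l]
  · exact (entry_comp R S U h i l j _ _).symm
  · intro l' _ hl
    exact entry_comp_of_ne R S U h i l l' hl.symm j _ _
  · intro hl; exact absurd (Finset.mem_univ _) hl

/-- The Leibniz rule for the triple product `π`, `x`, `ι`. Differentiating `ι` produces `D.q` and
differentiating `π` produces `C.q`. Since `S.ι i` has degree `-D.r i`, the middle term acquires
exactly the sign built into `Twisted.δ`; in the last term all the signs combine to $-(-1)^m$. -/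
lemma d_entry {m m' : ℤ} (h : m + 1 = m') (i : Fin D.n) (j : Fin C.n)
    (x : B.Hom (C.obj j) (D.obj i) (m + D.r i - C.r j)) :
    B.d m m' (entry R S m i j x) =
      entry R S m' i j ((D.r i).negOnePow • B.d _ (m' + D.r i - C.r j) x) +
      ∑ l, entry R S m' l j (B.comp x (D.q l i) (by omega)) -
      m.negOnePow • ∑ l, entry R S m' i l (B.comp (C.q j l) x (by omega)) := by
  rw [entry_apply, B.leibniz _ (S.ι i) _ (p' := m' + D.r i) (q' := 1 - D.r i) (by omega)
    (by omega) h, B.leibniz (R.π j) x _ (p' := C.r j + 1) (q' := m' + D.r i - C.r j) rfl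
    (by omega) (by omega), S.d_ι, R.d_π, B.comp_sum, B.neg_comp, B.units_smul_comp, B.sum_comp,
    B.add_comp, smul_add, B.units_smul_comp, B.neg_comp, B.units_smul_comp, B.sum_comp,
    entry_units_smul]
  have h₁ : ∀ l, B.comp (B.comp (R.π j) x (show _ = m + D.r i by omega))
      (B.comp (D.q l i) (S.ι l) (show _ = 1 - D.r i by omega)) (show _ = m' by omega) =
      entry R S m' l j (B.comp x (D.q l i) (by omega)) := by
    intro l
    rw [entry_apply, ← B.assoc _ (D.q l i) _ (show _ = m' + D.r l by omega) _ (by omega),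
      B.assoc (R.π j) x _ _ (show _ = m' + D.r l - C.r j by omega)]
  have h₂ : ∀ l, B.comp (B.comp (B.comp (R.π l) (C.q j l) (show _ = C.r j + 1 by omega)) x
      (show _ = m' + D.r i by omega)) (S.ι i) (show _ = m' by omega) =
      entry R S m' i l (B.comp (C.q j l) x (by omega)) := by
    intro l
    rw [entry_apply, B.assoc (R.π l) _ x _ (show _ = m' + D.r i - C.r l by omega)]
  simp only [h₁, h₂, smul_neg, smul_smul]
  rw [show (-D.r i).negOnePow = (D.r i).negOnePow from Int.negOnePow_neg _,
    show (D.r i).negOnePow * ((m + D.r i - C.r j).negOnePow * (C.r j).negOnePow) =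
      m.negOnePow by
      rw [← Int.negOnePow_add, ← Int.negOnePow_add, Int.negOnePow_eq_iff]
      exact ⟨D.r i, by ring⟩, entry_apply]
  abel

lemma d_ofMatrix {m m' : ℤ} (h : m + 1 = m') (f : Twisted.Hom C D m) :
    B.d m m' (ofMatrix R S m f) = ofMatrix R S m' (Twisted.dFun m m' h f) := by
  rw [Twisted.dFun, map_sub, map_add, ofMatrix_units_smul]
  simp only [ofMatrix_apply, map_sum, d_entry R S h, Finset.sum_add_distrib,
    Finset.sum_sub_distrib, ← Finset.smul_sum, Twisted.comp]
  congr 1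
  · congr 1
    rw [Finset.sum_comm, Finset.sum_comm (s := (Finset.univ : Finset (Fin D.n)))]
    exact Finset.sum_congr rfl fun j _ => Finset.sum_comm
  · exact congrArg _ (Finset.sum_congr rfl fun i _ => Finset.sum_comm)

lemma ι_comp_ofMatrix_comp_π {m : ℤ} (f : Twisted.Hom C D m) (i : Fin D.n) (j : Fin C.n) :
    B.comp (B.comp (R.ι j) (ofMatrix R S m f) (show _ = m - C.r j by omega)) (S.π i)
      (show _ = m + D.r i - C.r j by omega) = f i j := by
  simp only [ofMatrix_apply, B.comp_sum, B.sum_comp]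
  have key : ∀ i' j', B.comp (B.comp (R.ι j) (entry R S m i' j' (f i' j'))
      (show _ = m - C.r j by omega)) (S.π i) (show _ = m + D.r i - C.r j by omega) =
      B.comp (B.comp (R.ι j) (B.comp (R.π j') (f i' j') (show _ = m + D.r i' by omega))
        (show _ = m + D.r i' - C.r j by omega)) (B.comp (S.ι i') (S.π i) rfl) (by omega) := by
    intro i' j'
    rw [entry_apply, ← B.assoc (R.ι j) _ (S.ι i') (show _ = m + D.r i' - C.r j by omega) _
      (by omega), B.assoc _ (S.ι i') (S.π i) _ rfl]
  simp only [key]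
  rw [Finset.sum_eq_single i, Finset.sum_eq_single j]
  · rw [ι_comp_π_comp, ← B.assoc _ _ _ (show _ = m - C.r j by omega) _ (by omega), B.assoc _ _ _ _ (neg_add_cancel _) _ (add_zero _), S.ι_π,
      B.comp_id]
  · intro j' _ hj
    rw [ι_comp_π_comp_of_ne _ _ _ hj.symm, B.zero_comp]
  · intro hl; exact absurd (Finset.mem_univ _) hl
  · intro i' _ hi
    refine Finset.sum_eq_zero fun j' _ => ?_
    rw [S.ι_π_of_ne i' i _ _ hi, B.comp_zero]
  · intro hl; exact absurd (Finset.mem_univ _) hl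

lemma ofMatrix_bijective (m : ℤ) : Function.Bijective (ofMatrix R S m) := by
  constructor
  · intro f g h
    funext i j
    rw [← ι_comp_ofMatrix_comp_π R S f, ← ι_comp_ofMatrix_comp_π R S g, h]
  · intro g
    -- The matrix of `g` is obtained by restricting to summands and projecting; inserting `total` on
    -- both sides of `g` recovers it.
    refine ⟨fun i j => B.comp (B.comp (R.ι j) g (show _ = m - C.r j by omega)) (S.π i)
      (show _ = m + D.r i - C.r j by omega), ?_⟩
    have key : ∀ i j, entry R S m i j (B.comp (B.comp (R.ι j) g (show _ = m - C.r j by omega))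
        (S.π i) (show _ = m + D.r i - C.r j by omega)) =
        B.comp (B.comp (B.comp (R.π j) (B.comp (R.ι j) g (show _ = m - C.r j by omega))
          (show _ = m by omega)) (S.π i) (show _ = m + D.r i by omega)) (S.ι i) (by omega) := by
      intro i j
      rw [entry_apply, B.assoc (R.π j) _ (S.π i) _ (show _ = m + D.r i - C.r j by omega)]
    simp only [ofMatrix_apply, key, ← B.sum_comp]
    rw [R.sum_π_comp_ι_comp g (fun j => m - C.r j) (fun j => by omega)]
    exact S.sum_comp_π_comp_ι g _ _

/-- No computation with the casts in `idMatrix` is needed: the identity is the image of some matrix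
`f`, and `f` times the identity matrix is `f`, so multiplicativity gives the claim. -/
lemma ofMatrix_id : ofMatrix R R 0 (Twisted.idMatrix C) = B.id R.obj := by
  obtain ⟨f, hf⟩ := (ofMatrix_bijective R R 0).2 (B.id R.obj)
  rw [← hf]
  have h := ofMatrix_comp R R R (add_zero 0) f (Twisted.idMatrix C)
  rw [Twisted.comp_id, hf, B.id_comp] at h
  rw [hf, ← h]

/-- The total object of twisted complexes, as a DG-functor, if all twisted complexes are
represented. -/
def tot (R : ∀ C : Twisted B, Realization C) : DGFunctor (pretr B) B where
  obj C := (R C).obj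
  map {C D m} := ofMatrix (R C) (R D) m
  map_d {C D} n m f := by
    by_cases h : n + 1 = m
    · exact (congrArg (ofMatrix (R C) (R D) m) (Twisted.d_apply n m h f)).trans
        (d_ofMatrix (R C) (R D) h f).symm
    · exact (congrArg (ofMatrix (R C) (R D) m) ((pretr B).d_shape n m f h)).trans
        ((map_zero _).trans (B.d_shape n m _ h).symm)
  map_id C := ofMatrix_id (R C)
  map_comp {C D E} p q n f g h := ofMatrix_comp (R C) (R D) (R E) h f g

lemma tot_fullyFaithful (R : ∀ C : Twisted B, Realization C) : (tot R).FullyFaithful :=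
  fun _ _ m => ofMatrix_bijective _ _ m

end Realization

end DGCat

end

noncomputable section

/-! ### Total complexes of twisted complexes -/

namespace CochainComplex.HomComplex

section

variable {C : Type u} [Category.{v} C] [Preadditive C]

/-- The `v`-component as an additive map. -/
def Cochain.vHom (F G : CochainComplex C ℤ) {n : ℤ} (p q : ℤ) (h : p + n = q) :
    Cochain F G n →+ (F.X p ⟶ G.X q) := AddMonoidHom.mk' (fun z => z.v p q h) (fun _ _ => rfl)

lemma Cochain.sum_v {ι : Type*} (s : Finset ι) {F G : CochainComplex C ℤ} {n : ℤ}
    (z : ι → Cochain F G n) (p q : ℤ) (h : p + n = q) :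
    (∑ i ∈ s, z i).v p q h = ∑ i ∈ s, (z i).v p q h := map_sum (Cochain.vHom F G p q h) z s

lemma Cochain.sum_comp {ι : Type*} (s : Finset ι) {F G H : CochainComplex C ℤ} {p q n : ℤ}
    (f : ι → Cochain F G p) (g : Cochain G H q) (h : p + q = n) :
    (∑ i ∈ s, f i).comp g h = ∑ i ∈ s, (f i).comp g h :=
  map_sum (AddMonoidHom.mk' (fun f : Cochain F G p => f.comp g h)
    (fun f f' => Cochain.add_comp f f' g h)) f s

lemma Cochain.comp_sum {ι : Type*} (s : Finset ι) {F G H : CochainComplex C ℤ} {p q n : ℤ}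
    (f : Cochain F G p) (g : ι → Cochain G H q) (h : p + q = n) :
    f.comp (∑ i ∈ s, g i) h = ∑ i ∈ s, f.comp (g i) h :=
  map_sum (AddMonoidHom.mk' (fun g : Cochain G H q => f.comp g h)
    (fun g g' => Cochain.comp_add f g g' h)) g s

/-- Expressing `δ` as a graded commutator with the differentials lets the computations for total
complexes be carried out with composition of cochains, without choosing components. -/
lemma δ_eq_comp_diff {F G : CochainComplex C ℤ} {n m : ℤ} (h : n + 1 = m) (z : Cochain F G n) :
    δ n m z = z.comp (Cochain.diff G) h +
      m.negOnePow • (Cochain.diff F).comp z ((add_comm 1 n).trans h) := by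
  ext p q hpq
  rw [δ_v n m h z p q hpq (q - 1) (p + 1) (by omega) rfl, Cochain.add_v, Cochain.units_smul_v,
    Cochain.comp_v _ _ h p (q - 1) q (by omega) (by omega),
    Cochain.comp_v _ _ _ p (p + 1) q rfl (by omega), Cochain.diff_v, Cochain.diff_v]

end

end CochainComplex.HomComplex

namespace TotalComplex

open CochainComplex CochainComplex.HomComplex

variable {C : Type u} [Category.{v} C] [Preadditive C] [HasFiniteBiproducts C]
  {N : ℕ} (X : Fin N → CochainComplex C ℤ) (r : Fin N → ℤ)

/-- The direct sum of the `X j`, shifted by `r j`, with zero differential. -/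
abbrev graded : CochainComplex C ℤ where
  X m := ⨁ fun j => (X j).X (m + r j)
  d _ _ := 0

/-- The inclusion of a summand. -/
def inc (j : Fin N) : Cochain (X j) (graded X r) (-r j) :=
  Cochain.mk fun p q h => ((X j).XIsoOfEq (show p = q + r j by omega)).hom ≫
    biproduct.ι (fun j => (X j).X (q + r j)) j

/-- The projection to a summand. -/
def proj (j : Fin N) : Cochain (graded X r) (X j) (r j) :=
  Cochain.mk fun p q h => biproduct.π (fun j => (X j).X (p + r j)) j ≫
    ((X j).XIsoOfEq (show p + r j = q by omega)).hom

lemma inc_v (j : Fin N) (p q : ℤ) (h : p + -r j = q) : (inc X r j).v p q h =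
    ((X j).XIsoOfEq (show p = q + r j by omega)).hom ≫
      biproduct.ι (fun j => (X j).X (q + r j)) j := rfl

lemma proj_v (j : Fin N) (p q : ℤ) (h : p + r j = q) : (proj X r j).v p q h =
    biproduct.π (fun j => (X j).X (p + r j)) j ≫
      ((X j).XIsoOfEq (show p + r j = q by omega)).hom := rfl

lemma inc_proj (j : Fin N) :
    (inc X r j).comp (proj X r j) (neg_add_cancel _) = Cochain.ofHom (𝟙 (X j)) := by
  ext p
  rw [Cochain.comp_v _ _ _ p (p - r j) p (by omega) (by omega), inc_v, proj_v]
  simp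

lemma inc_proj_of_ne (i j : Fin N) (n : ℤ) (h : -r i + r j = n) (hij : i ≠ j) :
    (inc X r i).comp (proj X r j) h = 0 := by
  ext p q hpq
  rw [Cochain.comp_v _ _ _ p (p - r i) q (by omega) (by omega), inc_v, proj_v]
  simp [biproduct.ι_π_ne_assoc _ hij]

lemma sum_proj_inc :
    ∑ j, (proj X r j).comp (inc X r j) (add_neg_cancel _) = Cochain.ofHom (𝟙 (graded X r)) := by
  refine Cochain.ext₀ _ _ fun p => ?_
  rw [Cochain.sum_v, Cochain.ofHom_v]
  refine (Finset.sum_congr rfl fun j _ => ?_).trans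
    (biproduct.total (f := fun j => (X j).X (p + r j)))
  rw [Cochain.comp_v _ _ _ p (p + r j) p rfl (by omega), inc_v, proj_v]
  simp

variable {X r}
variable (q : ∀ i j : Fin N, Cochain (X j) (X i) (1 + r i - r j))

/-- The differential of the total complex. -/
def diffTot : Cochain (graded X r) (graded X r) 1 :=
  (∑ i, ∑ j, ((proj X r j).comp (q i j) (show _ = 1 + r i by omega)).comp (inc X r i)
    (show _ = 1 by omega)) +
  ∑ j, (r j).negOnePow • ((proj X r j).comp (Cochain.diff (X j))
    (show _ = 1 + r j by omega)).comp (inc X r j)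
    (show _ = 1 by omega)

lemma inc_comp_proj_comp (j : Fin N) {Y : CochainComplex C ℤ} {a n : ℤ} (x : Cochain (X j) Y a)
    (h : r j + a = n) (h' : -r j + n = a) : (inc X r j).comp ((proj X r j).comp x h) h' = x := by
  rw [← Cochain.comp_assoc _ _ _ (neg_add_cancel _) h (by omega), inc_proj, Cochain.id_comp]

lemma inc_comp_proj_comp_of_ne (i j : Fin N) (hij : i ≠ j) {Y : CochainComplex C ℤ} {a n n' : ℤ}
    (x : Cochain (X j) Y a) (h : r j + a = n) (h' : -r i + n = n') :
    (inc X r i).comp ((proj X r j).comp x h) h' = 0 := by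
  rw [← Cochain.comp_assoc _ _ _ rfl h (by omega), inc_proj_of_ne _ _ _ _ _ _ hij,
    Cochain.zero_comp]

lemma inc_diffTot (j : Fin N) : (inc X r j).comp (diffTot q) (show _ = 1 - r j by omega) =
    (∑ i, (q i j).comp (inc X r i) (by omega)) +
      (r j).negOnePow • (Cochain.diff (X j)).comp (inc X r j) (by omega) := by
  rw [diffTot, Cochain.comp_add, Cochain.comp_sum, Cochain.comp_sum]
  congr 1
  · refine Finset.sum_congr rfl fun i _ => ?_
    rw [Cochain.comp_sum, Finset.sum_eq_single j]
    · rw [← Cochain.comp_assoc _ _ _ (show _ = 1 + r i - r j by omega) _ (by omega),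
        inc_comp_proj_comp]
    · intro l _ hl
      rw [← Cochain.comp_assoc _ _ _ (show _ = 1 + r i - r j by omega) _ (by omega),
        inc_comp_proj_comp_of_ne _ _ hl.symm, Cochain.zero_comp]
    · intro hl; exact absurd (Finset.mem_univ _) hl
  · rw [Finset.sum_eq_single j]
    · rw [Cochain.comp_units_smul, ← Cochain.comp_assoc _ _ _ (show _ = 1 by omega) _ (by omega),
        inc_comp_proj_comp]
    · intro l _ hl
      rw [Cochain.comp_units_smul, ← Cochain.comp_assoc _ _ _ rfl _ (by omega),
        inc_comp_proj_comp_of_ne _ _ hl.symm, Cochain.zero_comp, smul_zero]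
    · intro hl; exact absurd (Finset.mem_univ _) hl

lemma comp_inc_comp_proj (j : Fin N) {Y : CochainComplex C ℤ} {a n : ℤ} (x : Cochain Y (X j) a)
    (h : a + -r j = n) (h' : n + r j = a) : (x.comp (inc X r j) h).comp (proj X r j) h' = x := by
  rw [Cochain.comp_assoc _ _ _ h (neg_add_cancel _) (by omega), inc_proj, Cochain.comp_id]

lemma comp_inc_comp_proj_of_ne (i j : Fin N) (hij : i ≠ j) {Y : CochainComplex C ℤ} {a n n' : ℤ}
    (x : Cochain Y (X i) a) (h : a + -r i = n) (h' : n + r j = n') :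
    (x.comp (inc X r i) h).comp (proj X r j) h' = 0 := by
  rw [Cochain.comp_assoc _ _ _ h rfl (by omega), inc_proj_of_ne _ _ _ _ _ _ hij,
    Cochain.comp_zero]

lemma diffTot_proj (i : Fin N) {n : ℤ} (hn : 1 + r i = n) : (diffTot q).comp (proj X r i) hn =
    (∑ j, (proj X r j).comp (q i j) (by omega)) +
      (r i).negOnePow • (proj X r i).comp (Cochain.diff (X i)) (by omega) := by
  subst hn
  rw [diffTot, Cochain.add_comp, Cochain.sum_comp, Cochain.sum_comp]
  congr 1
  · rw [Finset.sum_eq_single i]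
    · rw [Cochain.sum_comp]
      refine Finset.sum_congr rfl fun j _ => ?_
      rw [comp_inc_comp_proj]
    · intro l _ hl
      rw [Cochain.sum_comp]
      refine Finset.sum_eq_zero fun j _ => ?_
      rw [comp_inc_comp_proj_of_ne _ _ hl]
    · intro hl; exact absurd (Finset.mem_univ _) hl
  · rw [Finset.sum_eq_single i]
    · rw [Cochain.units_smul_comp, comp_inc_comp_proj]
    · intro l _ hl
      rw [Cochain.units_smul_comp, comp_inc_comp_proj_of_ne _ _ hl, smul_zero]
    · intro hl; exact absurd (Finset.mem_univ _) hl

/-- Inserting `sum_proj_inc` on both sides expresses a cochain through its matrix entries. -/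
lemma ext_inc_proj {m : ℤ} (f g : Cochain (graded X r) (graded X r) m)
    (h : ∀ i j, ((inc X r j).comp f rfl).comp (proj X r i) rfl =
      ((inc X r j).comp g rfl).comp (proj X r i) rfl) : f = g := by
  have key : ∀ f : Cochain (graded X r) (graded X r) m, f =
      ∑ j, ∑ i, (proj X r j).comp ((((inc X r j).comp f rfl).comp (proj X r i) rfl).comp (inc X r i)
        (show _ = -r j + m by omega)) (by omega) := by
    intro f
    have h₁ : ∀ j, ∑ i, (((inc X r j).comp f rfl).comp (proj X r i) rfl).comp (inc X r i)
        (show _ = -r j + m by omega) = (inc X r j).comp f rfl := by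
      intro j
      conv_rhs => rw [← Cochain.comp_id ((inc X r j).comp f rfl), ← sum_proj_inc, Cochain.comp_sum]
      refine Finset.sum_congr rfl fun i _ => ?_
      rw [Cochain.comp_assoc _ _ _ rfl (add_neg_cancel _) (by omega)]
    simp only [← Cochain.comp_sum, h₁]
    conv_lhs => rw [← Cochain.id_comp f, ← sum_proj_inc, Cochain.sum_comp]
    refine Finset.sum_congr rfl fun j _ => ?_
    rw [Cochain.comp_assoc _ _ _ (add_neg_cancel _) rfl (by omega)]
  rw [key f, key g]
  simp only [h]

lemma comp_inc_comp_proj_comp (j : Fin N) {Y Z : CochainComplex C ℤ} {a b n n' t : ℤ}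
    (x : Cochain Y (X j) a) (y : Cochain (X j) Z b) (h : a + -r j = n) (h' : r j + b = n')
    (h'' : n + n' = t) :
    (x.comp (inc X r j) h).comp ((proj X r j).comp y h') h'' = x.comp y (by omega) := by
  rw [Cochain.comp_assoc _ _ _ h (show _ = b by omega) (by omega), inc_comp_proj_comp]

lemma comp_inc_comp_proj_comp_of_ne (i j : Fin N) (hij : i ≠ j) {Y Z : CochainComplex C ℤ}
    {a b n n' t : ℤ} (x : Cochain Y (X i) a) (y : Cochain (X j) Z b) (h : a + -r i = n)
    (h' : r j + b = n') (h'' : n + n' = t) :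
    (x.comp (inc X r i) h).comp ((proj X r j).comp y h') h'' = 0 := by
  rw [Cochain.comp_assoc _ _ _ h rfl (by omega), inc_comp_proj_comp_of_ne _ _ hij,
    Cochain.comp_zero]

/-- The equation `dq + q² = 0`. -/
def MaurerCartan : Prop :=
  ∀ i j : Fin N, (r i).negOnePow • δ (1 + r i - r j) (2 + r i - r j) (q i j) +
    ∑ l, (q l j).comp (q i l) (by omega) = 0

-- Compare matrix entries. The square consists of the products of two `q`'s, the two mixed products
-- of `q` with an internal differential, and the square of the internal differential, which
-- vanishes. The mixed products add up to `(r i).negOnePow • δ (q i j)`, and the remaining sum is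
-- the Maurer–Cartan expression.
variable {q} in
lemma MaurerCartan.diffTot_comp_diffTot (hq : MaurerCartan q) :
    (diffTot q).comp (diffTot q) one_add_one_eq_two = 0 := by
  apply ext_inc_proj
  intro i j
  obtain ⟨t, ht⟩ : ∃ t, -r j + 2 + r i = t := ⟨_, rfl⟩
  rw [Cochain.comp_zero, Cochain.zero_comp,
    ← Cochain.comp_assoc _ _ _ (show _ = 1 - r j by omega) _ (by omega),
    Cochain.comp_assoc _ _ _ _ (show _ = 1 + r i by omega) (by omega), inc_diffTot, diffTot_proj,
    Cochain.add_comp, Cochain.comp_add, Cochain.comp_add, Cochain.sum_comp, Cochain.sum_comp,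
    Cochain.comp_units_smul, Cochain.units_smul_comp, Cochain.units_smul_comp,
    Cochain.comp_sum]
  have h₁ : ∀ l, ((q l j).comp (inc X r l) (show _ = 1 - r j by omega)).comp
      (∑ l', (proj X r l').comp (q i l') (show _ = 1 + r i by omega))
      (show _ = -r j + 2 + r i by omega) = (q l j).comp (q i l) (by omega) := by
    intro l
    rw [Cochain.comp_sum, Finset.sum_eq_single l]
    · exact comp_inc_comp_proj_comp _ _ _ _ _ _
    · intro l' _ hl
      exact comp_inc_comp_proj_comp_of_ne _ _ hl.symm _ _ _ _ _
    · intro hl; exact absurd (Finset.mem_univ _) hl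
  have h₂ : ∑ l, ((q l j).comp (inc X r l) (show _ = 1 - r j by omega)).comp
      ((r i).negOnePow • (proj X r i).comp (Cochain.diff (X i)) (show _ = 1 + r i by omega))
      (show _ = -r j + 2 + r i by omega) =
      (r i).negOnePow • (q i j).comp (Cochain.diff (X i)) (by omega) := by
    rw [Finset.sum_eq_single i]
    · rw [Cochain.comp_units_smul, comp_inc_comp_proj_comp]
    · intro l _ hl
      rw [Cochain.comp_units_smul, comp_inc_comp_proj_comp_of_ne _ _ hl, smul_zero]
    · intro hl; exact absurd (Finset.mem_univ _) hl
  have h₃ : ∑ l, ((Cochain.diff (X j)).comp (inc X r j) (show _ = 1 - r j by omega)).comp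
      ((proj X r l).comp (q i l) (show _ = 1 + r i by omega))
      (show _ = -r j + 2 + r i by omega) = (Cochain.diff (X j)).comp (q i j) (by omega) := by
    rw [Finset.sum_eq_single j]
    · rw [comp_inc_comp_proj_comp]
    · intro l _ hl
      rw [comp_inc_comp_proj_comp_of_ne _ _ hl.symm]
    · intro hl; exact absurd (Finset.mem_univ _) hl
  have h₄ : ((Cochain.diff (X j)).comp (inc X r j) (show _ = 1 - r j by omega)).comp
      ((proj X r i).comp (Cochain.diff (X i)) (show _ = 1 + r i by omega))
      (show _ = -r j + 2 + r i by omega) = 0 := by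
    by_cases hij : j = i
    · subst hij
      rw [comp_inc_comp_proj_comp]
      ext p p' hp
      rw [Cochain.comp_v _ _ _ p (p + 1) p' rfl (by omega)]
      simp
    · exact comp_inc_comp_proj_comp_of_ne _ _ hij _ _ _ _ _
  simp only [h₁]
  rw [h₂, h₃, h₄, smul_zero, smul_zero, add_zero]
  -- With the degree as a variable it can be replaced by `2 + r i - r j`, the form in which the
  -- Maurer–Cartan equation is given.
  have h₅ : ∀ (t : ℤ) (ht : -r j + 2 + r i = t),
      ((∑ l, (q l j).comp (q i l) (show _ = t by omega)) +
        (r i).negOnePow • (q i j).comp (Cochain.diff (X i)) (show _ = t by omega)) +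
        (r j).negOnePow • (Cochain.diff (X j)).comp (q i j) (show _ = t by omega) = 0 := by
    intro t ht
    obtain rfl : t = 2 + r i - r j := by omega
    have h := hq i j
    rw [δ_eq_comp_diff (by omega), smul_add, smul_smul] at h
    rw [show (r j).negOnePow = (r i).negOnePow * (2 + r i - r j).negOnePow by
      rw [← Int.negOnePow_add, Int.negOnePow_eq_iff]
      exact ⟨r j - r i - 1, by ring⟩, ← h]
    abel
  exact h₅ _ rfl

variable {q} in
/-- The total complex. -/
abbrev MaurerCartan.tot (hq : MaurerCartan q) : CochainComplex C ℤ where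
  X m := ⨁ fun j => (X j).X (m + r j)
  d m m' := if h : m + 1 = m' then (diffTot q).v m m' h else 0
  shape m m' h := dif_neg h
  d_comp_d' m m' m'' h h' := by
    have := Cochain.congr_v hq.diffTot_comp_diffTot m m'' (by
      simp only [ComplexShape.up_Rel] at h h'; omega)
    rw [Cochain.comp_v _ _ _ m m' m'' h h', Cochain.zero_v] at this
    rw [dif_pos (show m + 1 = m' from h), dif_pos (show m' + 1 = m'' from h')]
    exact this

namespace MaurerCartan

variable {q} (hq : MaurerCartan q)

/-- Cochains depend only on the terms of a complex, and `hq.tot` has the same terms as `graded X r`.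
Thus the identities for `inc`, `proj` and `diffTot` apply verbatim to `hq.tot` once its differential
is identified. -/
lemma diff_tot : Cochain.diff hq.tot = diffTot q := by
  exact Cochain.ext _ _ fun p p' h => dif_pos h

lemma d_tot (m m' : ℤ) (h : m + 1 = m') : hq.tot.d m m' = (diffTot q).v m m' h := dif_pos h

/-- The inclusion of a summand into the total complex. -/
def ι (j : Fin N) : Cochain (X j) hq.tot (-r j) := inc X r j

/-- The projection of the total complex to a summand. -/
def π (j : Fin N) : Cochain hq.tot (X j) (r j) := proj X r j

/-- The sign of the internal differential in `diffTot` is chosen so that it cancels the contribution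
of the differential of `X j` to `δ`. -/
lemma δ_ι (j : Fin N) :
    δ (-r j) (1 - r j) (hq.ι j) = ∑ i, (q i j).comp (hq.ι i) (by omega) := by
  have h₁ : (hq.ι j).comp (Cochain.diff hq.tot) (show _ = 1 - r j by omega) =
      (∑ i, (q i j).comp (hq.ι i) (by omega)) +
      (r j).negOnePow • (Cochain.diff (X j)).comp (hq.ι j) (by omega) := by
    rw [diff_tot]
    exact inc_diffTot q j
  rw [δ_eq_comp_diff (by omega), h₁, show (1 - r j).negOnePow = -(r j).negOnePow by
    rw [Int.negOnePow_sub, Int.negOnePow_one, neg_one_mul], Units.neg_smul]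
  abel

lemma δ_π (i : Fin N) : δ (r i) (r i + 1) (hq.π i) =
    -((r i).negOnePow • ∑ j, (hq.π j).comp (q i j) (by omega)) := by
  have h₁ : (Cochain.diff hq.tot).comp (hq.π i) (show _ = r i + 1 by omega) =
      (∑ j, (hq.π j).comp (q i j) (by omega)) +
      (r i).negOnePow • (hq.π i).comp (Cochain.diff (X i)) (by omega) := by
    rw [diff_tot]
    exact diffTot_proj q i (add_comm 1 (r i))
  rw [δ_eq_comp_diff (by omega), h₁, Int.negOnePow_succ, Units.neg_smul, smul_add, smul_smul,
    Int.units_mul_self, one_smul]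
  abel

end MaurerCartan

/-! ### Injectivity and exactness of total complexes. -/

section Abelian

attribute [local instance] Abelian.hasFiniteBiproducts

variable {C : Type u} [Category.{v} C] [Abelian C] {N : ℕ} {X : Fin N → CochainComplex C ℤ}
  {r : Fin N → ℤ} {q : ∀ i j : Fin N, Cochain (X j) (X i) (1 + r i - r j)}

lemma MaurerCartan.isZero_tot (hq : MaurerCartan q) (m : ℤ)
    (h : ∀ j, IsZero ((X j).X (m + r j))) : IsZero (hq.tot.X m) := by
  rw [IsZero.iff_id_eq_zero]
  refine biproduct.hom_ext _ _ fun j => (h j).eq_of_tgt _ _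

lemma MaurerCartan.injective_tot (hq : MaurerCartan q) (m : ℤ)
    (h : ∀ j n, Injective ((X j).X n)) : Injective (hq.tot.X m) := by
  have := fun j => h j (m + r j)
  change Injective (⨁ fun j => (X j).X (m + r j))
  infer_instance

lemma MaurerCartan.tot_hom_ext (hq : MaurerCartan q) {A : C} {m : ℤ} {f g : A ⟶ hq.tot.X m}
    (h : ∀ j, f ≫ (hq.π j).v m (m + r j) rfl = g ≫ (hq.π j).v m (m + r j) rfl) : f = g := by
  refine biproduct.hom_ext _ _ fun j => ?_
  have := h j
  change f ≫ biproduct.π _ j ≫ _ = g ≫ biproduct.π _ j ≫ _ at this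
  simpa using this

lemma MaurerCartan.π_d (hq : MaurerCartan q) (i : Fin N) (m m' : ℤ) (h : m + 1 = m') :
    hq.tot.d m m' ≫ (hq.π i).v m' (m' + r i) rfl =
      (∑ j, (hq.π j).v m (m + r j) rfl ≫ (q i j).v (m + r j) (m' + r i) (by omega)) +
      (r i).negOnePow • (hq.π i).v m (m + r i) rfl ≫ (X i).d (m + r i) (m' + r i) := by
  have := Cochain.congr_v (diffTot_proj q i rfl) m (m' + r i) (by omega)
  rw [Cochain.comp_v _ _ _ m m' (m' + r i) h rfl, Cochain.add_v, Cochain.sum_v,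
    Cochain.units_smul_v, Cochain.comp_v _ _ _ m (m + r i) (m' + r i) rfl (by omega)] at this
  rw [hq.d_tot m m' h]
  refine this.trans ?_
  congr 1

lemma MaurerCartan.ι_π_v (hq : MaurerCartan q) (j : Fin N) (m : ℤ) :
    (hq.ι j).v (m + r j) m (by omega) ≫ (hq.π j).v m (m + r j) rfl = 𝟙 _ := by
  have := Cochain.congr_v (inc_proj X r j) (m + r j) (m + r j) (add_zero _)
  rwa [Cochain.comp_v _ _ _ (m + r j) m (m + r j) (by omega) rfl, Cochain.ofHom_v,
    HomologicalComplex.id_f] at this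

lemma MaurerCartan.ι_π_v_of_ne (hq : MaurerCartan q) (i j : Fin N) (h : j ≠ i) (m : ℤ) :
    (hq.ι j).v (m + r j) m (by omega) ≫ (hq.π i).v m (m + r i) rfl = 0 := by
  have := Cochain.congr_v (inc_proj_of_ne X r j i _ rfl h) (m + r j) (m + r i) (by omega)
  rwa [Cochain.comp_v _ _ _ (m + r j) m (m + r i) (by omega) rfl] at this

lemma MaurerCartan.ι_d_π (hq : MaurerCartan q) (i j : Fin N) (m m' : ℤ) (h : m + 1 = m') :
    (hq.ι j).v (m + r j) m (by omega) ≫ hq.tot.d m m' ≫ (hq.π i).v m' (m' + r i) rfl =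
      (q i j).v (m + r j) (m' + r i) (by omega) + (r i).negOnePow •
        ((hq.ι j).v (m + r j) m (by omega) ≫ (hq.π i).v m (m + r i) rfl) ≫
          (X i).d (m + r i) (m' + r i) := by
  rw [hq.π_d i m m' h, Preadditive.comp_add, Preadditive.comp_sum, Linear.comp_units_smul,
    Category.assoc]
  congr 1
  rw [Finset.sum_eq_single j]
  · rw [← Category.assoc, hq.ι_π_v, Category.id_comp]
  · intro l _ hl
    rw [← Category.assoc, hq.ι_π_v_of_ne _ _ hl.symm, zero_comp]
  · intro hl; exact absurd (Finset.mem_univ _) hl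

/-- The total complex is exact in the degrees in which all summands are exact. -/
lemma MaurerCartan.exactAt_tot (hq : MaurerCartan q) (hq₀ : ∀ i j, j ≤ i → q i j = 0) (m : ℤ)
    (h : ∀ j, (X j).ExactAt (m + r j)) : hq.tot.ExactAt m := by
  -- Induction on a bound `k` for the indices of the nonzero components of a cycle. As `q` strictly
  -- lowers the index, the component of largest index is itself a cycle; it is made a boundary and
  -- removed at the cost of changing only components of smaller index.
  have key : ∀ (k : ℕ) {A : C} (x : A ⟶ hq.tot.X m) (_ : x ≫ hq.tot.d m (m + 1) = 0)
      (_ : ∀ j : Fin N, k ≤ j → x ≫ (hq.π j).v m (m + r j) rfl = 0),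
      ∃ (A' : C) (p : A' ⟶ A) (_ : Epi p) (y : A' ⟶ hq.tot.X (m - 1)),
        p ≫ x = y ≫ hq.tot.d (m - 1) m := by
    intro k
    induction k with
    | zero =>
      intro A x _ hx
      refine ⟨A, 𝟙 A, inferInstance, 0, ?_⟩
      have : x = 0 := hq.tot_hom_ext fun j => by rw [hx j (Nat.zero_le _), zero_comp]
      rw [this, zero_comp, comp_zero]
    | succ k ih =>
      intro A x hd hx
      by_cases hk : k < N
      · let κ : Fin N := ⟨k, hk⟩
        have h₁ : (x ≫ (hq.π κ).v m (m + r κ) rfl) ≫ (X κ).d (m + r κ) (m + 1 + r κ) = 0 := by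
          have := congrArg (x ≫ ·) (hq.π_d κ m (m + 1) rfl)
          dsimp only at this
          rw [← Category.assoc, hd, zero_comp, Preadditive.comp_add, Preadditive.comp_sum,
            Finset.sum_eq_zero, zero_add, Linear.comp_units_smul] at this
          · rw [Category.assoc]
            exact (smul_eq_zero_iff_eq _).1 this.symm
          · intro j _
            by_cases hj : k + 1 ≤ j
            · rw [← Category.assoc, hx j hj, zero_comp]
            · rw [hq₀ κ j (by rw [Fin.le_def]; change (j : ℕ) ≤ k; omega), Cochain.zero_v,
                comp_zero, comp_zero]
        -- A preimage exists only after passing to an epimorphism onto `A`, the substitute for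
        -- choosing elements.
        obtain ⟨A', p, hp, y, hy⟩ := ((X κ).exactAt_iff_exact_up_to_refinements
          (m - 1 + r κ) (m + r κ) (m + 1 + r κ) (by simp; omega) (by simp; omega)).1 (h κ) _ h₁
        -- The sign compensates that of the internal differential of the summand `κ` in the total
        -- complex.
        let z : A' ⟶ hq.tot.X (m - 1) :=
          (r κ).negOnePow • y ≫ (hq.ι κ).v (m - 1 + r κ) (m - 1) (by omega)
        obtain ⟨A'', p', hp', y', hy'⟩ := ih (p ≫ x - z ≫ hq.tot.d (m - 1) m)
          (by rw [Preadditive.sub_comp, Category.assoc, hd, Category.assoc,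
            HomologicalComplex.d_comp_d, comp_zero, comp_zero, sub_zero]) (by
          intro j hj
          rw [Preadditive.sub_comp, Category.assoc, Category.assoc, Linear.units_smul_comp,
            Category.assoc, hq.ι_d_π j κ (m - 1) m (by omega), hq₀ j κ hj, Cochain.zero_v,
            zero_add]
          by_cases hjk : κ = j
          · subst hjk
            rw [hq.ι_π_v, Category.id_comp, Linear.comp_units_smul, smul_smul,
              Int.units_mul_self, one_smul, hy, sub_self]
          · rw [hq.ι_π_v_of_ne _ _ hjk, zero_comp, smul_zero, comp_zero, smul_zero, sub_zero, hx j,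
              comp_zero]
            have : (κ : ℕ) ≠ j := fun h => hjk (Fin.ext h)
            change k ≠ j at this
            omega)
        refine ⟨A'', p' ≫ p, epi_comp _ _, y' + p' ≫ z, ?_⟩
        rw [Preadditive.add_comp, ← hy', Preadditive.comp_sub, Category.assoc, Category.assoc,
          sub_add_cancel]
      · exact ih x hd fun j hj => absurd j.2 (by omega)
  rw [hq.tot.exactAt_iff_exact_up_to_refinements (m - 1) m (m + 1) (by simp) (by simp)]
  intro A x hx
  exact key N x hx fun j hj => absurd j.2 (by omega)

end Abelian

end TotalComplex

/-! ### Realization of twisted complexes of complexes of injective objects. -/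

section InjRealization

open TotalComplex

variable {K : Type w} [Field K] {C : Type u} [Category.{v} C] [Abelian C] [Linear K C]

attribute [local instance] Abelian.hasFiniteBiproducts

lemma maurerCartan_injDG (T : DGCat.Twisted (injDG K C)) :
    MaurerCartan (X := fun j => (T.obj j).cx) (r := T.r) T.q := T.maurerCartan

/-- The total complex of a twisted complex of bounded below complexes of injective objects. -/
def injTot (T : DGCat.Twisted (injDG K C)) : InjComplex C where
  cx := (maurerCartan_injDG T).tot
  injective i := (maurerCartan_injDG T).injective_tot i fun j n => (T.obj j).injective n
  boundedBelow := by
    choose a ha using fun j => (T.obj j).boundedBelow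
    -- Degree `i` of the total complex involves degree `i + T.r j` of the summand `j`, whence the
    -- shifted bounds; a uniform one exists as there are finitely many summands.
    obtain ⟨b, hb⟩ := (Set.finite_range fun j => a j - T.r j).bddBelow
    refine ⟨b, fun i hi => (maurerCartan_injDG T).isZero_tot i fun j => ha j _ ?_⟩
    have : b ≤ a j - T.r j := hb (Set.mem_range_self j)
    omega
  boundedCohomology := by
    choose a ha using fun j => (T.obj j).boundedCohomology
    obtain ⟨b, hb⟩ := (Set.finite_range fun j => a j - T.r j).bddAbove
    refine ⟨b, fun i hi => (maurerCartan_injDG T).exactAt_tot T.q_eq_zero i fun j => ha j _ ?_⟩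
    have : a j - T.r j ≤ b := hb (Set.mem_range_self j)
    omega

/-- Twisted complexes of bounded below complexes of injective objects are represented. -/
def injRealization (T : DGCat.Twisted (injDG K C)) : DGCat.Realization T where
  obj := injTot T
  ι := (maurerCartan_injDG T).ι
  π := (maurerCartan_injDG T).π
  ι_π j := inc_proj _ T.r j
  ι_π_of_ne i j n h hij := inc_proj_of_ne _ T.r i j n h hij
  total := sum_proj_inc _ T.r
  d_ι j := (maurerCartan_injDG T).δ_ι j
  d_π i := (maurerCartan_injDG T).δ_π i

end InjRealization

end

noncomputable section

/-! ### The translation of complexes as a pair of cochains -/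

namespace CochainComplex.HomComplex

section ShiftCochains

variable {D : Type u} [Category.{v} D] [Preadditive D]

/-- The identity, as a cochain `X⟦1⟧ ⟶ X` of degree `1`, up to the sign which is used in the
triangles of mapping cones. -/
def shiftσ (X : CochainComplex D ℤ) : Cochain (X⟦(1 : ℤ)⟧) X 1 :=
  -(Cochain.ofHom (𝟙 (X⟦(1 : ℤ)⟧))).rightUnshift 1 (zero_add 1)

/-- The inverse of `shiftσ`. -/
def shiftτ (X : CochainComplex D ℤ) : Cochain X (X⟦(1 : ℤ)⟧) (-1) :=
  -(Cochain.ofHom (𝟙 X)).rightShift 1 (-1) (neg_add_cancel 1)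

/-- Translates the DG-notion of shift into the existing calculus of `rightShift`; the comparison is
made after undoing the shift, which is injective. -/
lemma comp_shiftτ {X Y : CochainComplex D ℤ} {n m : ℤ} (γ : Cochain X Y n) (h : n + -1 = m) :
    γ.comp (shiftτ Y) h = -γ.rightShift 1 m (by omega) := by
  refine (Cochain.rightShiftAddEquiv X Y n 1 m (by omega)).symm.injective ?_
  change (γ.comp (shiftτ Y) h).rightUnshift n (by omega) =
    (-γ.rightShift 1 m (by omega)).rightUnshift n (by omega)
  rw [Cochain.rightUnshift_comp γ (shiftτ Y) h n (by omega) 0 (neg_add_cancel 1), shiftτ,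
    Cochain.rightUnshift_neg, Cochain.rightUnshift_neg, Cochain.rightUnshift_rightShift,
    Cochain.rightUnshift_rightShift, Cochain.comp_neg, Cochain.comp_id]

lemma shiftσ_comp_shiftτ (X : CochainComplex D ℤ) :
    (shiftσ X).comp (shiftτ X) (add_neg_cancel 1) = Cochain.ofHom (𝟙 _) := by
  rw [comp_shiftτ, shiftσ, Cochain.rightShift_neg, Cochain.rightShift_rightUnshift, neg_neg]

lemma shiftτ_comp_shiftσ (X : CochainComplex D ℤ) :
    (shiftτ X).comp (shiftσ X) (neg_add_cancel 1) = Cochain.ofHom (𝟙 _) := by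
  rw [shiftσ, Cochain.comp_neg, ← Cochain.rightUnshift_comp (shiftτ X) _ (add_zero (-1)) 0
    (neg_add_cancel 1) 1 (zero_add 1), Cochain.comp_id, shiftτ, Cochain.rightUnshift_neg,
    Cochain.rightUnshift_rightShift, neg_neg]

lemma δ_shiftσ (X : CochainComplex D ℤ) : δ 1 2 (shiftσ X) = 0 := by
  rw [shiftσ, δ_neg, Cochain.δ_rightUnshift _ 1 (zero_add 1) 2 1 (one_add_one_eq_two), δ_ofHom,
    Cochain.rightUnshift_zero, smul_zero, neg_zero]

lemma δ_shiftτ (X : CochainComplex D ℤ) : δ (-1) 0 (shiftτ X) = 0 := by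
  rw [shiftτ, δ_neg, Cochain.δ_rightShift _ 1 (-1) 0 (neg_add_cancel 1) 1 (zero_add 1), δ_ofHom,
    Cochain.rightShift_zero, smul_zero, neg_zero]

lemma rightUnshift_ofHom_shift {X Y : CochainComplex D ℤ} (f : X ⟶ Y) :
    (Cochain.ofHom (f⟦(1 : ℤ)⟧')).rightUnshift 1 (zero_add 1) =
      ((Cochain.ofHom (𝟙 (X⟦(1 : ℤ)⟧))).rightUnshift 1 (zero_add 1)).comp
        (Cochain.ofHom f) (add_zero 1) := by
  ext p q rfl
  simp [Cochain.rightUnshift_v _ _ _ _ _ _ _ (add_zero p)]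

/-- The signs of `shiftσ` and `shiftτ` cancel, so the DG-translation of a morphism is exactly the
shift of complexes. -/
lemma shiftσ_comp_comp_shiftτ {X Y : CochainComplex D ℤ} (f : X ⟶ Y) :
    ((shiftσ X).comp (Cochain.ofHom f) (add_zero 1)).comp (shiftτ Y) (add_neg_cancel 1) =
      Cochain.ofHom (f⟦(1 : ℤ)⟧') := by
  rw [comp_shiftτ, shiftσ, Cochain.neg_comp, Cochain.rightShift_neg, neg_neg,
    ← rightUnshift_ofHom_shift, Cochain.rightShift_rightUnshift]

end ShiftCochains

end CochainComplex.HomComplex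

/-! ### Uniqueness of cones -/

namespace DGCat

section ConeUnique

variable {k : Type w} [CommRing k] {A : DGCat.{w, v, u} k} {X Y Z Z' : Z0 A} {f : X ⟶ Y}

/-- The differential of `j` is not part of the data but follows from it: differentiate `total`, then
compose with `c.j` to cancel `c.i`. -/
lemma Cone.d_j (c : A.Cone f Z) : A.d 0 1 c.j = -A.comp c.p f.val (add_zero 1) := by
  have h := congrArg (A.d 0 1) c.total
  rw [map_add, A.d_id, d_comp_closed 1 c.j c.i c.d_i (zero_add 1),
    A.leibniz c.p c.s (add_neg_cancel 1) one_add_one_eq_two (neg_add_cancel 1) (zero_add 1), c.d_p,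
    A.zero_comp, smul_zero, add_zero, c.d_s,
    ← A.assoc c.p f.val c.i (add_zero 1) _ (add_zero 1), ← A.add_comp] at h
  have h' := congrArg (fun γ => A.comp γ c.j (add_zero 1)) h
  simp only [A.zero_comp] at h'
  rw [A.assoc _ c.i c.j _ (add_zero 0) _ (add_zero 1), c.i_j, A.comp_id] at h'
  exact eq_neg_of_add_eq_zero_left h'

/-- The comparison morphism of two cones of the same morphism. -/
def Cone.homOf (c : A.Cone f Z) (c' : A.Cone f Z') : Z ⟶ Z' where
  val := A.comp c.j c'.i (add_zero 0) + A.comp c.p c'.s (add_neg_cancel 1)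
  closed := by
    -- The two summands contribute the composite of `c.p`, `f` and `c'.i` with opposite signs.
    rw [map_add, d_comp_closed 1 c.j c'.i c'.d_i (zero_add 1), c.d_j,
      A.leibniz c.p c'.s (add_neg_cancel 1) one_add_one_eq_two (neg_add_cancel 1) (zero_add 1),
      c.d_p, A.zero_comp, smul_zero, add_zero, c'.d_s,
      ← A.assoc c.p f.val c'.i (add_zero 1) _ (add_zero 1), A.neg_comp, neg_add_cancel]

lemma Cone.i_homOf (c : A.Cone f Z) (c' : A.Cone f Z') :
    A.comp c.i (c.homOf c').val (add_zero 0) = c'.i := by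
  change A.comp c.i (A.comp c.j c'.i (add_zero 0) + A.comp c.p c'.s (add_neg_cancel 1)) _ = _
  rw [A.comp_add, ← A.assoc c.i c.j c'.i (add_zero 0) _ (add_zero 0), c.i_j, A.id_comp,
    ← A.assoc c.i c.p c'.s (zero_add 1) _ (add_neg_cancel 1), c.i_p, A.zero_comp, add_zero]

lemma Cone.s_homOf (c : A.Cone f Z) (c' : A.Cone f Z') :
    A.comp c.s (c.homOf c').val (add_zero (-1)) = c'.s := by
  change A.comp c.s (A.comp c.j c'.i (add_zero 0) + A.comp c.p c'.s (add_neg_cancel 1)) _ = _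
  rw [A.comp_add, ← A.assoc c.s c.j c'.i (add_zero (-1)) _ (add_zero (-1)), c.s_j, A.zero_comp,
    ← A.assoc c.s c.p c'.s (neg_add_cancel 1) _ (zero_add (-1)), c.s_p, A.id_comp, zero_add]

lemma Cone.homOf_p (c : A.Cone f Z) (c' : A.Cone f Z') :
    A.comp (c.homOf c').val c'.p (zero_add 1) = c.p := by
  change A.comp (A.comp c.j c'.i (add_zero 0) + A.comp c.p c'.s (add_neg_cancel 1)) c'.p _ = _
  rw [A.add_comp, A.assoc c.j c'.i c'.p _ (zero_add 1) _ (zero_add 1), c'.i_p, A.comp_zero,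
    A.assoc c.p c'.s c'.p _ (neg_add_cancel 1) _ (add_zero 1), c'.s_p, A.comp_id, zero_add]

lemma Cone.homOf_homOf (c : A.Cone f Z) (c' : A.Cone f Z') : c.homOf c' ≫ c'.homOf c = 𝟙 Z := by
  ext
  change A.comp (A.comp c.j c'.i (add_zero 0) + A.comp c.p c'.s (add_neg_cancel 1))
    (c'.homOf c).val (add_zero 0) = A.id Z.obj
  rw [A.add_comp, A.assoc c.j c'.i _ _ (add_zero 0) _ (add_zero 0), c'.i_homOf,
    A.assoc c.p c'.s _ _ (add_zero (-1)) _ (add_neg_cancel 1), c'.s_homOf, c.total]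

/-- Two cones of the same morphism are isomorphic. -/
def Cone.iso (c : A.Cone f Z) (c' : A.Cone f Z') : Z ≅ Z' where
  hom := c.homOf c'
  inv := c'.homOf c
  hom_inv_id := c.homOf_homOf c'
  inv_hom_id := c'.homOf_homOf c

/-- Together with `Cone.i_homOf` this makes the comparison of cones a comparison of triangles, so an
abstract cone may be replaced by the mapping cone. -/
lemma Translation.homOf_coneToTranslation (T : A.Translation) (c : A.Cone f Z) (c' : A.Cone f Z') :
    c.homOf c' ≫ T.coneToTranslation c' = T.coneToTranslation c := by
  ext
  change A.comp (c.homOf c').val (A.comp c'.p (T.τ X.obj) (add_neg_cancel 1)) _ =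
    A.comp c.p (T.τ X.obj) (add_neg_cancel 1)
  rw [← A.assoc _ c'.p (T.τ X.obj) (zero_add 1) _ (add_neg_cancel 1), c.homOf_p]

end ConeUnique

end DGCat

/-! ### Shifts and mapping cones of bounded below complexes of injective objects -/

section InjComplex

variable {D : Type u} [Category.{v} D] [Abelian D]

namespace InjComplex

lemma exists_isStrictlyGE (X : InjComplex D) : ∃ a : ℤ, X.cx.IsStrictlyGE a := by
  obtain ⟨a, ha⟩ := X.boundedBelow
  exact ⟨a, (X.cx.isStrictlyGE_iff a).2 ha⟩

lemma exists_isLE (X : InjComplex D) : ∃ b : ℤ, X.cx.IsLE b := by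
  obtain ⟨b, hb⟩ := X.boundedCohomology
  exact ⟨b, (X.cx.isLE_iff b).2 hb⟩

/-- K-injectivity is what identifies morphisms into `X` in the derived category with homotopy
classes; it comes from being bounded below with injective terms. -/
instance isKInjective (X : InjComplex D) : X.cx.IsKInjective := by
  obtain ⟨a, ha⟩ := X.exists_isStrictlyGE
  have := X.injective
  exact CochainComplex.isKInjective_of_injective X.cx a

/-- The translation. -/
def shift (X : InjComplex D) : InjComplex D where
  cx := X.cx⟦(1 : ℤ)⟧
  injective i := X.injective (i + 1)
  boundedBelow := by
    obtain ⟨a, ha⟩ := X.boundedBelow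
    exact ⟨a - 1, fun i hi => ha (i + 1) (by omega)⟩
  boundedCohomology := by
    obtain ⟨b, hb⟩ := X.exists_isLE
    exact ⟨b - 1, ((X.cx⟦(1 : ℤ)⟧).isLE_iff (b - 1)).1
      (CochainComplex.isLE_shift X.cx b 1 (b - 1) (by omega))⟩

-- In the derived category the cone is an extension of $X[1]$ by $Y$, and the subcategories $D^{\le
-- n}$ are closed under extensions. The choice of derived category is internal to the argument,
-- since the statement concerns complexes only.
attribute [local instance] HasDerivedCategory.standard in
lemma exists_isLE_mappingCone {X Y : CochainComplex D ℤ} (f : X ⟶ Y) (a b : ℤ) [X.IsLE a]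
    [Y.IsLE b] : ∃ c : ℤ, (CochainComplex.mappingCone f).IsLE c := by
  refine ⟨max a b, (DerivedCategory.isLE_Q_obj_iff _ _).1 ?_⟩
  have hT := Pretriangulated.rot_of_distTriang _
    (DerivedCategory.mappingCone_triangle_distinguished f)
  have h₁ := DerivedCategory.TStructure.t.isLE_of_le (DerivedCategory.Q.obj Y) b _
    (le_max_right a b)
  have h₂ := DerivedCategory.TStructure.t.isLE_shift (DerivedCategory.Q.obj X) a 1 (a - 1)
  have h₃ := DerivedCategory.TStructure.t.isLE_of_le ((DerivedCategory.Q.obj X)⟦(1 : ℤ)⟧) (a - 1)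
    (max a b) (by have := le_max_left a b; omega)
  exact DerivedCategory.TStructure.t.isLE₂ _ hT (max a b) h₁ h₃

/-- The mapping cone. -/
def mappingCone {X Y : InjComplex D} (f : X.cx ⟶ Y.cx) : InjComplex D where
  cx := CochainComplex.mappingCone f
  injective i := by
    have := X.injective (i + 1)
    have := Y.injective i
    exact Injective.of_iso (HomologicalComplex.homotopyCofiber.XIsoBiprod f i (i + 1) rfl).symm
      inferInstance
  boundedBelow := by
    obtain ⟨a, ha⟩ := X.boundedBelow
    obtain ⟨b, hb⟩ := Y.boundedBelow
    -- The cone in degree `i` is built from degree `i + 1` of the source and degree `i` of the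
    -- target.
    refine ⟨min (a - 1) b, fun i hi => (CochainComplex.mappingCone.isZero_X_iff f i).2
      ⟨ha _ ?_, hb _ ?_⟩⟩ <;> omega
  boundedCohomology := by
    obtain ⟨a, ha⟩ := X.exists_isLE
    obtain ⟨b, hb⟩ := Y.exists_isLE
    obtain ⟨c, hc⟩ := exists_isLE_mappingCone f a b
    exact ⟨c, (CochainComplex.isLE_iff _ c).1 hc⟩

end InjComplex

end InjComplex

/-! ### Translation and cones in the DG-category of complexes of injective objects. -/

section InjDG

open CochainComplex CochainComplex.HomComplex

variable (k : Type w) [Field k] (D : Type u) [Category.{v} D] [Abelian D] [Linear k D]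

/-- The translation of the DG-category of complexes of injective objects. -/
def injTranslation : (injDG k D).Translation where
  obj := InjComplex.shift
  σ X := shiftσ X.cx
  τ X := shiftτ X.cx
  d_σ X := δ_shiftσ X.cx
  d_τ X := δ_shiftτ X.cx
  σ_τ X := shiftσ_comp_shiftτ X.cx
  τ_σ X := shiftτ_comp_shiftσ X.cx

variable {k D}

/-- The morphism of complexes given by a closed morphism of degree zero. -/
def injHom {X Y : DGCat.Z0 (injDG k D)} (f : X ⟶ Y) : X.obj.cx ⟶ Y.obj.cx :=
  Cocycle.homOf (Cocycle.mk f.val 1 (zero_add 1) f.closed)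

lemma ofHom_injHom {X Y : DGCat.Z0 (injDG k D)} (f : X ⟶ Y) : Cochain.ofHom (injHom f) = f.val :=
  Cocycle.cochain_ofHom_homOf_eq_coe _

lemma injHom_eq {X Y : DGCat.Z0 (injDG k D)} (f : X ⟶ Y) (g : X.obj.cx ⟶ Y.obj.cx)
    (h : f.val = Cochain.ofHom g) : injHom f = g :=
  Cochain.ofHom_injective ((ofHom_injHom f).trans h)

/-- A morphism of complexes as a closed morphism of degree zero. -/
def injOfHom {X Y : DGCat.Z0 (injDG k D)} (f : X.obj.cx ⟶ Y.obj.cx) : X ⟶ Y :=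
  ⟨Cochain.ofHom f, δ_ofHom _⟩

lemma injHom_injOfHom {X Y : DGCat.Z0 (injDG k D)} (f : X.obj.cx ⟶ Y.obj.cx) :
    injHom (injOfHom f : X ⟶ Y) = f := injHom_eq _ _ rfl

variable (k D) in
/-- The functor to the category of complexes. -/
def injToComplex : DGCat.Z0 (injDG k D) ⥤ CochainComplex D ℤ where
  obj X := X.obj.cx
  map f := injHom f
  map_id X := injHom_eq _ _ rfl
  map_comp f g := injHom_eq _ _ (by
    rw [Cochain.ofHom_comp, ofHom_injHom, ofHom_injHom]; rfl)

/-- An isomorphism of complexes as a closed isomorphism of degree zero. -/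
def injIso {X Y : DGCat.Z0 (injDG k D)} (e : X.obj.cx ≅ Y.obj.cx) : X ≅ Y where
  hom := injOfHom e.hom
  inv := injOfHom e.inv
  hom_inv_id := DGCat.Z0.Hom.ext ((Cochain.ofHom_comp _ _).symm.trans
    (congrArg Cochain.ofHom e.hom_inv_id))
  inv_hom_id := DGCat.Z0.Hom.ext ((Cochain.ofHom_comp _ _).symm.trans
    (congrArg Cochain.ofHom e.inv_hom_id))

/-- The mapping cone is a cone in the DG-category. -/
def injCone {X Y : DGCat.Z0 (injDG k D)} (f : X ⟶ Y) :
    (injDG k D).Cone f ⟨InjComplex.mappingCone (injHom f)⟩ where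
  i := Cochain.ofHom (mappingCone.inr (injHom f))
  j := mappingCone.snd (injHom f)
  s := mappingCone.inl (injHom f)
  p := (mappingCone.fst (injHom f)).1
  i_j := mappingCone.inr_snd _
  i_p := mappingCone.inr_fst _
  s_j := mappingCone.inl_snd _
  s_p := mappingCone.inl_fst _
  total := (add_comm _ _).trans (mappingCone.id _)
  d_i := δ_ofHom _
  d_p := (mappingCone.fst (injHom f)).δ_eq_zero 2
  d_s := (mappingCone.δ_inl _).trans ((Cochain.ofHom_comp _ _).trans
    (congrArg (fun γ => Cochain.comp γ (Cochain.ofHom (mappingCone.inr (injHom f))) (add_zero 0))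
      (ofHom_injHom f)))

lemma exists_injCone {X Y : DGCat.Z0 (injDG k D)} (f : X ⟶ Y) :
    ∃ Z, Nonempty ((injDG k D).Cone f Z) := ⟨_, ⟨injCone f⟩⟩

lemma injHom_translation {X Y : DGCat.Z0 (injDG k D)} (f : X ⟶ Y) :
    injHom ((injTranslation k D).functorZ0.map f) = (injHom f)⟦(1 : ℤ)⟧' :=
  injHom_eq _ _ ((congrArg (fun γ : Cochain X.obj.cx Y.obj.cx 0 =>
      ((shiftσ X.obj.cx).comp γ (add_zero 1)).comp (shiftτ Y.obj.cx) (add_neg_cancel 1))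
    (ofHom_injHom f).symm).trans (shiftσ_comp_comp_shiftτ (injHom f)))

/-- The connecting morphism of the mapping cone triangle is the shift of `-fst`; the minus sign in
`shiftτ` is there to make this an equality and not an equality up to sign. -/
lemma injHom_coneToTranslation {X Y : DGCat.Z0 (injDG k D)} (f : X ⟶ Y) :
    injHom ((injTranslation k D).coneToTranslation (injCone f)) =
      (mappingCone.triangle (injHom f)).mor₃ :=
  injHom_eq _ _ ((comp_shiftτ (mappingCone.fst (injHom f)).1 (add_neg_cancel 1)).trans
    ((Cochain.rightShift_neg _ _ _ _).symm.trans
      (Cocycle.cochain_ofHom_homOf_eq_coe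
        ((-mappingCone.fst (injHom f)).rightShift 1 0 (zero_add 1))).symm))

end InjDG

end

noncomputable section

/-! ### From complexes of injective objects to the bounded derived category -/

section InjToDerived

open CochainComplex CochainComplex.HomComplex DGCat

variable (k : Type w) [Field k] (D : Type u) [Category.{v} D] [Abelian D] [Linear k D]
  [HasDerivedCategory.{v'} D]

/-- The functor from the homotopy category of complexes of injective objects to the derived
category. -/
def injToDerived : H0 (injDG k D) ⥤ DerivedCategory D :=
  CategoryTheory.Quotient.lift (homotopic (injDG k D)) (injToComplex k D ⋙ DerivedCategory.Q) (by
    rintro X Y f g ⟨s, hs⟩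
    refine DerivedCategory.Q_map_eq_of_homotopy D ((Cochain.equivHomotopy _ _).symm ⟨s, ?_⟩)
    have h : δ (-1) 0 s = f.val - g.val := hs
    change Cochain.ofHom (injHom f) = δ (-1) 0 s + Cochain.ofHom (injHom g)
    rw [h, ofHom_injHom, ofHom_injHom]
    exact (sub_add_cancel _ _).symm)

variable {k D}

lemma injToDerived_map {X Y : Z0 (injDG k D)} (f : X ⟶ Y) :
    (injToDerived k D).map ((H0.quotient _).map f) = DerivedCategory.Q.map (injHom f) := rfl

/-- Localization factors through the homotopy category, where morphisms into a K-injective target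
already are the derived ones; homotopy classes then lift to morphisms of complexes. -/
lemma exists_Q_map_eq (X Y : CochainComplex D ℤ) [Y.IsKInjective]
    (g : DerivedCategory.Q.obj X ⟶ DerivedCategory.Q.obj Y) :
    ∃ f : X ⟶ Y, DerivedCategory.Q.map f = g := by
  obtain ⟨f', hf'⟩ := (IsKInjective.Qh_map_bijective ((HomotopyCategory.quotient _ _).obj X) Y).2
    ((DerivedCategory.quotientCompQhIso D).hom.app X ≫ g ≫
      (DerivedCategory.quotientCompQhIso D).inv.app Y)
  obtain ⟨f, rfl⟩ := (HomotopyCategory.quotient _ _).map_surjective f'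
  refine ⟨f, ?_⟩
  rw [← cancel_epi ((DerivedCategory.quotientCompQhIso D).hom.app X),
    ← DerivedCategory.quotientCompQhIso_hom_naturality, hf']
  simp

lemma homotopy_of_Q_map_eq {X Y : CochainComplex D ℤ} [Y.IsKInjective] {f g : X ⟶ Y}
    (h : DerivedCategory.Q.map f = DerivedCategory.Q.map g) : Nonempty (Homotopy f g) := by
  refine ⟨HomotopyCategory.homotopyOfEq _ _
    ((IsKInjective.Qh_map_bijective ((HomotopyCategory.quotient _ _).obj X) Y).1 ?_)⟩
  rw [← cancel_mono ((DerivedCategory.quotientCompQhIso D).hom.app Y),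
    DerivedCategory.quotientCompQhIso_hom_naturality,
    DerivedCategory.quotientCompQhIso_hom_naturality, h]

instance : (injToDerived k D).Full where
  map_surjective {X Y} g := by
    obtain ⟨X, rfl⟩ := H0.exists_obj_eq X
    obtain ⟨Y, rfl⟩ := H0.exists_obj_eq Y
    have := InjComplex.isKInjective Y.obj
    obtain ⟨f, hf⟩ := exists_Q_map_eq X.obj.cx Y.obj.cx g
    exact ⟨(H0.quotient _).map (injOfHom f), (injToDerived_map _).trans
      ((congrArg DerivedCategory.Q.map (injHom_injOfHom f)).trans hf)⟩

instance : (injToDerived k D).Faithful where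
  map_injective {X Y} f g h := by
    obtain ⟨X, rfl⟩ := H0.exists_obj_eq X
    obtain ⟨Y, rfl⟩ := H0.exists_obj_eq Y
    obtain ⟨f, rfl⟩ := H0.exists_map_eq f
    obtain ⟨g, rfl⟩ := H0.exists_map_eq g
    have := InjComplex.isKInjective Y.obj
    obtain ⟨s⟩ := homotopy_of_Q_map_eq (Y := Y.obj.cx) (f := injHom f) (g := injHom g) h
    obtain ⟨s, hs⟩ := Cochain.equivHomotopy _ _ s
    refine (H0.quotient_map_eq_iff _ _ _).2 ⟨s, ?_⟩
    rw [ofHom_injHom, ofHom_injHom] at hs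
    exact eq_sub_of_add_eq hs.symm

instance : (injToDerived k D).Linear k where
  map_smul {X Y} f c := by
    obtain ⟨X, rfl⟩ := H0.exists_obj_eq X
    obtain ⟨Y, rfl⟩ := H0.exists_obj_eq Y
    obtain ⟨f, rfl⟩ := H0.exists_map_eq f
    have h : injHom (c • f) = c • injHom f := by
      have h' : Cochain.ofHom (c • injHom f) = c • Cochain.ofHom (injHom f) := by
        ext p
        simp
      refine injHom_eq _ _ (Eq.trans ?_ h'.symm)
      rw [ofHom_injHom]
      rfl
    rw [← Functor.map_smul]
    exact (congrArg DerivedCategory.Q.map h).trans (DerivedCategory.Q.map_smul _ _)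

lemma bounded_injToDerived (X : H0 (injDG k D)) :
    DerivedCategory.TStructure.t.bounded ((injToDerived k D).obj X) := by
  obtain ⟨X, rfl⟩ := H0.exists_obj_eq X
  obtain ⟨a, ha⟩ := X.obj.exists_isStrictlyGE
  obtain ⟨b, hb⟩ := X.obj.exists_isLE
  exact ⟨⟨a, inferInstanceAs ((DerivedCategory.Q.obj X.obj.cx).IsGE a)⟩,
    ⟨b, inferInstanceAs ((DerivedCategory.Q.obj X.obj.cx).IsLE b)⟩⟩

/-- The translation corresponds to the shift of the derived category. -/
def injToDerivedShift : (injTranslation k D).functor ⋙ injToDerived k D ≅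
    injToDerived k D ⋙ shiftFunctor (DerivedCategory D) (1 : ℤ) :=
  NatIso.ofComponents (fun X => (DerivedCategory.Q.commShiftIso (1 : ℤ)).app X.as.obj.cx) (by
    intro X Y f
    obtain ⟨f, rfl⟩ := H0.exists_map_eq (X := X.as) (Y := Y.as) f
    exact (congrArg (fun g => DerivedCategory.Q.map g ≫
        (DerivedCategory.Q.commShiftIso (1 : ℤ)).hom.app Y.as.obj.cx) (injHom_translation f)).trans
      ((DerivedCategory.Q.commShiftIso (1 : ℤ)).hom.naturality (injHom f)))

lemma comp_comp_cancel {E : Type*} [Category* E] {X Y Z W : E} (x : X ⟶ Y) (y : Y ⟶ Z) (z : Z ⟶ W)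
    (w : W ⟶ Z) (h : z ≫ w = 𝟙 Z) : (x ≫ y ≫ z) ≫ w = x ≫ y := by
  rw [Category.assoc, Category.assoc, h, Category.comp_id]

/-- By uniqueness of cones the given cone can be traded for the mapping cone, whose triangle is
distinguished in the derived category. -/
lemma injToDerived_distinguished {X Y Z : H0 (injDG k D)} {f : X ⟶ Y} {g : Y ⟶ Z}
    {h : Z ⟶ (injTranslation k D).functor.obj X} (H : (injTranslation k D).Distinguished f g h) :
    Pretriangulated.Triangle.mk ((injToDerived k D).map f) ((injToDerived k D).map g)
      ((injToDerived k D).map h ≫ injToDerivedShift.hom.app X) ∈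
        Pretriangulated.distinguishedTriangles := by
  obtain ⟨X', Y', Z', φ, c, a, b, e, h₁, h₂, h₃⟩ := H
  let ξ := (H0.quotient _).map (c.homOf (injCone φ))
  have h₂' : g ≫ e.hom ≫ ξ = b.hom ≫ (H0.quotient _).map ⟨(injCone φ).i, (injCone φ).d_i⟩ := by
    rw [← Category.assoc, h₂, Category.assoc, ← Functor.map_comp]
    exact congrArg (fun t => b.hom ≫ (H0.quotient _).map t) (Z0.Hom.ext (c.i_homOf (injCone φ)))
  have h₃' : h ≫ (injTranslation k D).functor.map a.hom = (e.hom ≫ ξ) ≫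
      (H0.quotient _).map ((injTranslation k D).coneToTranslation (injCone φ)) := by
    rw [h₃, Category.assoc, ← Functor.map_comp, Translation.homOf_coneToTranslation]
  refine Pretriangulated.isomorphic_distinguished _
    (DerivedCategory.mappingCone_triangle_distinguished (injHom φ)) _
    (Pretriangulated.Triangle.isoMk _ _ ((injToDerived k D).mapIso a) ((injToDerived k D).mapIso b)
      ((injToDerived k D).mapIso (e ≪≫ (H0.quotient _).mapIso (c.iso (injCone φ)))) ?_ ?_ ?_)
  · exact ((injToDerived k D).map_comp _ _).symm.trans
      ((congrArg (injToDerived k D).map h₁).trans ((injToDerived k D).map_comp _ _))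
  · refine ((injToDerived k D).map_comp _ _).symm.trans
      ((congrArg (injToDerived k D).map h₂').trans (((injToDerived k D).map_comp _ _).trans ?_))
    exact congrArg (fun t => (injToDerived k D).map b.hom ≫ DerivedCategory.Q.map t)
      (injHom_eq _ _ rfl)
  · change ((injToDerived k D).map h ≫ injToDerivedShift.hom.app X) ≫
      ((injToDerived k D).map a.hom)⟦(1 : ℤ)⟧' = (injToDerived k D).map (e.hom ≫ ξ) ≫
        DerivedCategory.Q.map (mappingCone.triangle (injHom φ)).mor₃ ≫
          (DerivedCategory.Q.commShiftIso (1 : ℤ)).hom.app X'.obj.cx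
    rw [← injHom_coneToTranslation]
    calc _ = (injToDerived k D).map h ≫ injToDerivedShift.hom.app X ≫
          ((injToDerived k D).map a.hom)⟦(1 : ℤ)⟧' := Category.assoc _ _ _
      _ = (injToDerived k D).map h ≫ (injToDerived k D).map ((injTranslation k D).functor.map a.hom)
          ≫ injToDerivedShift.hom.app ((H0.quotient _).obj X') :=
        congrArg ((injToDerived k D).map h ≫ ·) (injToDerivedShift.hom.naturality a.hom).symm
      _ = (injToDerived k D).map (h ≫ (injTranslation k D).functor.map a.hom)
          ≫ injToDerivedShift.hom.app ((H0.quotient _).obj X') := by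
        rw [Functor.map_comp, Category.assoc]
      _ = _ := by
        rw [h₃']
        exact (congrArg (· ≫ injToDerivedShift.hom.app ((H0.quotient _).obj X'))
          ((injToDerived k D).map_comp _ _)).trans (Category.assoc _ _ _)

variable (k D) in
/-- The functor from the homotopy category of complexes of injective objects with bounded cohomology
to the bounded derived category. -/
def injToBounded : H0 (injDG k D) ⥤ DerivedCategory.Bounded D :=
  DerivedCategory.TStructure.t.bounded.lift (injToDerived k D) bounded_injToDerived

instance : (injToBounded k D).Full := inferInstanceAs (ObjectProperty.lift _ _ _).Full

instance : (injToBounded k D).Faithful := inferInstanceAs (ObjectProperty.lift _ _ _).Faithful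

instance : (injToBounded k D).Linear k where
  map_smul := by
    intros
    ext
    exact (injToDerived k D).map_smul _ _

/-- An object of $D^{\ge a}$ is represented by a complex vanishing below `a`, which has an injective
resolution vanishing below `a`; the upper bound on cohomology is invariant under isomorphism in the
derived category. -/
instance [EnoughInjectives D] : (injToBounded k D).EssSurj where
  mem_essImage Y := by
    obtain ⟨⟨a, ha⟩, ⟨b, hb⟩⟩ := Y.property
    obtain ⟨M, hM, ⟨e⟩⟩ := DerivedCategory.exists_iso_Q_obj_of_isGE Y.obj a
    obtain ⟨N, i, hi, hN, hN'⟩ :=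
      CochainComplex.Plus.modelCategoryQuillen.exists_quasiIso_injective M a
    let e' : Y.obj ≅ DerivedCategory.Q.obj N := e ≪≫ asIso (DerivedCategory.Q.map i)
    have hb' : N.IsLE b := (DerivedCategory.isLE_Q_obj_iff N b).1
      (DerivedCategory.TStructure.t.isLE_of_iso e' b)
    let X : InjComplex D := ⟨N, hN, ⟨a, fun i hi => (N.isStrictlyGE_iff a).1 hN' i hi⟩,
      ⟨b, fun i hi => (N.isLE_iff b).1 hb' i hi⟩⟩
    exact ⟨(H0.quotient (injDG k D)).obj ⟨X⟩,
      ⟨DerivedCategory.TStructure.t.bounded.fullyFaithfulι.preimageIso e'.symm⟩⟩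

/-- The translation corresponds to the shift of the bounded derived category. -/
def injToBoundedShift : (injTranslation k D).functor ⋙ injToBounded k D ≅
    injToBounded k D ⋙ shiftFunctor (DerivedCategory.Bounded D) (1 : ℤ) :=
  NatIso.ofComponents (fun X => DerivedCategory.TStructure.t.bounded.fullyFaithfulι.preimageIso
    (injToDerivedShift.app X ≪≫
      (DerivedCategory.Bounded.ι.commShiftIso (1 : ℤ)).symm.app ((injToBounded k D).obj X))) (by
    intro X Y f
    apply DerivedCategory.Bounded.ι.map_injective
    have h₁ := injToDerivedShift.hom.naturality f
    have h₂ := (DerivedCategory.Bounded.ι.commShiftIso (1 : ℤ)).inv.naturality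
      ((injToBounded k D).map f)
    simp only [Functor.map_comp, Functor.FullyFaithful.preimageIso_hom]
    refine (Category.assoc _ _ _).symm.trans
      ((congrArg (· ≫ (DerivedCategory.Bounded.ι.commShiftIso (1 : ℤ)).inv.app
        ((injToBounded k D).obj Y)) h₁).trans ((Category.assoc _ _ _).trans
      ((congrArg (injToDerivedShift.hom.app X ≫ ·) h₂).trans (Category.assoc _ _ _).symm))))

lemma ι_map_injToBoundedShift (X : H0 (injDG k D)) :
    DerivedCategory.Bounded.ι.map (injToBoundedShift.hom.app X) = injToDerivedShift.hom.app X ≫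
      (DerivedCategory.Bounded.ι.commShiftIso (1 : ℤ)).inv.app ((injToBounded k D).obj X) :=
  DerivedCategory.TStructure.t.bounded.fullyFaithfulι.map_preimage _

lemma injToBounded_distinguished {X Y Z : H0 (injDG k D)} {f : X ⟶ Y} {g : Y ⟶ Z}
    {h : Z ⟶ (injTranslation k D).functor.obj X} (H : (injTranslation k D).Distinguished f g h) :
    Pretriangulated.Triangle.mk ((injToBounded k D).map f) ((injToBounded k D).map g)
      ((injToBounded k D).map h ≫ injToBoundedShift.hom.app X) ∈
        Pretriangulated.distinguishedTriangles := by
  -- A triangle in the bounded category is distinguished precisely when its image in the derived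
  -- category is; only the identifications of the shifts have to be matched.
  change DerivedCategory.Bounded.ι.mapTriangle.obj _ ∈ Pretriangulated.distinguishedTriangles
  refine Pretriangulated.isomorphic_distinguished _ (injToDerived_distinguished H) _
    (Pretriangulated.Triangle.isoMk _ _ (Iso.refl _) (Iso.refl _) (Iso.refl _) ?_ ?_ ?_)
  · exact (Category.comp_id _).trans (Category.id_comp _).symm
  · exact (Category.comp_id _).trans (Category.id_comp _).symm
  · have h₁ : DerivedCategory.Bounded.ι.map ((injToBounded k D).map h ≫
          injToBoundedShift.hom.app X) ≫
        (DerivedCategory.Bounded.ι.commShiftIso (1 : ℤ)).hom.app ((injToBounded k D).obj X) =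
        (injToDerived k D).map h ≫ injToDerivedShift.hom.app X := by
      rw [Functor.map_comp, ι_map_injToBoundedShift]
      exact comp_comp_cancel _ _ _ _ (Iso.inv_hom_id_app _ _)
    refine Eq.trans ?_ (h₁.trans (Category.id_comp _).symm)
    refine (congrArg (_ ≫ ·) ((CategoryTheory.shiftFunctor (DerivedCategory D) (1 : ℤ)).map_id _)).trans
      (Category.comp_id _)

end InjToDerived

end

noncomputable section

/-! ### The trace dual basis of a finite separable extension -/

section TraceDual

variable {K : Type w} {L : Type w'} [Field K] [Field L] [Algebra K L] [FiniteDimensional K L]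
  [Algebra.IsSeparable K L] {n : ℕ} (b : Module.Basis (Fin n) K L)

lemma repr_eq_trace_traceDual_mul (x : L) (i : Fin n) :
    b.repr x i = Algebra.trace K L (b.traceDual i * x) := by
  conv_rhs => rw [← b.sum_repr x, Finset.mul_sum, map_sum]
  rw [Finset.sum_eq_single i]
  · rw [mul_smul_comm, map_smul, b.trace_traceDual_mul, if_pos rfl, smul_eq_mul, mul_one]
  · intro j _ hj
    rw [mul_smul_comm, map_smul, b.trace_traceDual_mul, if_neg hj, smul_zero]
  · exact fun h => absurd (Finset.mem_univ i) h

/-- The trace dual basis transforms by the transposed matrices. -/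
lemma traceDual_mul (a : L) (i : Fin n) :
    b.traceDual i * a = ∑ j, b.repr (a * b j) i • b.traceDual j := by
  conv_lhs => rw [← b.traceDual.sum_repr (b.traceDual i * a)]
  refine Finset.sum_congr rfl fun j _ => ?_
  rw [b.traceDual_repr_apply, repr_eq_trace_traceDual_mul, Algebra.traceForm_apply, mul_assoc]

/-- Tested against the trace form, which is nondegenerate by separability: the trace of `x` is the
sum of the diagonal coefficients of multiplication by `x`, and each coefficient is a trace against a
dual basis vector. With `traceDual_mul` this makes $\sum b_j\otimes b_j^*$ a separability
idempotent. -/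
lemma sum_mul_traceDual : ∑ j, b j * b.traceDual j = 1 := by
  rw [← sub_eq_zero]
  refine (traceForm_nondegenerate K L).1 _ fun x => ?_
  rw [Algebra.traceForm_apply, sub_mul, map_sub, one_mul, Finset.sum_mul, map_sum,
    Algebra.trace_eq_matrix_trace b x, sub_eq_zero]
  refine Finset.sum_congr rfl fun j _ => ?_
  rw [Matrix.diag_apply, Algebra.leftMulMatrix_eq_repr_mul, repr_eq_trace_traceDual_mul]
  congr 1
  ring

end TraceDual

/-! ### Injective module objects -/

attribute [local instance] Abelian.hasFiniteBiproducts

namespace ScalarModule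

section Injective

variable {K : Type w} {L : Type w'} [Field K] [Field L] [Algebra K L]
  {C : Type u} [Category.{v} C] [Abelian C] [Linear K C] {n : ℕ} (b : Module.Basis (Fin n) K L)

lemma act_sum {ι : Type*} (s : Finset ι) (X : ScalarModule K L C) (f : ι → L) :
    X.ρ (∑ i ∈ s, f i) = ∑ i ∈ s, X.ρ (f i) := map_sum X.act f s

lemma act_smul (X : ScalarModule K L C) (c : K) (a : L) : X.ρ (c • a) = c • X.ρ a :=
  map_smul X.act c a

lemma act_mul_basis (X : ScalarModule K L C) (a : L) (j : Fin n) :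
    X.ρ (a * b j) = ∑ i, b.repr (a * b j) i • X.ρ (b i) := by
  conv_lhs => rw [← b.sum_repr (a * b j), act_sum]
  simp only [act_smul]

/-- The action of `L` on a direct sum of copies of `X` indexed by a basis of `L`. -/
def tensorAct (X : C) (l : L) : (⨁ fun _ : Fin n => X) ⟶ ⨁ fun _ : Fin n => X :=
  biproduct.desc fun j => ∑ i, b.repr (l * b j) i • biproduct.ι (fun _ : Fin n => X) i

lemma ι_tensorAct (X : C) (l : L) (j : Fin n) :
    biproduct.ι (fun _ : Fin n => X) j ≫ tensorAct b X l =
      ∑ i, b.repr (l * b j) i • biproduct.ι (fun _ : Fin n => X) i := by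
  simp [tensorAct]

lemma ι_tensorAct_assoc (X : C) (l : L) (j : Fin n) {Z : C} (h : (⨁ fun _ : Fin n => X) ⟶ Z) :
    biproduct.ι (fun _ : Fin n => X) j ≫ tensorAct b X l ≫ h =
      (∑ i, b.repr (l * b j) i • biproduct.ι (fun _ : Fin n => X) i) ≫ h := by
  rw [← Category.assoc, ι_tensorAct]

/-- The module object `L ⊗ X`. -/
def tensorObj (X : C) : ScalarModule K L C :=
  ofEnd (⨁ fun _ : Fin n => X) (tensorAct b X)
    (fun x y => by
      refine biproduct.hom_ext' _ _ fun j => ?_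
      rw [ι_tensorAct_assoc, ι_tensorAct, Preadditive.sum_comp]
      simp only [Linear.smul_comp, ι_tensorAct, Finset.smul_sum, smul_smul]
      rw [Finset.sum_comm]
      simp only [← Finset.sum_smul]
      refine Finset.sum_congr rfl fun i _ => ?_
      congr 1
      conv_lhs => rw [mul_assoc, ← b.sum_repr (y * b j), Finset.mul_sum, map_sum]
      simp)
    (fun x y => by
      refine biproduct.hom_ext' _ _ fun j => ?_
      simp [ι_tensorAct, add_mul, add_smul, Finset.sum_add_distrib])
    (fun r => by
      refine biproduct.hom_ext' _ _ fun j => ?_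
      simp [ι_tensorAct, ← Algebra.smul_def, Finsupp.single_apply])

/-- The functoriality of `L ⊗ X`. -/
def tensorMap {X Y : C} (f : X ⟶ Y) : tensorObj (K := K) b X ⟶ tensorObj b Y where
  hom := biproduct.map (f := fun _ : Fin n => X) (g := fun _ => Y) fun _ => f
  comm l := by
    change tensorAct b X l ≫ biproduct.map (f := fun _ : Fin n => X) (g := fun _ => Y) (fun _ => f) =
      biproduct.map (f := fun _ : Fin n => X) (g := fun _ => Y) (fun _ => f) ≫ tensorAct b Y l
    refine biproduct.hom_ext' _ _ fun j => ?_
    simp [ι_tensorAct, ι_tensorAct_assoc, Preadditive.sum_comp, Preadditive.comp_sum]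

/-- The morphism `L ⊗ X ⟶ M` of module objects given by a morphism `X ⟶ M`. -/
def tensorDesc {X : C} {M : ScalarModule K L C} (f : X ⟶ M.obj) : tensorObj b X ⟶ M where
  hom := biproduct.desc (f := fun _ : Fin n => X) fun j => f ≫ M.ρ (b j)
  comm l := by
    change tensorAct b X l ≫ biproduct.desc (f := fun _ : Fin n => X) (fun j => f ≫ M.ρ (b j)) =
      biproduct.desc (f := fun _ : Fin n => X) (fun j => f ≫ M.ρ (b j)) ≫ M.ρ l
    refine biproduct.hom_ext' _ _ fun j => ?_
    rw [biproduct.ι_desc_assoc, Category.assoc, ← act_mul_comp, act_mul_basis]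
    simp [ι_tensorAct_assoc, Preadditive.sum_comp, Preadditive.comp_sum]

/-- The morphism `X ⟶ L ⊗ X` given by the unit of `L`. -/
def tensorUnit (X : C) : X ⟶ (tensorObj (K := K) b X).obj :=
  ∑ i, b.repr 1 i • biproduct.ι (fun _ : Fin n => X) i

lemma tensorUnit_tensorMap {X Y : C} (f : X ⟶ Y) :
    tensorUnit (K := K) b X ≫ (tensorMap (K := K) b f).hom = f ≫ tensorUnit (K := K) b Y := by
  change (∑ i, b.repr 1 i • biproduct.ι (fun _ : Fin n => X) i) ≫ biproduct.map (fun _ => f) =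
    f ≫ ∑ i, b.repr 1 i • biproduct.ι (fun _ : Fin n => Y) i
  simp [Preadditive.sum_comp, Preadditive.comp_sum]

lemma tensorUnit_tensorDesc {X : C} {M : ScalarModule K L C} (f : X ⟶ M.obj) :
    tensorUnit (K := K) b X ≫ (tensorDesc b f).hom = f := by
  change (∑ i, b.repr 1 i • biproduct.ι (fun _ : Fin n => X) i) ≫
    biproduct.desc (fun j => f ≫ M.ρ (b j)) = f
  have h := act_sum Finset.univ M fun i => b.repr 1 i • b i
  rw [b.sum_repr, act_one] at h
  conv_rhs => rw [← Category.comp_id f, h]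
  simp [Preadditive.sum_comp, Preadditive.comp_sum, act_smul]

instance {X Y : C} (f : X ⟶ Y) [Mono f] : Mono (tensorMap (K := K) b f) := by
  have : Mono ((forget K L C).map (tensorMap (K := K) b f)) :=
    inferInstanceAs (Mono (biproduct.map fun _ : Fin n => f))
  exact (forget K L C).mono_of_mono_map this

/-- A right adjoint of a mono-preserving functor preserves injectives: pass to $L\otimes X\to M$,
extend along the mono $L\otimes f$, and restrict along the unit of $L$. -/
lemma injective_obj [FiniteDimensional K L] (M : ScalarModule K L C) [Injective M] :
    Injective M.obj where
  factors {X Y} g f _ := by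
    let b := Module.finBasis K L
    refine ⟨tensorUnit (K := K) b Y ≫
      (Injective.factorThru (tensorDesc b g) (tensorMap b f)).hom, ?_⟩
    rw [← Category.assoc, ← tensorUnit_tensorMap, Category.assoc, ← comp_hom,
      Injective.comp_factorThru, tensorUnit_tensorDesc]

variable [FiniteDimensional K L] [Algebra.IsSeparable K L]

lemma act_mul_traceDual (X : ScalarModule K L C) (a : L) (i : Fin n) :
    X.ρ (a * b.traceDual i) = ∑ j, b.repr (a * b j) i • X.ρ (b.traceDual j) := by
  rw [mul_comm, traceDual_mul, act_sum]
  simp only [act_smul]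

lemma sum_act_traceDual_act (X : ScalarModule K L C) :
    ∑ j, X.ρ (b.traceDual j) ≫ X.ρ (b j) = 𝟙 X.obj := by
  simp only [← act_mul_comp, ← act_sum, sum_mul_traceDual, act_one]

/-- The average over `L` of a morphism of `C`. -/
def average {M N : ScalarModule K L C} (h : M.obj ⟶ N.obj) : M ⟶ N :=
  ⟨∑ j, M.ρ (b j) ≫ h ≫ N.ρ (b.traceDual j), fun a => by
    rw [Preadditive.comp_sum, Preadditive.sum_comp]
    -- Multiplication by `a` on the basis and on its trace dual has transposed matrices, so
    -- exchanging the two sums moves `a` from one side to the other.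
    calc ∑ j, M.ρ a ≫ M.ρ (b j) ≫ h ≫ N.ρ (b.traceDual j)
        = ∑ j, ∑ i, b.repr (a * b j) i • M.ρ (b i) ≫ h ≫ N.ρ (b.traceDual j) := by
          refine Finset.sum_congr rfl fun j _ => ?_
          rw [← Category.assoc, ← act_mul_comp, mul_comm, act_mul_basis, Preadditive.sum_comp]
          simp only [Linear.smul_comp]
      _ = ∑ i, ∑ j, b.repr (a * b j) i • M.ρ (b i) ≫ h ≫ N.ρ (b.traceDual j) := Finset.sum_comm
      _ = ∑ i, (M.ρ (b i) ≫ h ≫ N.ρ (b.traceDual i)) ≫ N.ρ a := by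
          refine Finset.sum_congr rfl fun i _ => ?_
          rw [Category.assoc, Category.assoc, ← act_mul_comp, act_mul_traceDual,
            Preadditive.comp_sum, Preadditive.comp_sum]
          simp only [Linear.comp_smul]⟩

/-- By linearity of `f` and `g` the actions on the two sides of `h` collect into the action of $\sum
b_j b_j^*=1$, so averaging preserves the property of extending `g`. -/
lemma comp_average {M N P : ScalarModule K L C} (f : M ⟶ N) (g : M ⟶ P) (h : N.obj ⟶ P.obj)
    (hf : f.hom ≫ h = g.hom) : f ≫ average b h = g := by
  ext
  change f.hom ≫ ∑ j, N.ρ (b j) ≫ h ≫ P.ρ (b.traceDual j) = g.hom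
  have hf' (j : Fin n) : f.hom ≫ h ≫ P.ρ (b.traceDual j) = g.hom ≫ P.ρ (b.traceDual j) := by
    rw [← Category.assoc, hf]
  rw [Preadditive.comp_sum]
  simp only [← f.comm_assoc]
  simp only [hf', ← g.comm, ← act_mul_comp, ← Category.assoc, ← Preadditive.sum_comp,
    ← act_sum, mul_comm (b.traceDual _), sum_mul_traceDual, act_one, Category.id_comp]

lemma injective_of_obj (M : ScalarModule K L C) [Injective M.obj] : Injective M where
  factors g f _ := ⟨average (Module.finBasis K L) (Injective.factorThru g.hom f.hom),
    comp_average _ _ _ _ (Injective.comp_factorThru g.hom f.hom)⟩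

/-- The underlying morphism of the embedding of `M` into `L ⊗ X` given by a morphism `M ⟶ X`. -/
def tensorLiftHom {M : ScalarModule K L C} {X : C} (f : M.obj ⟶ X) :
    M.obj ⟶ ⨁ fun _ : Fin n => X :=
  ∑ j, M.ρ (b.traceDual j) ≫ f ≫ biproduct.ι (fun _ : Fin n => X) j

/-- The embedding of `M` into `L ⊗ X` given by a morphism `M ⟶ X` of `C`. -/
def tensorLift {M : ScalarModule K L C} {X : C} (f : M.obj ⟶ X) : M ⟶ tensorObj b X where
  hom := tensorLiftHom b f
  comm a := by
    change M.ρ a ≫ tensorLiftHom b f = tensorLiftHom b f ≫ tensorAct b X a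
    rw [tensorLiftHom, Preadditive.comp_sum, Preadditive.sum_comp]
    calc ∑ j, M.ρ a ≫ M.ρ (b.traceDual j) ≫ f ≫ biproduct.ι (fun _ : Fin n => X) j
        = ∑ j, ∑ i, b.repr (a * b i) j •
            M.ρ (b.traceDual i) ≫ f ≫ biproduct.ι (fun _ : Fin n => X) j := by
          refine Finset.sum_congr rfl fun j _ => ?_
          rw [← Category.assoc, ← act_mul_comp, mul_comm, act_mul_traceDual, Preadditive.sum_comp]
          simp only [Linear.smul_comp]
      _ = ∑ i, ∑ j, b.repr (a * b i) j •
            M.ρ (b.traceDual i) ≫ f ≫ biproduct.ι (fun _ : Fin n => X) j := Finset.sum_comm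
      _ = ∑ i, (M.ρ (b.traceDual i) ≫ f ≫ biproduct.ι (fun _ : Fin n => X) i) ≫
            tensorAct b X a := by
          refine Finset.sum_congr rfl fun i _ => ?_
          rw [Category.assoc, Category.assoc, ι_tensorAct, Preadditive.comp_sum,
            Preadditive.comp_sum]
          simp only [Linear.comp_smul]

/-- If the composite with `x` vanishes, then so does `x` followed by the action of every dual basis
vector, and these actions generate the identity through $\sum b_j^* b_j=1$. -/
lemma mono_tensorLiftHom {M : ScalarModule K L C} {X : C} (f : M.obj ⟶ X) [Mono f] :
    Mono (tensorLiftHom b f) := by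
  refine Preadditive.mono_of_cancel_zero _ fun {W} x hx => ?_
  have h (j : Fin n) : x ≫ M.ρ (b.traceDual j) = 0 := by
    have := congrArg (· ≫ biproduct.π (fun _ : Fin n => X) j) hx
    simp only [tensorLiftHom, Category.assoc, Preadditive.sum_comp, biproduct.ι_π, zero_comp] at this
    rw [Finset.sum_eq_single j (fun i _ hij => by simp [hij]) (by simp)] at this
    rw [← cancel_mono f]
    simpa using this
  rw [← Category.comp_id x, ← sum_act_traceDual_act b, Preadditive.comp_sum]
  exact Finset.sum_eq_zero fun j _ => by rw [← Category.assoc, h, zero_comp]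

instance mono_tensorLift {M : ScalarModule K L C} {X : C} (f : M.obj ⟶ X) [Mono f] :
    Mono (tensorLift b f) :=
  (forget K L C).mono_of_mono_map (mono_tensorLiftHom b f)

/-- An embedding of `M.obj` into an injective $I$ of $\mathcal C$ gives an $L$-linear one into
$L\otimes I$, whose underlying object is a finite sum of copies of $I$. -/
instance [EnoughInjectives C] : EnoughInjectives (ScalarModule K L C) where
  presentation M :=
    let b := Module.finBasis K L
    have : Injective (tensorObj (K := K) b (Injective.under M.obj)).obj :=
      inferInstanceAs (Injective (⨁ fun _ => Injective.under M.obj))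
    ⟨{ J := tensorObj b (Injective.under M.obj)
       injective := injective_of_obj _
       f := tensorLift b (Injective.ι M.obj)
       mono := mono_tensorLift b _ }⟩

end Injective

end ScalarModule

end

noncomputable section

/-! ### Complexes of module objects and module objects in complexes -/

namespace ScalarModule

section Exact

variable {K : Type w} {L : Type w'} [Field K] [Field L] [Algebra K L]
  {C : Type u} [Category.{v} C] [Abelian C] [Linear K C]

lemma isZero_iff (X : ScalarModule K L C) : IsZero X ↔ IsZero X.obj := by
  rw [IsZero.iff_id_eq_zero, IsZero.iff_id_eq_zero]
  exact ⟨fun h => congrArg Hom.hom h, fun h => Hom.ext h⟩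

/-- Exactness says that the kernel inclusion followed by the cokernel projection is zero, and both
are computed in `C`. -/
lemma exact_iff (S : ShortComplex (ScalarModule K L C)) :
    S.Exact ↔ (S.map (forget K L C)).Exact := by
  have h₁ := S.exact_iff_of_forks
    (isLimitOfHom (kerι S.g) S.g (kerι_comp S.g) (kernelIsKernel S.g.hom))
    (isColimitOfHom S.f (cokerπ S.f) (comp_cokerπ S.f) (cokernelIsCokernel S.f.hom))
  have h₂ := (S.map (forget K L C)).exact_iff_of_forks (kernelIsKernel _) (cokernelIsCokernel _)
  rw [h₁, h₂]
  exact ⟨fun h => congrArg Hom.hom h, fun h => Hom.ext h⟩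

variable (K L C) in
/-- The underlying complex of a complex of module objects. -/
abbrev forgetComplex : CochainComplex (ScalarModule K L C) ℤ ⥤ CochainComplex C ℤ :=
  (forget K L C).mapHomologicalComplex _

lemma exactAt_iff (X : CochainComplex (ScalarModule K L C) ℤ) (i : ℤ) :
    X.ExactAt i ↔ ((forgetComplex K L C).obj X).ExactAt i := exact_iff (X.sc i)

end Exact

end ScalarModule

/-! ### The DG-equivalence between module objects in complexes and complexes of module objects. -/

section ModuleComplex

open CochainComplex CochainComplex.HomComplex DGCat

variable {K : Type w} {L : Type w'} [Field K] [Field L] [Algebra K L]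
  {C : Type u} [Category.{v} C] [Abelian C] [Linear K C]

lemma comp_v_eq_v_comp {X X' Y Y' : CochainComplex C ℤ} {n : ℤ} (f : X ⟶ X') (g : Y ⟶ Y')
    (α : Cochain X Y n) (α' : Cochain X' Y' n) (h : (Cochain.ofHom f).comp α' (zero_add n) =
      α.comp (Cochain.ofHom g) (add_zero n)) (p q : ℤ) (hpq : p + n = q) :
    f.f p ≫ α'.v p q hpq = α.v p q hpq ≫ g.f q := by
  simpa using Cochain.congr_v h p q hpq

/-- The endomorphism of complexes by which `l` acts. -/
def lobjHom (X : LObj (injDG K C) L) (l : L) : X.obj.cx ⟶ X.obj.cx :=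
  Cocycle.homOf (Cocycle.mk (X.act l) 1 (zero_add 1) (X.d_act l))

lemma ofHom_lobjHom (X : LObj (injDG K C) L) (l : L) : Cochain.ofHom (lobjHom X l) = X.act l :=
  Cocycle.cochain_ofHom_homOf_eq_coe _

lemma lobjHom_eq (X : LObj (injDG K C) L) (l : L) {f : X.obj.cx ⟶ X.obj.cx}
    (h : X.act l = Cochain.ofHom f) : lobjHom X l = f :=
  Cochain.ofHom_injective ((ofHom_lobjHom X l).trans h)

lemma lobjHom_mul (X : LObj (injDG K C) L) (a b : L) :
    lobjHom X (a * b) = lobjHom X b ≫ lobjHom X a :=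
  lobjHom_eq X _ (by
    rw [Cochain.ofHom_comp, ofHom_lobjHom, ofHom_lobjHom]
    exact X.act_mul a b)

lemma lobjHom_add (X : LObj (injDG K C) L) (a b : L) :
    lobjHom X (a + b) = lobjHom X a + lobjHom X b :=
  lobjHom_eq X _ (by
    rw [Cochain.ofHom_add, ofHom_lobjHom, ofHom_lobjHom]
    exact map_add X.act a b)

lemma lobjHom_algebraMap (X : LObj (injDG K C) L) (r : K) :
    lobjHom X (algebraMap K L r) = r • 𝟙 _ :=
  lobjHom_eq X _ (by
    have h : Cochain.ofHom (r • 𝟙 X.obj.cx) = r • Cochain.ofHom (𝟙 X.obj.cx) := by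
      ext p
      simp
    rw [h, Algebra.algebraMap_eq_smul_one, map_smul, X.act_one]
    rfl)

/-- A module object in complexes is a complex of module objects. -/
def lobjComplex (X : LObj (injDG K C) L) : CochainComplex (ScalarModule K L C) ℤ where
  X i := ScalarModule.ofEnd (X.obj.cx.X i) (fun l => (lobjHom X l).f i)
    (fun a b => by rw [lobjHom_mul]; rfl) (fun a b => by rw [lobjHom_add]; rfl)
    (fun r => by rw [lobjHom_algebraMap]; rfl)
  d i j := ⟨X.obj.cx.d i j, fun l => ((lobjHom X l).comm i j)⟩
  shape i j h := ScalarModule.Hom.ext (X.obj.cx.shape i j h)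
  d_comp_d' i j k _ _ := ScalarModule.Hom.ext (X.obj.cx.d_comp_d i j k)

lemma lobjHom_comp_v {X Y : LObj (injDG K C) L} {n : ℤ} (α : LHom X Y n) (l : L) (p q : ℤ)
    (h : p + n = q) : (lobjHom X l).f p ≫ Cochain.v (n := n) α.1 p q h =
      Cochain.v (n := n) α.1 p q h ≫ (lobjHom Y l).f q := by
  refine comp_v_eq_v_comp _ _ _ _ ?_ p q h
  rw [ofHom_lobjHom, ofHom_lobjHom]
  exact α.2 l

/-- A morphism of module objects as a cochain. -/
def lhomCochain {X Y : LObj (injDG K C) L} {n : ℤ} (α : LHom X Y n) :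
    Cochain (lobjComplex X) (lobjComplex Y) n :=
  Cochain.mk fun p q h => ⟨Cochain.v (n := n) α.1 p q h, fun l => lobjHom_comp_v α l p q h⟩

lemma lhomCochain_injective {X Y : LObj (injDG K C) L} {n : ℤ} :
    Function.Injective (lhomCochain : LHom X Y n → _) := fun _ _ h =>
  Subtype.ext (Cochain.ext (F := X.obj.cx) (G := Y.obj.cx) _ _ fun p q hpq =>
    congrArg ScalarModule.Hom.hom (Cochain.congr_v h p q hpq))

/-- Compatibility with $L$ is a condition on each component separately, so every cochain of module
objects comes from an $L$-linear cochain. -/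
lemma lhomCochain_surjective {X Y : LObj (injDG K C) L} {n : ℤ} :
    Function.Surjective (lhomCochain : LHom X Y n → _) := fun β => by
  let α : Cochain X.obj.cx Y.obj.cx n := Cochain.mk fun p q h => (β.v p q h).hom
  refine ⟨⟨α, fun l => ?_⟩, Cochain.ext _ _ fun p q h => ScalarModule.Hom.ext rfl⟩
  have h : (Cochain.ofHom (lobjHom X l)).comp α (zero_add n) =
      α.comp (Cochain.ofHom (lobjHom Y l)) (add_zero n) := by
    ext p q hpq
    rw [Cochain.zero_cochain_comp_v, Cochain.comp_zero_cochain_v, Cochain.ofHom_v, Cochain.ofHom_v]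
    exact (β.v p q hpq).comm l
  rw [ofHom_lobjHom, ofHom_lobjHom] at h
  exact h

lemma lhomCochain_δ {X Y : LObj (injDG K C) L} (n m : ℤ) (α : LHom X Y n) :
    lhomCochain ((DGCat.scalarExt (injDG K C) L).d n m α) = δ n m (lhomCochain α) := by
  by_cases h : n + 1 = m
  · refine Cochain.ext _ _ fun p q hpq => ScalarModule.Hom.ext ?_
    rw [δ_v n m h _ p q hpq (q - 1) (p + 1) rfl rfl]
    exact δ_v n m h (F := X.obj.cx) (G := Y.obj.cx) α.1 p q hpq (q - 1) (p + 1) rfl rfl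
  · exact (congrArg lhomCochain ((DGCat.scalarExt (injDG K C) L).d_shape n m α h)).trans
      ((Cochain.ext _ _ fun p q hpq => ScalarModule.Hom.ext rfl).trans (δ_shape _ _ h _).symm)

lemma lhomCochain_comp {X Y Z : LObj (injDG K C) L} {p q n : ℤ} (α : LHom X Y p) (β : LHom Y Z q)
    (h : p + q = n) : lhomCochain ((DGCat.scalarExt (injDG K C) L).comp α β h) =
      (lhomCochain α).comp (lhomCochain β) h := by
  refine Cochain.ext _ _ fun a c hac => ScalarModule.Hom.ext ?_
  rw [Cochain.comp_v _ _ h a (a + p) c rfl (by omega)]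
  exact Cochain.comp_v (F := X.obj.cx) (G := Y.obj.cx) (K := Z.obj.cx) α.1 β.1 h a (a + p) c rfl
    (by omega)

/-- The cochains given by morphisms of module objects, as a linear map. -/
def lhomCochainHom (X Y : LObj (injDG K C) L) (n : ℤ) :
    LHom X Y n →ₗ[L] Cochain (lobjComplex X) (lobjComplex Y) n where
  toFun := lhomCochain
  map_add' α β := Cochain.ext _ _ fun p q h => ScalarModule.Hom.ext rfl
  map_smul' l α := Cochain.ext _ _ fun p q h => ScalarModule.Hom.ext (by
    refine (congrArg (fun γ : Cochain X.obj.cx X.obj.cx 0 =>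
      (γ.comp (n₂ := n) α.1 (zero_add n)).v p q h) (ofHom_lobjHom X l).symm).trans ?_
    exact (Cochain.zero_cochain_comp_v (F := X.obj.cx) (G := X.obj.cx) (K := Y.obj.cx) _ α.1 p q
      h).trans (congrArg (· ≫ Cochain.v (n := n) α.1 p q h) (Cochain.ofHom_v (lobjHom X l) p)))

variable [FiniteDimensional K L]

/-- The underlying complex of a complex of injective module objects. -/
def injForget (X : InjComplex (ScalarModule K L C)) : InjComplex C where
  cx := (ScalarModule.forgetComplex K L C).obj X.cx
  injective i :=
    have := X.injective i
    ScalarModule.injective_obj (X.cx.X i)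
  boundedBelow := by
    obtain ⟨a, ha⟩ := X.boundedBelow
    exact ⟨a, fun i hi => (ScalarModule.isZero_iff _).1 (ha i hi)⟩
  boundedCohomology := by
    obtain ⟨b, hb⟩ := X.boundedCohomology
    exact ⟨b, fun i hi => (ScalarModule.exactAt_iff _ i).1 (hb i hi)⟩

/-- The endomorphism of the underlying complex by which `l` acts. -/
def injForgetHom (X : InjComplex (ScalarModule K L C)) (l : L) :
    (injForget X).cx ⟶ (injForget X).cx where
  f i := (X.cx.X i).ρ l
  comm' i j _ := (X.cx.d i j).comm l

/-- The action of `L` on the underlying complex. -/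
def injForgetAct (X : InjComplex (ScalarModule K L C)) :
    L →ₗ[K] Cochain (injForget X).cx (injForget X).cx 0 where
  toFun l := Cochain.ofHom (injForgetHom X l)
  map_add' a b := by
    rw [← Cochain.ofHom_add]
    congr 1
    ext i
    exact (X.cx.X i).act_add a b
  map_smul' c a := by
    have h : Cochain.ofHom (c • injForgetHom X a) = c • Cochain.ofHom (injForgetHom X a) := by
      ext p
      simp
    refine Eq.trans ?_ h
    congr 1
    ext i
    exact (X.cx.X i).act_smul c a

/-- A complex of injective module objects, as a module object in complexes of injective objects. -/
def injLObj (X : InjComplex (ScalarModule K L C)) : LObj (injDG K C) L where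
  obj := injForget X
  act := injForgetAct X
  act_one := congrArg Cochain.ofHom (by
    ext i
    exact (X.cx.X i).act_one : injForgetHom X 1 = 𝟙 _)
  act_mul a b := (congrArg Cochain.ofHom (by
    ext i
    exact (X.cx.X i).act_mul_comp a b :
      injForgetHom X (a * b) = injForgetHom X b ≫ injForgetHom X a)).trans (Cochain.ofHom_comp _ _)
  d_act a := δ_ofHom _

lemma lobjHom_injLObj (X : InjComplex (ScalarModule K L C)) (l : L) :
    lobjHom (injLObj X) l = injForgetHom X l := lobjHom_eq _ _ rfl

/-- The two constructions are inverse to each other. -/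
def lobjComplexInjLObjIso (X : InjComplex (ScalarModule K L C)) :
    lobjComplex (injLObj X) ≅ X.cx where
  hom :=
    { f := fun i => ⟨𝟙 (X.cx.X i).obj, fun l => (Category.comp_id _).trans
        ((congrArg (fun h => HomologicalComplex.Hom.f h i) (lobjHom_injLObj X l)).trans
          (Category.id_comp _).symm)⟩
      comm' := fun i j _ => ScalarModule.Hom.ext
        ((Category.id_comp _).trans (Category.comp_id _).symm) }
  inv :=
    { f := fun i => ⟨𝟙 (X.cx.X i).obj, fun l => (Category.comp_id _).trans
        ((congrArg (fun h => HomologicalComplex.Hom.f h i) (lobjHom_injLObj X l)).symm.trans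
          (Category.id_comp _).symm)⟩
      comm' := fun i j _ => ScalarModule.Hom.ext
        ((Category.id_comp _).trans (Category.comp_id _).symm) }
  hom_inv_id := by
    ext i
    exact Category.comp_id _
  inv_hom_id := by
    ext i
    exact Category.comp_id _

variable [Algebra.IsSeparable K L]

/-- A module object in bounded below complexes of injective objects is a complex of injective module
objects. -/
def lobjInj (X : LObj (injDG K C) L) : InjComplex (ScalarModule K L C) where
  cx := lobjComplex X
  injective i :=
    have : Injective ((lobjComplex X).X i).obj := X.obj.injective i
    ScalarModule.injective_of_obj _
  boundedBelow := by
    obtain ⟨a, ha⟩ := X.obj.boundedBelow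
    exact ⟨a, fun i hi => (ScalarModule.isZero_iff _).2 (ha i hi)⟩
  boundedCohomology := by
    obtain ⟨b, hb⟩ := X.obj.boundedCohomology
    exact ⟨b, fun i hi => (ScalarModule.exactAt_iff _ i).2 (hb i hi)⟩

variable (K L C)

/-- Module objects in the DG-category of complexes are complexes of module objects. -/
def lobjFunctor : DGFunctor (DGCat.scalarExt (injDG K C) L) (injDG L (ScalarModule K L C)) where
  obj := lobjInj
  map {X Y n} := lhomCochainHom X Y n
  map_d := lhomCochain_δ
  map_id X := Cochain.ext _ _ fun p q h => ScalarModule.Hom.ext (by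
    obtain rfl : p = q := by omega
    refine (Cochain.ofHom_v (𝟙 X.obj.cx) p).trans ?_
    exact (congrArg ScalarModule.Hom.hom (Cochain.ofHom_v (𝟙 (lobjComplex X)) p)).symm)
  map_comp := lhomCochain_comp

lemma lobjFunctor_fullyFaithful : (lobjFunctor K L C).FullyFaithful :=
  fun _ _ _ => ⟨lhomCochain_injective, lhomCochain_surjective⟩

variable {K L C}

/-- Here injective module objects must have injective underlying objects, while the functor itself
required the converse. -/
instance : (lobjFunctor K L C).mapZ0.EssSurj where
  mem_essImage X := ⟨⟨injLObj X.obj⟩, ⟨injIso (lobjComplexInjLObjIso X.obj)⟩⟩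

end ModuleComplex

end

noncomputable section

/-! ### Tensor products with `L` in a DG-category with finite direct sums -/

namespace DGCat

section Copies

variable {k : Type w} [CommRing k] (A : DGCat.{w, v, u} k)

/-- A direct sum of `n` copies of `X`. -/
structure Copies (X : A.Obj) (n : ℕ) where
  obj : A.Obj
  ι : Fin n → A.Hom X obj 0
  π : Fin n → A.Hom obj X 0
  ι_π : ∀ j, A.comp (ι j) (π j) (add_zero 0) = A.id X
  ι_π_of_ne : ∀ i j, i ≠ j → A.comp (ι i) (π j) (add_zero 0) = 0
  total : ∑ j, A.comp (π j) (ι j) (add_zero 0) = A.id obj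
  d_ι : ∀ j, A.d 0 1 (ι j) = 0
  d_π : ∀ j, A.d 0 1 (π j) = 0

variable {A}

/-- The twisted complex `⨁ X`. -/
def Twisted.copies (X : A.Obj) (n : ℕ) : Twisted A where
  n := n
  obj _ := X
  r _ := 0
  q _ _ := 0
  q_eq_zero _ _ _ := rfl
  maurerCartan _ _ := by simp [A.comp_zero]

/-- Direct sums of copies from realizations of twisted complexes. -/
def Realization.copies {X : A.Obj} {n : ℕ} (R : Realization (Twisted.copies X n)) :
    Copies A X n where
  obj := R.obj
  ι := R.ι
  π := R.π
  ι_π := R.ι_π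
  ι_π_of_ne i j h := R.ι_π_of_ne i j 0 rfl h
  total := R.total
  d_ι j := (R.d_ι j).trans (Finset.sum_eq_zero fun _ _ => A.zero_comp _ _)
  d_π j := (R.d_π j).trans (neg_eq_zero.2 ((congrArg (_ • ·)
    (Finset.sum_eq_zero fun _ _ => A.comp_zero _ _)).trans (smul_zero _)))

namespace Copies

variable {X : A.Obj} {n : ℕ} (S : Copies A X n)

/-- The morphism given by its restrictions to the summands. -/
def desc {Z : A.Obj} {m : ℤ} (x : Fin n → A.Hom X Z m) : A.Hom S.obj Z m :=
  ∑ i, A.comp (S.π i) (x i) (zero_add m)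

lemma ι_desc {Z : A.Obj} {m : ℤ} (x : Fin n → A.Hom X Z m) (j : Fin n) :
    A.comp (S.ι j) (S.desc x) (zero_add m) = x j := by
  rw [desc, A.comp_sum, Finset.sum_eq_single j]
  · rw [← A.assoc (S.ι j) (S.π j) (x j) (add_zero 0) _ (zero_add m), S.ι_π, A.id_comp]
  · intro i _ hi
    rw [← A.assoc (S.ι j) (S.π i) (x i) (add_zero 0) _ (zero_add m), S.ι_π_of_ne j i hi.symm,
      A.zero_comp]
  · exact fun h => absurd (Finset.mem_univ j) h

lemma desc_ι {Z : A.Obj} {m : ℤ} (f : A.Hom S.obj Z m) :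
    S.desc (fun j => A.comp (S.ι j) f (zero_add m)) = f := by
  conv_rhs => rw [← A.id_comp f, ← S.total, A.sum_comp]
  refine Finset.sum_congr rfl fun j _ => ?_
  rw [A.assoc (S.π j) (S.ι j) f _ (zero_add m) _ (zero_add m)]

lemma hom_ext {Z : A.Obj} {m : ℤ} {f g : A.Hom S.obj Z m}
    (h : ∀ j, A.comp (S.ι j) f (zero_add m) = A.comp (S.ι j) g (zero_add m)) : f = g := by
  rw [← S.desc_ι f, ← S.desc_ι g]
  exact congrArg _ (funext h)

lemma desc_comp {Z W : A.Obj} {p q m : ℤ} (x : Fin n → A.Hom X Z p) (g : A.Hom Z W q)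
    (h : p + q = m) : A.comp (S.desc x) g h = S.desc fun j => A.comp (x j) g h := by
  rw [desc, A.sum_comp]
  refine Finset.sum_congr rfl fun j _ => ?_
  rw [A.assoc (S.π j) (x j) g _ h _ (zero_add m)]

lemma d_desc {Z : A.Obj} (x : Fin n → A.Hom X Z 0) (hx : ∀ j, A.d 0 1 (x j) = 0) :
    A.d 0 1 (S.desc x) = 0 := by
  rw [desc, map_sum]
  refine Finset.sum_eq_zero fun j _ => ?_
  rw [d_closed_comp 1 (S.π j) (x j) (S.d_π j) (zero_add 1), hx, A.comp_zero]

end Copies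

end Copies

/-! ### The object $L\otimes X$ built from copies of $X$, and its universal property. -/

section Tensor

variable {K : Type w} [Field K] {A : DGCat.{w, v, u} K} {L : Type w'} [Field L] [Algebra K L]

namespace Copies

variable {X : A.Obj} {n : ℕ} (S : Copies A X n) (b : Module.Basis (Fin n) K L)

/-- The embedding of a summand `l ⊗ X`. -/
def elt : L →ₗ[K] A.Hom X S.obj 0 where
  toFun l := ∑ i, b.repr l i • S.ι i
  map_add' x y := by simp [add_smul, Finset.sum_add_distrib]
  map_smul' c x := by simp [Finset.smul_sum, smul_smul]

lemma elt_basis (j : Fin n) : S.elt b (b j) = S.ι j := by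
  change ∑ i, b.repr (b j) i • S.ι i = _
  simp [Finsupp.single_apply]

lemma d_elt (l : L) : A.d 0 1 (S.elt b l) = 0 := by
  change A.d 0 1 (∑ i, b.repr l i • S.ι i) = 0
  simp [S.d_ι]

lemma elt_desc {Z : A.Obj} {m : ℤ} (u : L →ₗ[K] A.Hom X Z m) (l : L) :
    A.comp (S.elt b l) (S.desc fun j => u (b j)) (zero_add m) = u l := by
  change A.comp (∑ i, b.repr l i • S.ι i) _ _ = _
  conv_rhs => rw [← b.sum_repr l, map_sum]
  rw [A.sum_comp]
  refine Finset.sum_congr rfl fun j _ => ?_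
  rw [A.smul_comp, S.ι_desc, map_smul]

/-- The action of `l` on `L ⊗ X`. -/
def act (l : L) : A.Hom S.obj S.obj 0 := S.desc fun j => S.elt b (l * b j)

lemma elt_act (x l : L) : A.comp (S.elt b x) (S.act b l) (add_zero 0) = S.elt b (l * x) :=
  S.elt_desc b ((S.elt b).comp (LinearMap.mulLeft K l)) x

lemma ι_act (l : L) (j : Fin n) :
    A.comp (S.ι j) (S.act b l) (add_zero 0) = S.elt b (l * b j) := S.ι_desc _ j

/-- The module object `L ⊗ X`. -/
def tensor : LObj A L where
  obj := S.obj
  act :=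
    { toFun := S.act b
      map_add' := fun x y => S.hom_ext fun j => by
        rw [A.comp_add, S.ι_act, S.ι_act, S.ι_act, add_mul, map_add]
      map_smul' := fun c x => S.hom_ext fun j => by
        rw [RingHom.id_apply, A.comp_smul, S.ι_act, S.ι_act, smul_mul_assoc, map_smul] }
  act_one := S.hom_ext fun j => by
    rw [A.comp_id]
    exact (S.ι_act b 1 j).trans (by rw [one_mul, elt_basis])
  act_mul x y := S.hom_ext fun j => by
    change A.comp (S.ι j) (S.act b (x * y)) (add_zero 0) =
      A.comp (S.ι j) (A.comp (S.act b y) (S.act b x) (add_zero 0)) (add_zero 0)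
    rw [← A.assoc (S.ι j) (S.act b y) _ (add_zero 0) _ (add_zero 0), S.ι_act, S.ι_act, S.elt_act,
      mul_assoc]
  d_act l := S.d_desc _ fun j => S.d_elt b _

/-- The unit is the copy of $X$ at $1\in L$; acting by `b j` moves it to the `j`-th summand, so a
morphism is prescribed freely by its values on the basis. -/
lemma isTensor : IsTensor X (S.tensor b) := by
  refine ⟨S.elt b 1, S.d_elt b 1, fun Z m u => ⟨S.desc fun j => u (b j), fun l => ?_, ?_⟩⟩
  · change A.comp (A.comp (S.elt b 1) (S.act b l) (add_zero 0)) _ _ = _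
    rw [S.elt_act, mul_one, S.elt_desc]
  · intro φ hφ
    refine S.hom_ext fun j => ?_
    have h : A.comp (A.comp (S.elt b 1) (S.act b (b j)) (add_zero 0)) φ (zero_add m) = u (b j) :=
      hφ (b j)
    rw [S.elt_act, mul_one, S.elt_basis] at h
    rw [h, S.ι_desc]

end Copies

/-! ### Splitting the multiplication $L\otimes Y\to Y$ by separability. -/

section Retract

variable (Y : LObj A L) {n : ℕ} (S : Copies A Y.obj n) (b : Module.Basis (Fin n) K L)

/-- The multiplication `L ⊗ Y ⟶ Y`. -/
def LObj.retraction : A.Hom S.obj Y.obj 0 := S.desc fun j => Y.act (b j)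

lemma LObj.retraction_mem : Y.retraction S b ∈ LHom (S.tensor b) Y 0 := by
  intro l
  refine S.hom_ext fun j => ?_
  change A.comp (S.ι j) (A.comp (S.act b l) (Y.retraction S b) (add_zero 0)) (add_zero 0) =
    A.comp (S.ι j) (A.comp (Y.retraction S b) (Y.act l) (add_zero 0)) (add_zero 0)
  rw [← A.assoc (S.ι j) (S.act b l) _ (add_zero 0) _ (add_zero 0), S.ι_act, LObj.retraction,
    S.elt_desc, S.desc_comp, S.ι_desc, Y.act_mul]

variable [FiniteDimensional K L] [Algebra.IsSeparable K L]

/-- The embedding `Y ⟶ L ⊗ Y` given by the separability element. -/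
def LObj.embedding : A.Hom Y.obj S.obj 0 :=
  ∑ j, A.comp (Y.act (b.traceDual j)) (S.ι j) (add_zero 0)

/-- The $L$-linearity is the centrality of the separability element, expressed by the transposed
matrices in `traceDual_mul`. -/
lemma LObj.embedding_mem : Y.embedding S b ∈ LHom Y (S.tensor b) 0 := by
  intro l
  change A.comp (Y.act l) (Y.embedding S b) (add_zero 0) =
    A.comp (Y.embedding S b) (S.act b l) (add_zero 0)
  rw [LObj.embedding, A.comp_sum, A.sum_comp]
  calc ∑ j, A.comp (Y.act l) (A.comp (Y.act (b.traceDual j)) (S.ι j) (add_zero 0)) (add_zero 0)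
      = ∑ j, ∑ i, b.repr (l * b i) j • A.comp (Y.act (b.traceDual i)) (S.ι j) (add_zero 0) := by
        refine Finset.sum_congr rfl fun j _ => ?_
        rw [← A.assoc (Y.act l) _ (S.ι j) (add_zero 0) _ (add_zero 0), ← Y.act_mul, traceDual_mul,
          map_sum, A.sum_comp]
        refine Finset.sum_congr rfl fun i _ => ?_
        rw [map_smul, A.smul_comp]
    _ = ∑ i, ∑ j, b.repr (l * b i) j • A.comp (Y.act (b.traceDual i)) (S.ι j) (add_zero 0) :=
        Finset.sum_comm
    _ = _ := by
        refine Finset.sum_congr rfl fun i _ => ?_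
        rw [A.assoc _ (S.ι i) (S.act b l) _ (add_zero 0) _ (add_zero 0), S.ι_act]
        change _ = A.comp _ (∑ j, b.repr (l * b i) j • S.ι j) _
        rw [A.comp_sum]
        refine Finset.sum_congr rfl fun j _ => ?_
        rw [A.comp_smul]

/-- The composite is the action of $\sum b_j b_j^*$, which is $1$. -/
lemma LObj.embedding_retraction :
    A.comp (Y.embedding S b) (Y.retraction S b) (add_zero 0) = A.id Y.obj := by
  rw [LObj.embedding, A.sum_comp, ← Y.act_one, ← sum_mul_traceDual b, map_sum]
  refine Finset.sum_congr rfl fun j _ => ?_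
  rw [A.assoc _ (S.ι j) _ _ (add_zero 0) _ (add_zero 0), LObj.retraction, S.ι_desc, Y.act_mul]

lemma LObj.d_embedding : A.d 0 1 (Y.embedding S b) = 0 := by
  rw [LObj.embedding, map_sum]
  refine Finset.sum_eq_zero fun j _ => ?_
  rw [d_comp_closed 1 _ (S.ι j) (S.d_ι j) (zero_add 1), Y.d_act, A.zero_comp]

/-- Over a separable extension, `Y` is a direct summand of `L ⊗ Y`. -/
lemma LObj.exists_retract : ∃ (i : (⟨Y⟩ : Z0 (A.scalarExt L)) ⟶ ⟨S.tensor b⟩)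
    (r : (⟨S.tensor b⟩ : Z0 (A.scalarExt L)) ⟶ ⟨Y⟩), i ≫ r = 𝟙 _ :=
  ⟨⟨⟨Y.embedding S b, Y.embedding_mem S b⟩, Subtype.ext (Y.d_embedding S b)⟩,
    ⟨⟨Y.retraction S b, Y.retraction_mem S b⟩, Subtype.ext (S.d_desc _ fun _ => Y.d_act _)⟩,
    Z0.Hom.ext (Subtype.ext (Y.embedding_retraction S b))⟩

end Retract

end Tensor

end DGCat

end

noncomputable section

/-! ### Distinguished triangles in the homotopy category -/

namespace DGCat

section Reflect

variable {k : Type w} [CommRing k] {A : DGCat.{w, v, u} k} (T : A.Translation)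
  {E : Type u'} [Category.{v'} E] [HasZeroObject E] [HasShift E ℤ] [Preadditive E]
  [∀ n : ℤ, (shiftFunctor E n).Additive] [Pretriangulated E]

lemma Translation.distinguished_cone {X Y Z : Z0 A} {f : X ⟶ Y} (c : A.Cone f Z) :
    T.Distinguished ((H0.quotient A).map f) ((H0.quotient A).map ⟨c.i, c.d_i⟩)
      ((H0.quotient A).map (T.coneToTranslation c)) :=
  ⟨X, Y, Z, f, c, Iso.refl _, Iso.refl _, Iso.refl _,
    (Category.comp_id _).trans (Category.id_comp _).symm,
    (Category.comp_id _).trans (Category.id_comp _).symm,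
    (congrArg (_ ≫ ·) (T.functor.map_id _)).trans
      ((Category.comp_id _).trans (Category.id_comp _).symm)⟩

/-- A fully faithful functor to a triangulated category which sends the distinguished triangles to
distinguished triangles also reflects them, if all cones exist. -/
lemma Translation.distinguished_iff_map (hA : ∀ {X Y : Z0 A} (f : X ⟶ Y), ∃ Z, Nonempty (A.Cone f Z))
    (G : H0 A ⥤ E) [G.Full] [G.Faithful] (γ : T.functor ⋙ G ≅ G ⋙ shiftFunctor E (1 : ℤ))
    (hG : ∀ {X Y Z : H0 A} {f : X ⟶ Y} {g : Y ⟶ Z} {h : Z ⟶ T.functor.obj X},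
      T.Distinguished f g h → Pretriangulated.Triangle.mk (G.map f) (G.map g)
        (G.map h ≫ γ.hom.app X) ∈ Pretriangulated.distinguishedTriangles)
    {X Y Z : H0 A} (f : X ⟶ Y) (g : Y ⟶ Z) (h : Z ⟶ T.functor.obj X) :
    T.Distinguished f g h ↔ Pretriangulated.Triangle.mk (G.map f) (G.map g)
      (G.map h ≫ γ.hom.app X) ∈ Pretriangulated.distinguishedTriangles := by
  refine ⟨hG, fun H => ?_⟩
  obtain ⟨X, rfl⟩ := H0.exists_obj_eq X
  obtain ⟨Y, rfl⟩ := H0.exists_obj_eq Y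
  obtain ⟨f, rfl⟩ := H0.exists_map_eq f
  obtain ⟨Z', ⟨c⟩⟩ := hA f
  -- The given triangle and that of a cone of `f` have images with the same first morphism, hence
  -- isomorphic images; by full faithfulness the isomorphism of third terms comes from `H0 A`.
  let e := Pretriangulated.isoTriangleOfIso₁₂ _ _ H (hG (T.distinguished_cone c)) (Iso.refl _)
    (Iso.refl _) ((Category.comp_id _).trans (Category.id_comp _).symm)
  let e₃ : G.obj Z ≅ G.obj ((H0.quotient A).obj Z') := Pretriangulated.Triangle.π₃.mapIso e
  have he₁ : e.hom.hom₁ = 𝟙 _ := rfl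
  have he₂ : e.hom.hom₂ = 𝟙 _ := rfl
  have c₂ : G.map g ≫ e₃.hom = G.map ((H0.quotient A).map ⟨c.i, c.d_i⟩) :=
    (e.hom.comm₂).trans ((congrArg (· ≫ _) he₂).trans (Category.id_comp _))
  have c₃ : (G.map h ≫ γ.hom.app ((H0.quotient A).obj X)) =
      e₃.hom ≫ G.map ((H0.quotient A).map (T.coneToTranslation c)) ≫
        γ.hom.app ((H0.quotient A).obj X) := by
    refine Eq.trans ?_ e.hom.comm₃
    rw [he₁]
    exact ((congrArg (_ ≫ ·) ((shiftFunctor E (1 : ℤ)).map_id _)).trans (Category.comp_id _)).symm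
  have c₃' : G.map h = e₃.hom ≫ G.map ((H0.quotient A).map (T.coneToTranslation c)) :=
    (cancel_mono (γ.hom.app ((H0.quotient A).obj X))).1 (c₃.trans (Category.assoc _ _ _).symm)
  refine ⟨X, Y, Z', f, c, Iso.refl _, Iso.refl _, G.preimageIso e₃,
    (Category.comp_id _).trans (Category.id_comp _).symm, G.map_injective ?_, G.map_injective ?_⟩
  · refine (G.map_comp _ _).trans (Eq.trans ?_ (congrArg G.map (Category.id_comp _)).symm)
    exact (congrArg (G.map g ≫ ·) (G.map_preimage e₃.hom)).trans c₂
  · refine (congrArg G.map ((congrArg (h ≫ ·) (T.functor.map_id _)).trans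
      (Category.comp_id _))).trans (c₃'.trans (Eq.trans ?_ (G.map_comp _ _).symm))
    exact congrArg (· ≫ G.map ((H0.quotient A).map (T.coneToTranslation c)))
      (G.map_preimage e₃.hom).symm

end Reflect

/-! ### One-term twisted complexes. -/

section ToPretr

variable {k : Type w} [CommRing k] {A : DGCat.{w, v, u} k} {B : DGCat.{w, v', u'} k}

/-- The realization of a twisted complex with one term is this term. -/
def Realization.isoToPretr (F : DGFunctor A B) (Y : A.Obj)
    (R : Realization (F.mapTwisted (toPretr Y))) : (⟨R.obj⟩ : Z0 B) ≅ ⟨F.obj Y⟩ where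
  hom := ⟨R.π (0 : Fin 1), (R.d_π (0 : Fin 1)).trans (neg_eq_zero.2 ((congrArg (_ • ·)
    (Finset.sum_eq_zero fun _ _ => (congrArg (fun x => B.comp _ x _) (map_zero F.map)).trans
      (B.comp_zero _ _))).trans (smul_zero _)))⟩
  inv := ⟨R.ι (0 : Fin 1), (R.d_ι (0 : Fin 1)).trans
    (Finset.sum_eq_zero fun _ _ => (congrArg (fun x => B.comp x _ _) (map_zero F.map)).trans
      (B.zero_comp _ _))⟩
  hom_inv_id := Z0.Hom.ext ((Fin.sum_univ_one _).symm.trans R.total)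
  inv_hom_id := Z0.Hom.ext (R.ι_π (0 : Fin 1))

end ToPretr

end DGCat

end

noncomputable section

/-! ### The base change of the bounded derived category -/

/-- Retracts are reflected by fully faithful functors. -/
lemma exists_retract_of_map {D : Type u} [Category.{v} D] {E : Type u'} [Category.{v'} E]
    (F : D ⥤ E) [F.Full] [F.Faithful] {X Y : D} {Z W : E} (a : Z ≅ F.obj X) (b : W ≅ F.obj Y)
    (i : Z ⟶ W) (r : W ⟶ Z) (h : i ≫ r = 𝟙 Z) :
    ∃ (i' : X ⟶ Y) (r' : Y ⟶ X), i' ≫ r' = 𝟙 X := by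
  refine ⟨F.preimage (a.inv ≫ i ≫ b.hom), F.preimage (b.inv ≫ r ≫ a.hom), F.map_injective ?_⟩
  simp only [Functor.map_comp, Functor.map_preimage, Category.assoc, Iso.hom_inv_id_assoc]
  rw [← Category.assoc i, h, Category.id_comp, Iso.inv_hom_id, F.map_id]

section BaseChange

open DGCat

variable (K : Type w) (L : Type w') [Field K] [Field L] [Algebra K L]
  [FiniteDimensional K L] [Algebra.IsSeparable K L]
  (C : Type u) [Category.{v} C] [Abelian C] [Linear K C]

/-- A twisted complex of complexes of injective objects with an action of `L` is sent to its total
complex. -/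
def pretrToInj : DGFunctor (pretr ((injDG K C).scalarExt L)) (injDG L (ScalarModule K L C)) :=
  (lobjFunctor K L C).mapPretr.comp (Realization.tot injRealization)

lemma pretrToInj_fullyFaithful : (pretrToInj K L C).FullyFaithful :=
  (lobjFunctor_fullyFaithful K L C).mapPretr.comp (Realization.tot_fullyFaithful _)

variable {K C} in
/-- The total complex of a twisted complex with one term is this term. -/
def pretrToInjObjIso (Y : LObj (injDG K C) L) :
    (pretrToInj K L C).mapZ0.obj ⟨toPretr (A := (injDG K C).scalarExt L) Y⟩ ≅
      (lobjFunctor K L C).mapZ0.obj ⟨Y⟩ :=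
  Realization.isoToPretr (lobjFunctor K L C) Y (injRealization _)

/-- One-term twisted complexes suffice, so forming the pretriangulated hull adds nothing new up to
closed isomorphism. -/
instance : (pretrToInj K L C).mapZ0.EssSurj where
  mem_essImage Z := ⟨⟨toPretr (A := (injDG K C).scalarExt L)
      ((lobjFunctor K L C).mapZ0.objPreimage Z).obj⟩,
    ⟨pretrToInjObjIso L _ ≪≫ (lobjFunctor K L C).mapZ0.objObjPreimageIso Z⟩⟩

variable {K C} in
/-- Every twisted complex is a direct summand of some `L ⊗ X`. -/
lemma exists_retract_isTensor (M : Z0 (pretr ((injDG K C).scalarExt L))) :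
    ∃ (X : InjComplex C) (Y : LObj (injDG K C) L), IsTensor (A := injDG K C) X Y ∧
      ∃ (i : M ⟶ ⟨toPretr (A := (injDG K C).scalarExt L) Y⟩)
        (r : (⟨toPretr (A := (injDG K C).scalarExt L) Y⟩ : Z0 (pretr _)) ⟶ M), i ≫ r = 𝟙 M := by
  let Φ := (lobjFunctor K L C).mapZ0
  have := (pretrToInj_fullyFaithful K L C).fullZ0
  have := (pretrToInj_fullyFaithful K L C).faithfulZ0
  -- The total complex of `M` is itself an object with an action of $L$, so `M` may be replaced by
  -- the one-term complex on `Y`, for which the splitting is available.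
  let Y := Φ.objPreimage ((pretrToInj K L C).mapZ0.obj M)
  let S := (injRealization (Twisted.copies (A := injDG K C) Y.obj.obj
    (Module.finrank K L))).copies
  let b := Module.finBasis K L
  obtain ⟨i, r, h⟩ := LObj.exists_retract Y.obj S b
  exact ⟨Y.obj.obj, S.tensor b, S.isTensor b, exists_retract_of_map (pretrToInj K L C).mapZ0
    (Φ.objObjPreimageIso _) (pretrToInjObjIso L (S.tensor b)).symm (Φ.map i) (Φ.map r)
    ((Φ.map_comp i r).symm.trans ((congrArg Φ.map h).trans (Φ.map_id _)))⟩

-- Each object is a retract of a generator, so of the closure properties of a thick subcategory only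
-- the one for summands is used.
variable {K C} in
lemma thickClosure_baseChangeImage (M : H0 (pretr ((injDG K C).scalarExt L))) :
    (pretrTranslation ((injDG K C).scalarExt L)).thickClosure ((injDG K C).baseChangeImage L) M := by
  intro P hP hS
  obtain ⟨M, rfl⟩ := H0.exists_obj_eq M
  obtain ⟨X, Y, hY, i, r, h⟩ := exists_retract_isTensor L M
  exact hP.summand ((H0.quotient _).map i) ((H0.quotient _).map r)
    (((H0.quotient _).map_comp i r).symm.trans
      ((congrArg (H0.quotient _).map h).trans ((H0.quotient _).map_id _)))
    (hS _ ⟨X, Y, hY, rfl⟩)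

instance : ((pretrTranslation ((injDG K C).scalarExt L)).thickClosure
    ((injDG K C).baseChangeImage L)).ι.EssSurj where
  mem_essImage M := ⟨⟨M, thickClosure_baseChangeImage L M⟩, ⟨Iso.refl _⟩⟩

variable [HasDerivedCategory.{v'} (ScalarModule K L C)]

/-- The functor from the homotopy category of twisted complexes to the bounded derived category. -/
def pretrToBounded :
    H0 (pretr ((injDG K C).scalarExt L)) ⥤ DerivedCategory.Bounded (ScalarModule K L C) :=
  (pretrToInj K L C).mapH0 ⋙ injToBounded L (ScalarModule K L C)

instance : (pretrToBounded K L C).Full :=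
  have := (pretrToInj_fullyFaithful K L C).full
  inferInstanceAs ((pretrToInj K L C).mapH0 ⋙ injToBounded L (ScalarModule K L C)).Full

instance : (pretrToBounded K L C).Faithful :=
  have := (pretrToInj_fullyFaithful K L C).faithful
  inferInstanceAs ((pretrToInj K L C).mapH0 ⋙ injToBounded L (ScalarModule K L C)).Faithful

instance [EnoughInjectives C] : (pretrToBounded K L C).EssSurj :=
  have := (pretrToInj K L C).essSurj_mapH0
  inferInstanceAs ((pretrToInj K L C).mapH0 ⋙ injToBounded L (ScalarModule K L C)).EssSurj

instance : (pretrToBounded K L C).Linear L :=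
  inferInstanceAs (((pretrToInj K L C).mapH0 ⋙ injToBounded L (ScalarModule K L C)).Linear L)

/-- The functor `pretrToBounded` commutes with the translations. -/
def pretrToBoundedShift : (pretrTranslation ((injDG K C).scalarExt L)).functor ⋙
    pretrToBounded K L C ≅ pretrToBounded K L C ⋙
      shiftFunctor (DerivedCategory.Bounded (ScalarModule K L C)) (1 : ℤ) :=
  Functor.isoWhiskerRight ((pretrToInj K L C).shiftIso (pretrTranslation _)
    (injTranslation L (ScalarModule K L C))) (injToBounded L (ScalarModule K L C)) ≪≫
  Functor.isoWhiskerLeft (pretrToInj K L C).mapH0 injToBoundedShift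

variable {K L C} in
lemma pretrToBounded_distinguished {X Y Z : H0 (pretr ((injDG K C).scalarExt L))}
    {f : X ⟶ Y} {g : Y ⟶ Z}
    {h : Z ⟶ (pretrTranslation ((injDG K C).scalarExt L)).functor.obj X}
    (H : (pretrTranslation ((injDG K C).scalarExt L)).Distinguished f g h) :
    Pretriangulated.Triangle.mk ((pretrToBounded K L C).map f) ((pretrToBounded K L C).map g)
      ((pretrToBounded K L C).map h ≫ (pretrToBoundedShift K L C).hom.app X) ∈
        Pretriangulated.distinguishedTriangles := by
  have key := injToBounded_distinguished ((pretrToInj K L C).map_distinguished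
    (pretrTranslation _) (injTranslation L (ScalarModule K L C)) H)
  have e := (congrArg (· ≫ injToBoundedShift.hom.app ((pretrToInj K L C).mapH0.obj X))
    ((injToBounded L (ScalarModule K L C)).map_comp ((pretrToInj K L C).mapH0.map h)
      (((pretrToInj K L C).shiftIso (pretrTranslation _)
        (injTranslation L (ScalarModule K L C))).hom.app X))).trans (Category.assoc _ _ _)
  exact e ▸ key

-- Reflection of triangles requires cones of twisted complexes; they are pulled back from mapping
-- cones along the DG-equivalence `pretrToInj`.
variable {K L C} in
lemma pretrToBounded_distinguished_iff {X Y Z : H0 (pretr ((injDG K C).scalarExt L))}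
    (f : X ⟶ Y) (g : Y ⟶ Z)
    (h : Z ⟶ (pretrTranslation ((injDG K C).scalarExt L)).functor.obj X) :
    (pretrTranslation ((injDG K C).scalarExt L)).Distinguished f g h ↔
    Pretriangulated.Triangle.mk ((pretrToBounded K L C).map f) ((pretrToBounded K L C).map g)
      ((pretrToBounded K L C).map h ≫ (pretrToBoundedShift K L C).hom.app X) ∈
        Pretriangulated.distinguishedTriangles :=
  Translation.distinguished_iff_map _
    (fun f => (pretrToInj_fullyFaithful K L C).exists_cone_of_essSurj exists_injCone f)
    (pretrToBounded K L C) (pretrToBoundedShift K L C) pretrToBounded_distinguished f g h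

/-- The functor from the base change to the bounded derived category of module objects. -/
def baseChangeToBounded :
    (injDG K C).BaseChange L ⥤ DerivedCategory.Bounded (ScalarModule K L C) :=
  ObjectProperty.ι _ ⋙ pretrToBounded K L C

instance [EnoughInjectives C] : (baseChangeToBounded K L C).IsEquivalence where
  full := inferInstanceAs (ObjectProperty.ι _ ⋙ pretrToBounded K L C).Full
  faithful := inferInstanceAs (ObjectProperty.ι _ ⋙ pretrToBounded K L C).Faithful
  essSurj := inferInstanceAs (ObjectProperty.ι _ ⋙ pretrToBounded K L C).EssSurj

instance : (baseChangeToBounded K L C).Linear L :=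
  inferInstanceAs ((ObjectProperty.ι _ ⋙ pretrToBounded K L C).Linear L)

/-- The functor `baseChangeToBounded` commutes with the translations. -/
def baseChangeToBoundedShift : (injDG K C).baseChangeShift L ⋙ baseChangeToBounded K L C ≅
    baseChangeToBounded K L C ⋙
      shiftFunctor (DerivedCategory.Bounded (ScalarModule K L C)) (1 : ℤ) :=
  Functor.isoWhiskerLeft (ObjectProperty.ι _) (pretrToBoundedShift K L C)

end BaseChange

end

theorem mainTheorem5 (K : Type w) (L : Type w') [Field K] [Field L] [Algebra K L]
    [FiniteDimensional K L] [Algebra.IsSeparable K L]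
    (C : Type u) [Category.{v} C] [Abelian C] [Linear K C] [EnoughInjectives C]
    {ι : Type u'} (G : ι → C) (hG : (ObjectProperty.ofObj G).IsSeparating)
    [HasDerivedCategory.{v'} (ScalarModule K L C)] :
    ∃ (e : (injDG K C).BaseChange L ≌ DerivedCategory.Bounded (ScalarModule K L C))
      (φ : (injDG K C).baseChangeShift L ⋙ e.functor ≅
        e.functor ⋙ shiftFunctor (DerivedCategory.Bounded (ScalarModule K L C)) (1 : ℤ)),
      e.functor.Linear L ∧
      ∀ {X Y Z : (injDG K C).BaseChange L} (f : X ⟶ Y) (g : Y ⟶ Z)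
        (h : Z ⟶ ((injDG K C).baseChangeShift L).obj X),
        (injDG K C).BaseChangeDistinguished L f g h ↔
          Pretriangulated.Triangle.mk (e.functor.map f) (e.functor.map g)
            (e.functor.map h ≫ φ.hom.app X) ∈
              Pretriangulated.distinguishedTriangles :=
  -- Triangles of the base change are tested in the ambient homotopy category, so the criterion
  -- there applies to the underlying morphisms.
  ⟨(baseChangeToBounded K L C).asEquivalence, baseChangeToBoundedShift K L C,
    inferInstanceAs ((baseChangeToBounded K L C).Linear L),
    fun f g h => pretrToBounded_distinguished_iff f.hom g.hom h.hom⟩
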